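/- Let $W\colon(0,\infty)^2\to\mathbb R$ be continuous, symmetric, homogeneous of degree zero (that is, $W(\lambda x,\lambda y)=W(x,y)$ for all $\lambda,x,y>0$) and such that $0\le W\le 1$, and put $K_\varepsilon=2+\varepsilon W$ for $\varepsilon\ge 0$. For $G\in L^1((0,\infty),(1+x)\,dx)$ let $$\mathcal C_{\varepsilon}(G,G)(x)=\frac12\int_0^x K_\varepsilon(x-y,y)\,G(x-y)\,G(y)\,dy-G(x)\int_0^\infty K_\varepsilon(x,y)\,G(y)\,dy .$$ A self-similar profile of Smoluchowski's coagulation equation with kernel $K_\varepsilon$ is a nonnegative $G\in L^1((0,\infty),(1+x)\,dx)$ which is a stationary mild solution of $\partial_t f=\mathcal C_{\varepsilon}(f,f)+2f+x\,\partial_x f$, that is, $$G=S_tG+\int_0^t S_{t-s}\,\mathcal C_{\varepsilon}(G,G)\,ds\quad\text{for all } t\ge 0,\qquad (S_th)(x)=e^{2t}h(e^tx);$$ its mass is $\int_0^\infty xG(x)\,dx$. There exists $\varepsilon_1>0$, independent of $W$, such that for every such $W$ and all $0\le\varepsilon\le\varepsilon_1$ Smoluchowski's coagulation equation with kernel $K_\varepsilon$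 has exactly one self-similar profile with mass $1$ (as an element of $L^1((0,\infty),(1+x)\,dx)$, that is, up to equality almost everywhere). -/

import Mathlib

open MeasureTheory Set

namespace Smoluchowski

/-- The admissible perturbations `W : (0,∞) × (0,∞) → [0,1]`: continuous, symmetric and homogeneous
of degree zero.  Only the values of `W` at positive arguments play a role. -/
structure IsPerturbation (W : ℝ → ℝ → ℝ) : Prop where
  continuousOn : ContinuousOn (Function.uncurry W) (Ioi 0 ×ˢ Ioi 0)
  symm : ∀ x y : ℝ, 0 < x → 0 < y → W x y = W y x
  nonneg : ∀ x y : ℝ, 0 < x → 0 < y → 0 ≤ W x y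
  le_one : ∀ x y : ℝ, 0 < x → 0 < y → W x y ≤ 1
  homogeneous : ∀ l x y : ℝ, 0 < l → 0 < x → 0 < y → W (l * x) (l * y) = W x y

/-- The kernel `K_ε = 2 + ε W`. -/
def kernel (W : ℝ → ℝ → ℝ) (ε : ℝ) : ℝ → ℝ → ℝ := fun x y => 2 + ε * W x y

/-- The coagulation operator
`C_K(f,f)(x) = 1/2 ∫_0^x K(x-y,y) f(x-y) f(y) dy - f(x) ∫_0^∞ K(x,y) f(y) dy`. -/
noncomputable def coag (K : ℝ → ℝ → ℝ) (f : ℝ → ℝ) (x : ℝ) : ℝ :=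
  (1 / 2) * (∫ y in Ioo 0 x, K (x - y) y * f (x - y) * f y)
    - f x * ∫ y in Ioi 0, K x y * f y

/-- The semigroup `(S_t h)(x) = e^{2t} h(e^t x)` generated by `h ↦ 2h + x h'`. -/
noncomputable def semigroup (t : ℝ) (h : ℝ → ℝ) (x : ℝ) : ℝ :=
  Real.exp (2 * t) * h (Real.exp t * x)

/-- `G ∈ L¹((0,∞), (1+x) dx)`. -/
def MemL11 (G : ℝ → ℝ) : Prop :=
  IntegrableOn (fun x => G x * (1 + x)) (Ioi 0)

/-- `G` is a self-similar profile for the kernel `K`: a nonnegative element of `L¹((1+x) dx)` which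
is a stationary mild solution of the self-similar Smoluchowski equation
`∂ₜ f = C_K(f,f) + 2f + x ∂ₓ f`, that is, `G = S_t G + ∫_0^t S_{t-s} C_K(G,G) ds` for all `t ≥ 0`.
The equality in `L¹((1+x) dx)` is an equality for almost every `x > 0`, where the `L¹`-valued
integral in `s` is computed pointwise. -/
structure IsProfile (K : ℝ → ℝ → ℝ) (G : ℝ → ℝ) : Prop where
  memL11 : MemL11 G
  nonneg : ∀ᵐ x ∂(volume.restrict (Ioi (0 : ℝ))), 0 ≤ G x
  mild : ∀ t : ℝ, 0 ≤ t → ∀ᵐ x ∂(volume.restrict (Ioi (0 : ℝ))),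
    G x = semigroup t G x + ∫ s in (0 : ℝ)..t, semigroup (t - s) (coag K G) x

/-- The mass (first moment) `∫_0^∞ x f(x) dx`. -/
noncomputable def mass (f : ℝ → ℝ) : ℝ := ∫ x in Ioi 0, x * f x

end Smoluchowski

/-! Along the dilations x ↦ e^t x the mild equation is a conservation law. Letting t → ∞ in it shows
that profiles are the nonnegative solutions of x²G(x) = ∬_{y<x<y+z} y K(y,z) G(y)G(z) dy dz: the
mass flux of coagulation across x balances the dilation (`IsProfile.eq_gain`,
`isProfile_of_eq_gain`). So G = B_K(G,G) with B_K the bilinear operator `gain`, which is bounded by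
sup |K| on X = L¹((1+x²)dx) (`gain_memX`). For K = 2 the solution of mass one is e^{-x}, and the
proof perturbs from it. Only 0 ≤ W ≤ 1 enters the constants, so they do not depend on W.

Every profile is close to e^{-x}. For U(p) = ∫(1-e^{-px})G dx the equation yields U² ≤ U - pU' ≤
(1+ε/2)U², hence p/U has slope between 1 and 1+ε/2 and, by the mass condition, limit 1 at p = 0
(`IsProfile.bern_bounds`). This bounds ∫G and ∫x²G. For a sequence of profiles with ε → 0 the
Laplace transforms of xG converge; xG is bounded, so it converges weakly; the flux equation upgrades
this to pointwise convergence, and a Scheffé argument with the moment bounds to convergence in X. By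
contradiction the closeness is uniform in W (`exists_forall_profile_close`).

The linearization h ↦ h - 2B_1(e^{-x},h) - 2B_1(h,e^{-x}) annihilates (1-x)e^{-x}, the derivative in
λ of the family λe^{-λx} of solutions; requiring h to have mass zero removes this direction.
Injectivity follows from a first-order equation for the Bernstein transform
(`eq_zero_of_linearized`). Solvability with a bound in X comes from an explicit formula in terms of
tail integrals (`exists_linearized_solution`). Hence fixed points of equal mass near e^{-x} coincide
(`ae_eq_of_eq_gain`), and a contraction argument produces one of mass one (`exists_eq_gain`).

The fixed point so obtained has no sign a priori, and `nonneg_of_eq_gain` supplies it. Near 0 the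
flux is a nearly constant multiple of the signed mass below x, and a cone argument excludes sign
changes; up to x = 10 the inner interaction integral stays positive and a Gronwall-type step
propagates nonnegativity; beyond 10 the factor 1/x makes the negative part smaller than itself. -/

namespace Smoluchowski
open Filter Topology

/-! ### Bounded kernels, the mass flux and its weak formulation -/

/-- Lebesgue measure on the positive half-line. -/
noncomputable abbrev posVol : Measure ℝ := volume.restrict (Ioi (0 : ℝ))

/-- Lebesgue measure on the positive quadrant. -/
noncomputable abbrev quadVol : Measure (ℝ × ℝ) := posVol.prod posVol

lemma ae_pos : ∀ᵐ x ∂posVol, 0 < x := ae_restrict_mem measurableSet_Ioi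

lemma ae_quad_pos : ∀ᵐ q ∂quadVol, 0 < q.1 ∧ 0 < q.2 := by
  have h1 : ∀ᵐ q ∂quadVol, 0 < q.1 := Measure.quasiMeasurePreserving_fst.ae ae_pos
  have h2 : ∀ᵐ q ∂quadVol, 0 < q.2 := Measure.quasiMeasurePreserving_snd.ae ae_pos
  filter_upwards [h1, h2] with q a b using ⟨a, b⟩

/-- A kernel which is measurable and bounded by `M` on the positive quadrant. -/
structure BddKernel (K : ℝ → ℝ → ℝ) (M : ℝ) : Prop where
  aesm : AEStronglyMeasurable (fun q : ℝ × ℝ => K q.1 q.2) quadVol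
  bound : ∀ x y : ℝ, 0 < x → 0 < y → |K x y| ≤ M

/-- The density of coagulation events which feed the mass flux. -/
def pairing (K : ℝ → ℝ → ℝ) (a b : ℝ → ℝ) (q : ℝ × ℝ) : ℝ := K q.1 q.2 * (a q.1 * b q.2)

/-- The pairs of sizes whose coagulation transports mass across `x`. -/
def crossing (x : ℝ) : Set (ℝ × ℝ) := {q | q.1 < x ∧ x < q.1 + q.2}

/-- The mass flux across `x` produced by the coagulation of `a` with `b`. -/
noncomputable def flux (K : ℝ → ℝ → ℝ) (a b : ℝ → ℝ) (x : ℝ) : ℝ :=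
  ∫ q, (crossing x).indicator (fun q => q.1 * pairing K a b q) q ∂quadVol

/-- The bilinear operator whose quadratic fixed points are the self-similar profiles. -/
noncomputable def gain (K : ℝ → ℝ → ℝ) (a b : ℝ → ℝ) (x : ℝ) : ℝ := flux K a b x / x ^ 2

lemma measurableSet_crossing (x : ℝ) : MeasurableSet (crossing x) :=
  (measurableSet_lt measurable_fst measurable_const).inter
    (measurableSet_lt measurable_const (measurable_fst.add measurable_snd))

lemma measurableSet_crossing_uncurry :
    MeasurableSet {p : ℝ × (ℝ × ℝ) | p.2.1 < p.1 ∧ p.1 < p.2.1 + p.2.2} :=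
  (measurableSet_lt (measurable_fst.comp measurable_snd) measurable_fst).inter
    (measurableSet_lt measurable_fst
      ((measurable_fst.comp measurable_snd).add (measurable_snd.comp measurable_snd)))

lemma BddKernel.nonneg {K : ℝ → ℝ → ℝ} {M : ℝ} (hK : BddKernel K M) : 0 ≤ M :=
  (abs_nonneg _).trans (hK.bound 1 1 one_pos one_pos)

lemma BddKernel.aesm_pairing {K : ℝ → ℝ → ℝ} {M : ℝ} (hK : BddKernel K M) {a b : ℝ → ℝ}
    (ha : AEStronglyMeasurable a posVol) (hb : AEStronglyMeasurable b posVol) :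
    AEStronglyMeasurable (pairing K a b) quadVol :=
  hK.aesm.mul (ha.comp_fst.mul hb.comp_snd)

/-- The kernel bound and the product bound on φ dominate the integrand by a tensor product, whose
integral factorises. It serves for the weights 1, 1 + x, 1 + x² and x alike. -/
lemma BddKernel.integrable_weight {K : ℝ → ℝ → ℝ} {M : ℝ} (hK : BddKernel K M) {a b w₁ w₂ : ℝ → ℝ}
    (ha : AEStronglyMeasurable a posVol) (hb : AEStronglyMeasurable b posVol)
    (haw : Integrable (fun y => |a y| * w₁ y) posVol)
    (hbw : Integrable (fun y => |b y| * w₂ y) posVol)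
    {φ : ℝ × ℝ → ℝ} (hφ : AEStronglyMeasurable φ quadVol)
    (hle : ∀ y z : ℝ, 0 < y → 0 < z → |φ (y, z)| ≤ w₁ y * w₂ z) :
    Integrable (fun q => φ q * pairing K a b q) quadVol ∧
      ∫ q, |φ q * pairing K a b q| ∂quadVol
        ≤ M * ((∫ y, |a y| * w₁ y ∂posVol) * ∫ z, |b z| * w₂ z ∂posVol) := by
  have hi : Integrable (fun q : ℝ × ℝ => M * ((|a q.1| * w₁ q.1) * (|b q.2| * w₂ q.2))) quadVol :=
    (haw.mul_prod hbw).const_mul M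
  have hb' : ∀ᵐ q ∂quadVol, |φ q * pairing K a b q|
      ≤ M * ((|a q.1| * w₁ q.1) * (|b q.2| * w₂ q.2)) := by
    filter_upwards [ae_quad_pos] with q hq
    have h1 := hle q.1 q.2 hq.1 hq.2
    have h2 := hK.bound q.1 q.2 hq.1 hq.2
    rw [pairing, abs_mul, abs_mul, abs_mul]
    calc |φ q| * (|K q.1 q.2| * (|a q.1| * |b q.2|))
        ≤ (w₁ q.1 * w₂ q.2) * (M * (|a q.1| * |b q.2|)) := by
          gcongr
          exact (abs_nonneg _).trans h1
      _ = _ := by ring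
  have hint : Integrable (fun q => φ q * pairing K a b q) quadVol :=
    hi.mono' (hφ.mul (hK.aesm_pairing ha hb)) hb'
  refine ⟨hint, ?_⟩
  calc _ ≤ ∫ q : ℝ × ℝ, M * ((|a q.1| * w₁ q.1) * (|b q.2| * w₂ q.2)) ∂quadVol :=
        integral_mono_ae hint.abs hi hb'
    _ = _ := by
        rw [integral_const_mul]
        congr 1
        exact integral_prod_mul (fun y => |a y| * w₁ y) (fun z => |b z| * w₂ z)

lemma BddKernel.integrable_pairing {K : ℝ → ℝ → ℝ} {M : ℝ} (hK : BddKernel K M) {a b : ℝ → ℝ}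
    (ha : Integrable a posVol) (hb : Integrable b posVol) :
    Integrable (pairing K a b) quadVol := by
  have := (hK.integrable_weight (w₁ := fun _ => 1) (w₂ := fun _ => 1) (φ := fun _ => 1) ha.1 hb.1
    (by simpa using ha.abs) (by simpa using hb.abs) aestronglyMeasurable_const (by simp)).1
  simpa using this

lemma BddKernel.integrable_crossing {K : ℝ → ℝ → ℝ} {M : ℝ} (hK : BddKernel K M) {a b : ℝ → ℝ}
    (ha : Integrable a posVol) (hb : Integrable b posVol) (x : ℝ) :
    Integrable ((crossing x).indicator (fun q => q.1 * pairing K a b q)) quadVol := by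
  refine Integrable.mono' ((hK.integrable_pairing ha hb).abs.const_mul |x|)
    (AEStronglyMeasurable.indicator
      (measurable_fst.aestronglyMeasurable.mul (hK.aesm_pairing ha.1 hb.1))
      (measurableSet_crossing x)) ?_
  filter_upwards [ae_quad_pos] with q hq
  by_cases h : q ∈ crossing x
  · rw [indicator_of_mem h, norm_mul]
    have : ‖q.1‖ ≤ |x| := by
      rw [Real.norm_eq_abs, abs_of_pos hq.1]
      exact h.1.le.trans (le_abs_self x)
    exact mul_le_mul_of_nonneg_right this (abs_nonneg _)
  · rw [indicator_of_notMem h, norm_zero]; positivity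

/-- Testing the mass flux against a weight. -/
theorem flux_test {K : ℝ → ℝ → ℝ} {M : ℝ} (hK : BddKernel K M) {a b θ w₁ w₂ : ℝ → ℝ}
    (hθm : Measurable θ) (hθi : ∀ y z : ℝ, 0 < y → 0 < z → IntegrableOn θ (Ioo y (y + z)))
    (hθ : ∀ y z : ℝ, 0 < y → 0 < z → y * ∫ x in Ioo y (y + z), |θ x| ≤ w₁ y * w₂ z)
    (ha : AEStronglyMeasurable a posVol) (hb : AEStronglyMeasurable b posVol)
    (haw : Integrable (fun y => |a y| * w₁ y) posVol)
    (hbw : Integrable (fun y => |b y| * w₂ y) posVol) :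
    Integrable (fun x => θ x * flux K a b x) posVol ∧
    ∫ x, |θ x * flux K a b x| ∂posVol
      ≤ M * ((∫ y, |a y| * w₁ y ∂posVol) * ∫ z, |b z| * w₂ z ∂posVol) ∧
    ∫ x, θ x * flux K a b x ∂posVol
      = ∫ q, (q.1 * ∫ x in Ioo q.1 (q.1 + q.2), θ x) * pairing K a b q ∂quadVol := by
  set S : Set (ℝ × (ℝ × ℝ)) := {p | p.2.1 < p.1 ∧ p.1 < p.2.1 + p.2.2} with hS
  have hSm : MeasurableSet S := measurableSet_crossing_uncurry
  -- Everything follows from Fubini for this integrand in (x, (y, z)): integrating out (y, z) gives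
  -- θ times the flux, integrating out x gives y ∫ θ over (y, y + z).
  set F : ℝ × (ℝ × ℝ) → ℝ := S.indicator (fun p => θ p.1 * (p.2.1 * pairing K a b p.2)) with hF
  have hFm : AEStronglyMeasurable F (posVol.prod quadVol) := by
    refine AEStronglyMeasurable.indicator ?_ hSm
    refine (hθm.comp measurable_fst).aestronglyMeasurable.mul ?_
    exact (measurable_fst.aestronglyMeasurable.mul (hK.aesm_pairing ha hb)).comp_snd
  have hslice : ∀ q x, F (x, q) = (Ioo q.1 (q.1 + q.2)).indicator θ x * (q.1 * pairing K a b q) := by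
    intro q x
    by_cases h : q.1 < x ∧ x < q.1 + q.2
    · rw [hF, indicator_of_mem (show (x, q) ∈ S from h), indicator_of_mem (show x ∈ Ioo _ _ from h)]
    · rw [hF, indicator_of_notMem (show (x, q) ∉ S from h),
        indicator_of_notMem (show x ∉ Ioo _ _ from h), zero_mul]
  have hrow : ∀ x q, F (x, q) = θ x * (crossing x).indicator (fun q => q.1 * pairing K a b q) q := by
    intro x q
    by_cases h : q.1 < x ∧ x < q.1 + q.2
    · rw [hF, indicator_of_mem (show (x, q) ∈ S from h), indicator_of_mem (show q ∈ crossing x from h)]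
    · rw [hF, indicator_of_notMem (show (x, q) ∉ S from h),
        indicator_of_notMem (show q ∉ crossing x from h), mul_zero]
  have hres : ∀ q : ℝ × ℝ, 0 < q.1 → posVol.restrict (Ioo q.1 (q.1 + q.2))
      = volume.restrict (Ioo q.1 (q.1 + q.2)) := by
    intro q hq
    rw [Measure.restrict_restrict measurableSet_Ioo, inter_eq_left.2]
    exact fun x hx => hq.trans hx.1
  have hindi : ∀ g : ℝ → ℝ, ∀ q : ℝ × ℝ, 0 < q.1 →
      ∫ x, (Ioo q.1 (q.1 + q.2)).indicator g x ∂posVol = ∫ x in Ioo q.1 (q.1 + q.2), g x := by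
    intro g q hq
    rw [integral_indicator measurableSet_Ioo, hres q hq]
  have hnorm : ∀ᵐ q ∂quadVol, ∫ x, ‖F (x, q)‖ ∂posVol
      = |q.1 * ∫ x in Ioo q.1 (q.1 + q.2), (|θ x| : ℝ)| * |pairing K a b q| := by
    filter_upwards [ae_quad_pos] with q hq
    have : ∀ x, ‖F (x, q)‖ = (Ioo q.1 (q.1 + q.2)).indicator (fun x => |θ x|) x
        * |q.1 * pairing K a b q| := by
      intro x
      rw [hslice, norm_mul, norm_indicator_eq_indicator_norm]; rfl
    simp_rw [this]
    rw [integral_mul_const, hindi _ q hq.1, abs_mul, abs_mul,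
      abs_of_nonneg (integral_nonneg fun x => abs_nonneg (θ x))]
    ring
  have hφm : AEStronglyMeasurable (fun q : ℝ × ℝ => q.1 * ∫ x in Ioo q.1 (q.1 + q.2), |θ x|)
      quadVol := by
    have h1 : Measurable (fun p : (ℝ × ℝ) × ℝ => {p : (ℝ × ℝ) × ℝ | p.1.1 < p.2 ∧ p.2 < p.1.1 + p.1.2}.indicator
        (fun p => |θ p.2|) p) := by
      refine Measurable.indicator (by fun_prop) ?_
      exact (measurableSet_lt (measurable_fst.comp measurable_fst) measurable_snd).inter
        (measurableSet_lt measurable_snd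
          ((measurable_fst.comp measurable_fst).add (measurable_snd.comp measurable_fst)))
    have h2 : StronglyMeasurable (fun q : ℝ × ℝ => ∫ x, {p : (ℝ × ℝ) × ℝ | p.1.1 < p.2 ∧ p.2 < p.1.1 + p.1.2}.indicator
        (fun p => |θ p.2|) (q, x)) := h1.stronglyMeasurable.integral_prod_right
    refine (measurable_fst.mul h2.measurable).aestronglyMeasurable.congr ?_
    refine Filter.Eventually.of_forall fun q => ?_
    simp only [Pi.mul_apply]
    congr 1
    rw [← integral_indicator measurableSet_Ioo]
    rfl
  have hW := hK.integrable_weight ha hb haw hbw hφm (fun y z hy hz => by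
    rw [abs_of_nonneg (mul_nonneg hy.le (integral_nonneg fun x => abs_nonneg (θ x)))]
    exact hθ y z hy hz)
  have hFi : Integrable F (posVol.prod quadVol) := by
    rw [integrable_prod_iff' hFm]
    constructor
    · filter_upwards [ae_quad_pos] with q hq
      simp_rw [hslice]
      refine Integrable.mul_const ?_ _
      rw [integrable_indicator_iff measurableSet_Ioo, IntegrableOn, hres q hq.1]
      exact hθi _ _ hq.1 hq.2
    · refine hW.1.abs.congr ?_
      filter_upwards [hnorm] with q hq
      rw [hq, abs_mul]
  have hinner : ∀ x, ∫ q, F (x, q) ∂quadVol = θ x * flux K a b x := by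
    intro x
    simp_rw [hrow]
    rw [integral_const_mul, flux]
  refine ⟨?_, ?_, ?_⟩
  · simpa only [hinner] using hFi.integral_prod_left
  · calc ∫ x, |θ x * flux K a b x| ∂posVol ≤ ∫ x, ∫ q, ‖F (x, q)‖ ∂quadVol ∂posVol := by
          refine integral_mono (by simpa only [hinner] using hFi.integral_prod_left.abs)
            hFi.norm.integral_prod_left fun x => ?_
          change |θ x * flux K a b x| ≤ ∫ q, ‖F (x, q)‖ ∂quadVol
          rw [← hinner]
          exact norm_integral_le_integral_norm (fun q => F (x, q))
      _ = ∫ q, ∫ x, ‖F (x, q)‖ ∂posVol ∂quadVol :=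
          integral_integral_swap (f := fun x q => ‖F (x, q)‖) hFi.norm
      _ = ∫ q, |(q.1 * ∫ x in Ioo q.1 (q.1 + q.2), |θ x|) * pairing K a b q| ∂quadVol := by
          refine integral_congr_ae ?_
          filter_upwards [hnorm] with q hq
          rw [hq]; exact (abs_mul _ _).symm
      _ ≤ _ := hW.2
  · simp_rw [← hinner]
    rw [integral_integral_swap (f := fun x q => F (x, q)) hFi]
    refine integral_congr_ae ?_
    filter_upwards [ae_quad_pos] with q hq
    simp_rw [hslice]
    rw [integral_mul_const, hindi _ q hq.1]
    ring

/-! ### The weighted space and the boundedness of the gain operator -/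

/-- Membership in `L¹((0,∞), (1+x²) dx)`. -/
def MemX (a : ℝ → ℝ) : Prop := Integrable (fun x => a x * (1 + x ^ 2)) posVol

/-- The norm of `L¹((0,∞), (1+x²) dx)`. -/
noncomputable def nX (a : ℝ → ℝ) : ℝ := ∫ x, |a x| * (1 + x ^ 2) ∂posVol

lemma aesm_of_mul {a w : ℝ → ℝ} (hw : Measurable w) (hpos : ∀ x, 0 < x → w x ≠ 0)
    (h : AEStronglyMeasurable (fun x => a x * w x) posVol) : AEStronglyMeasurable a posVol := by
  refine (h.mul hw.inv.aestronglyMeasurable).congr ?_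
  filter_upwards [ae_pos] with x hx
  simp only [Pi.mul_apply, Pi.inv_apply]
  field_simp [hpos x hx]

lemma MemX.aesm {a : ℝ → ℝ} (h : MemX a) : AEStronglyMeasurable a posVol :=
  aesm_of_mul (w := fun x => 1 + x ^ 2) (by fun_prop) (fun x _ => by positivity) h.1

lemma MemX.integrable_abs {a : ℝ → ℝ} (h : MemX a) :
    Integrable (fun x => |a x| * (1 + x ^ 2)) posVol := by
  refine h.abs.congr (Filter.Eventually.of_forall fun x => ?_)
  simp only [abs_mul]
  rw [abs_of_pos (by positivity : (0 : ℝ) < 1 + x ^ 2)]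

lemma memX_of_abs {a : ℝ → ℝ} (ha : AEStronglyMeasurable a posVol)
    (h : Integrable (fun x => |a x| * (1 + x ^ 2)) posVol) : MemX a := by
  refine h.mono (ha.mul (by fun_prop)) (Filter.Eventually.of_forall fun x => ?_)
  simp only [norm_mul, Real.norm_eq_abs, abs_abs]
  exact le_rfl

lemma MemX.integrable_mul {a : ℝ → ℝ} (h : MemX a) {φ : ℝ → ℝ}
    (hφ : AEStronglyMeasurable φ posVol) {C : ℝ} (hle : ∀ x, 0 < x → |φ x| ≤ C * (1 + x ^ 2)) :
    Integrable (fun x => φ x * a x) posVol := by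
  refine (h.integrable_abs.const_mul C).mono' (hφ.mul h.aesm) ?_
  filter_upwards [ae_pos] with x hx
  rw [norm_mul, Real.norm_eq_abs, Real.norm_eq_abs]
  nlinarith [hle x hx, abs_nonneg (a x), mul_le_mul_of_nonneg_right (hle x hx) (abs_nonneg (a x))]

lemma MemX.integral_mul_le {a : ℝ → ℝ} (h : MemX a) {φ : ℝ → ℝ}
    (hφ : AEStronglyMeasurable φ posVol) {C : ℝ} (hle : ∀ x, 0 < x → |φ x| ≤ C * (1 + x ^ 2)) :
    ∫ x, |φ x * a x| ∂posVol ≤ C * nX a := by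
  rw [nX, ← integral_const_mul]
  refine integral_mono_ae (h.integrable_mul hφ hle).abs (h.integrable_abs.const_mul C) ?_
  filter_upwards [ae_pos] with x hx
  rw [abs_mul]
  nlinarith [hle x hx, abs_nonneg (a x), mul_le_mul_of_nonneg_right (hle x hx) (abs_nonneg (a x))]

lemma MemX.integrable {a : ℝ → ℝ} (h : MemX a) : Integrable a posVol := by
  have := h.integrable_mul (φ := fun _ => 1) (by fun_prop) (C := 1) (fun x _ => by
    rw [abs_one]; nlinarith [sq_nonneg x])
  simpa using this

lemma MemX.integrable_id {a : ℝ → ℝ} (h : MemX a) : Integrable (fun x => x * a x) posVol :=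
  h.integrable_mul (φ := fun x => x) (by fun_prop) (C := 1) (fun x hx => by
    rw [abs_of_pos hx]; nlinarith [sq_nonneg (x - 1)])

lemma nX_nonneg (a : ℝ → ℝ) : 0 ≤ nX a := integral_nonneg fun x => by positivity

lemma MemX.integral_abs_le {a : ℝ → ℝ} (h : MemX a) : ∫ x, |a x| ∂posVol ≤ nX a := by
  have := h.integral_mul_le (φ := fun _ => 1) (by fun_prop) (C := 1) (fun x _ => by
    rw [abs_one]; nlinarith [sq_nonneg x])
  simpa using this

lemma MemX.integral_id_le {a : ℝ → ℝ} (h : MemX a) : ∫ x, |x * a x| ∂posVol ≤ nX a := by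
  have := h.integral_mul_le (φ := fun x => x) (by fun_prop) (C := 1) (fun x hx => by
    rw [abs_of_pos hx]; nlinarith [sq_nonneg (x - 1)])
  simpa using this

lemma MemX.add {a b : ℝ → ℝ} (ha : MemX a) (hb : MemX b) : MemX (fun x => a x + b x) := by
  refine (Integrable.add ha hb).congr (Filter.Eventually.of_forall fun x => ?_)
  simp only [Pi.add_apply]; ring

lemma MemX.sub {a b : ℝ → ℝ} (ha : MemX a) (hb : MemX b) : MemX (fun x => a x - b x) := by
  refine (Integrable.sub ha hb).congr (Filter.Eventually.of_forall fun x => ?_)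
  simp only [Pi.sub_apply]; ring

lemma MemX.const_mul {a : ℝ → ℝ} (ha : MemX a) (c : ℝ) : MemX (fun x => c * a x) := by
  refine (Integrable.const_mul ha c).congr (Filter.Eventually.of_forall fun x => ?_)
  simp only; ring

lemma nX_congr {a b : ℝ → ℝ} (h : a =ᵐ[posVol] b) : nX a = nX b :=
  integral_congr_ae (by filter_upwards [h] with x hx; rw [hx])

lemma nX_add_le {a b : ℝ → ℝ} (ha : MemX a) (hb : MemX b) :
    nX (fun x => a x + b x) ≤ nX a + nX b := by
  rw [nX, nX, nX, ← integral_add ha.integrable_abs hb.integrable_abs]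
  refine integral_mono (ha.add hb).integrable_abs (ha.integrable_abs.add hb.integrable_abs) fun x => ?_
  simp only
  nlinarith [abs_add_le (a x) (b x), sq_nonneg x]

lemma nX_const_mul (c : ℝ) (a : ℝ → ℝ) : nX (fun x => c * a x) = |c| * nX a := by
  rw [nX, nX, ← integral_const_mul]
  refine integral_congr_ae (Filter.Eventually.of_forall fun x => ?_)
  simp only [abs_mul]; ring

lemma nX_sub_le {a b : ℝ → ℝ} (ha : MemX a) (hb : MemX b) :
    nX (fun x => a x - b x) ≤ nX a + nX b := by
  have h := nX_add_le ha (hb.const_mul (-1))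
  rw [nX_const_mul] at h
  simpa [sub_eq_add_neg] using h

lemma nX_eq_zero {a : ℝ → ℝ} (ha : MemX a) (h : nX a ≤ 0) : a =ᵐ[posVol] 0 := by
  have h0 : nX a = 0 := le_antisymm h (nX_nonneg a)
  rw [nX, integral_eq_zero_iff_of_nonneg (fun x => by positivity) ha.integrable_abs] at h0
  filter_upwards [h0] with x hx
  have : |a x| = 0 := by
    rcases mul_eq_zero.1 hx with h | h
    · exact h
    · nlinarith [sq_nonneg x]
  simpa using this

lemma integral_Ioo_inv_sq {y z : ℝ} (hy : 0 < y) (hz : 0 < z) :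
    IntegrableOn (fun x : ℝ => (1 + x ^ 2) / x ^ 2) (Ioo y (y + z)) ∧
      ∫ x in Ioo y (y + z), (1 + x ^ 2) / x ^ 2 = 1 / y - 1 / (y + z) + z := by
  have hd : ∀ x ∈ uIcc y (y + z), HasDerivAt (fun x : ℝ => x - 1 / x) ((1 + x ^ 2) / x ^ 2) x := by
    intro x hx
    rw [uIcc_of_le (by linarith)] at hx
    have hx0 : x ≠ 0 := (hy.trans_le hx.1).ne'
    have := (hasDerivAt_id x).sub (hasDerivAt_inv hx0)
    have h2 : (fun x : ℝ => x - 1 / x) = id - fun y => y⁻¹ := by ext t; simp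
    rw [h2]
    refine this.congr_deriv ?_
    field_simp
    ring
  have hc : ContinuousOn (fun x : ℝ => (1 + x ^ 2) / x ^ 2) (uIcc y (y + z)) := by
    refine ContinuousOn.div (by fun_prop) (by fun_prop) fun x hx => ?_
    rw [uIcc_of_le (by linarith)] at hx
    have := hy.trans_le hx.1
    positivity
  have hI : IntervalIntegrable (fun x : ℝ => (1 + x ^ 2) / x ^ 2) volume y (y + z) :=
    hc.intervalIntegrable
  constructor
  · exact ((intervalIntegrable_iff_integrableOn_Ioo_of_le (by linarith)).1 hI)
  · rw [← integral_Ioc_eq_integral_Ioo, ← intervalIntegral.integral_of_le (by linarith),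
      intervalIntegral.integral_eq_sub_of_hasDerivAt hd hI]
    ring

/-- Testing the flux with (1 + x²)/x² produces the weight y(1/y - 1/(y+z) + z) = z/(y+z) + yz, which
is at most (1 + y²)(1 + z²). The weight 1 + x² is thus reproduced with constant one. -/
theorem gain_memX {K : ℝ → ℝ → ℝ} {M : ℝ} (hK : BddKernel K M) {a b : ℝ → ℝ} (ha : MemX a)
    (hb : MemX b) : MemX (gain K a b) ∧ nX (gain K a b) ≤ M * (nX a * nX b) := by
  have h := flux_test hK (θ := fun x => (1 + x ^ 2) / x ^ 2) (w₁ := fun y => 1 + y ^ 2)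
    (w₂ := fun z => 1 + z ^ 2) (by fun_prop) (fun y z hy hz => (integral_Ioo_inv_sq hy hz).1)
    (fun y z hy hz => by
      have h1 : ∀ x : ℝ, |(1 + x ^ 2) / x ^ 2| = (1 + x ^ 2) / x ^ 2 :=
        fun x => abs_of_nonneg (by positivity)
      simp_rw [h1]
      rw [(integral_Ioo_inv_sq hy hz).2]
      have : y * (1 / y - 1 / (y + z) + z) = z / (y + z) + y * z := by field_simp; ring
      rw [this]
      have h2 : z / (y + z) ≤ 1 := by rw [div_le_one (by positivity)]; linarith
      nlinarith [sq_nonneg (y - z), sq_nonneg (y * z)])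
    ha.aesm hb.aesm ha.integrable_abs hb.integrable_abs
  have he : ∀ x, (1 + x ^ 2) / x ^ 2 * flux K a b x = gain K a b x * (1 + x ^ 2) := by
    intro x; rw [gain]; ring
  refine ⟨by unfold MemX; simpa only [he] using h.1, ?_⟩
  refine le_trans (le_of_eq ?_) h.2.1
  rw [nX]
  refine integral_congr_ae (Filter.Eventually.of_forall fun x => ?_)
  simp only [he, abs_mul]
  rw [abs_of_pos (by positivity : (0 : ℝ) < 1 + x ^ 2)]

lemma flux_congr {K : ℝ → ℝ → ℝ} {a a' b b' : ℝ → ℝ} (ha : a =ᵐ[posVol] a')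
    (hb : b =ᵐ[posVol] b') (x : ℝ) : flux K a b x = flux K a' b' x := by
  refine integral_congr_ae ?_
  have h1 := Measure.quasiMeasurePreserving_fst (μ := posVol) (ν := posVol) |>.ae_eq_comp ha
  have h2 := Measure.quasiMeasurePreserving_snd (μ := posVol) (ν := posVol) |>.ae_eq_comp hb
  filter_upwards [h1, h2] with q h1 h2
  simp only [Function.comp] at h1 h2
  simp only [indicator, pairing, h1, h2]

/-! ### Bilinearity of the flux and its form as an iterated integral -/

section linear
variable {K : ℝ → ℝ → ℝ} {M : ℝ} {a a' b b' : ℝ → ℝ}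

lemma flux_sub_left (hK : BddKernel K M) (ha : Integrable a posVol) (ha' : Integrable a' posVol)
    (hb : Integrable b posVol) (x : ℝ) :
    flux K (fun y => a y - a' y) b x = flux K a b x - flux K a' b x := by
  rw [flux, flux, flux, ← integral_sub (hK.integrable_crossing ha hb x)
    (hK.integrable_crossing ha' hb x)]
  congr 1; ext q
  by_cases h : q ∈ crossing x <;> simp [h, pairing]
  ring

lemma flux_sub_right (hK : BddKernel K M) (ha : Integrable a posVol) (hb : Integrable b posVol)
    (hb' : Integrable b' posVol) (x : ℝ) :
    flux K a (fun y => b y - b' y) x = flux K a b x - flux K a b' x := by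
  rw [flux, flux, flux, ← integral_sub (hK.integrable_crossing ha hb x)
    (hK.integrable_crossing ha hb' x)]
  congr 1; ext q
  by_cases h : q ∈ crossing x <;> simp [h, pairing]
  ring

lemma gain_sub_left (hK : BddKernel K M) (ha : Integrable a posVol) (ha' : Integrable a' posVol)
    (hb : Integrable b posVol) (x : ℝ) :
    gain K (fun y => a y - a' y) b x = gain K a b x - gain K a' b x := by
  rw [gain, flux_sub_left hK ha ha' hb, sub_div]; rfl

lemma gain_sub_right (hK : BddKernel K M) (ha : Integrable a posVol) (hb : Integrable b posVol)
    (hb' : Integrable b' posVol) (x : ℝ) :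
    gain K a (fun y => b y - b' y) x = gain K a b x - gain K a b' x := by
  rw [gain, flux_sub_right hK ha hb hb', sub_div]; rfl

lemma gain_congr (ha : a =ᵐ[posVol] a') (hb : b =ᵐ[posVol] b') (x : ℝ) :
    gain K a b x = gain K a' b' x := by
  rw [gain, gain, flux_congr ha hb]

/-- On the crossing set the factor y is less than x. Divided by x, this is a pointwise bound on x ·
`gain`, the boundedness that the Laplace transform arguments need. -/
lemma abs_flux_le (hK : BddKernel K M) (ha : Integrable a posVol) (hb : Integrable b posVol)
    {x : ℝ} (hx : 0 < x) :
    |flux K a b x| ≤ x * (M * ((∫ y, |a y| ∂posVol) * ∫ z, |b z| ∂posVol)) := by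
  have h1 := (hK.integrable_weight (w₁ := fun _ => 1) (w₂ := fun _ => 1) (φ := fun _ => 1) ha.1 hb.1
    (by simpa using ha.abs) (by simpa using hb.abs) aestronglyMeasurable_const (by simp))
  simp only [one_mul, mul_one] at h1
  calc |flux K a b x| ≤ ∫ q, x * |pairing K a b q| ∂quadVol := by
        rw [flux, ← Real.norm_eq_abs]
        refine norm_integral_le_of_norm_le (h1.1.abs.const_mul x) ?_
        filter_upwards [ae_quad_pos] with q hq
        by_cases h : q ∈ crossing x
        · rw [indicator_of_mem h, norm_mul, Real.norm_eq_abs, abs_of_pos hq.1]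
          exact mul_le_mul_of_nonneg_right h.1.le (abs_nonneg _)
        · rw [indicator_of_notMem h, norm_zero]; positivity
    _ ≤ _ := by
        rw [integral_const_mul]
        exact mul_le_mul_of_nonneg_left h1.2 hx.le

lemma integral_crossing_slice (x y : ℝ) :
    ∫ z, (crossing x).indicator (fun q => q.1 * pairing K a b q) (y, z) ∂posVol
      = (Iio x).indicator (fun y => y * a y * ∫ z in Ioi (x - y), K y z * b z) y := by
  by_cases hy : y < x
  · rw [indicator_of_mem (show y ∈ Iio x from hy), ← integral_const_mul]
    have h2 : ∀ z, (crossing x).indicator (fun q => q.1 * pairing K a b q) (y, z)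
        = (Ioi (x - y)).indicator (fun z => y * a y * (K y z * b z)) z := by
      intro z
      by_cases hz : x - y < z
      · rw [indicator_of_mem (show z ∈ Ioi (x - y) from hz),
          indicator_of_mem (show (y, z) ∈ crossing x from ⟨hy, by simp only; linarith⟩)]
        simp only [pairing]; ring
      · rw [indicator_of_notMem (show z ∉ Ioi (x - y) from hz), indicator_of_notMem]
        rintro ⟨-, h⟩
        simp only at h
        exact hz (by linarith)
    simp_rw [h2]
    rw [integral_indicator measurableSet_Ioi, Measure.restrict_restrict measurableSet_Ioi,
      inter_eq_left.2]
    exact Ioi_subset_Ioi (by linarith)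
  · rw [indicator_of_notMem (show y ∉ Iio x from hy)]
    refine integral_eq_zero_of_ae (Filter.Eventually.of_forall fun z => ?_)
    exact indicator_of_notMem (fun h => hy h.1) _

lemma posVol_restrict_Iio (x : ℝ) : posVol.restrict (Iio x) = volume.restrict (Ioo 0 x) := by
  rw [Measure.restrict_restrict measurableSet_Iio]
  congr 1
  ext y; simp [and_comm]

/-- The mass flux as an iterated integral. -/
lemma flux_eq_iterated (hK : BddKernel K M) (ha : Integrable a posVol) (hb : Integrable b posVol)
    (x : ℝ) :
    flux K a b x = ∫ y in Ioo 0 x, y * a y * ∫ z in Ioi (x - y), K y z * b z := by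
  rw [flux, integral_prod _ (hK.integrable_crossing ha hb x)]
  simp_rw [integral_crossing_slice]
  rw [integral_indicator measurableSet_Iio, posVol_restrict_Iio]

lemma integrableOn_flux (hK : BddKernel K M) (ha : Integrable a posVol) (hb : Integrable b posVol)
    (x : ℝ) :
    IntegrableOn (fun y => y * a y * ∫ z in Ioi (x - y), K y z * b z) (Ioo 0 x) := by
  have h := (hK.integrable_crossing ha hb x).integral_prod_left
  simp_rw [integral_crossing_slice] at h
  rwa [integrable_indicator_iff measurableSet_Iio, IntegrableOn, posVol_restrict_Iio] at h

end linear

/-! ### The perturbed kernels -/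

lemma bddKernel_one : BddKernel (fun _ _ => 1) 1 :=
  ⟨aestronglyMeasurable_const, by simp⟩

lemma IsPerturbation.aesm {W : ℝ → ℝ → ℝ} (hW : IsPerturbation W) :
    AEStronglyMeasurable (fun q : ℝ × ℝ => W q.1 q.2) quadVol := by
  rw [quadVol, Measure.prod_restrict]
  exact hW.continuousOn.aestronglyMeasurable (measurableSet_Ioi.prod measurableSet_Ioi)

lemma IsPerturbation.bddKernel {W : ℝ → ℝ → ℝ} (hW : IsPerturbation W) : BddKernel W 1 :=
  ⟨hW.aesm, fun x y hx hy => abs_le.2 ⟨by linarith [hW.nonneg x y hx hy], hW.le_one x y hx hy⟩⟩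

lemma IsPerturbation.bddKernel_kernel {W : ℝ → ℝ → ℝ} (hW : IsPerturbation W) {ε : ℝ}
    (h0 : 0 ≤ ε) : BddKernel (kernel W ε) (2 + ε) := by
  refine ⟨(hW.aesm.const_mul ε).const_add 2, fun x y hx hy => ?_⟩
  have h1 := hW.nonneg x y hx hy
  have h2 := hW.le_one x y hx hy
  rw [kernel, abs_of_nonneg (by positivity)]
  nlinarith

lemma flux_kernel {W : ℝ → ℝ → ℝ} (hW : IsPerturbation W) (ε : ℝ) {a b : ℝ → ℝ}
    (ha : Integrable a posVol) (hb : Integrable b posVol) (x : ℝ) :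
    flux (kernel W ε) a b x = 2 * flux (fun _ _ => 1) a b x + ε * flux W a b x := by
  rw [flux, flux, flux, ← integral_const_mul, ← integral_const_mul, ← integral_add
    ((bddKernel_one.integrable_crossing ha hb x).const_mul 2)
    ((hW.bddKernel.integrable_crossing ha hb x).const_mul ε)]
  congr 1; ext q
  by_cases h : q ∈ crossing x <;> simp [h, pairing, kernel]
  ring

lemma gain_kernel {W : ℝ → ℝ → ℝ} (hW : IsPerturbation W) (ε : ℝ) {a b : ℝ → ℝ}
    (ha : Integrable a posVol) (hb : Integrable b posVol) (x : ℝ) :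
    gain (kernel W ε) a b x = 2 * gain (fun _ _ => 1) a b x + ε * gain W a b x := by
  rw [gain, flux_kernel hW ε ha hb, gain, gain]; ring

/-! ### The coagulation operator in weak form -/

lemma tendsto_setIntegral_Ioi_atTop {f : ℝ → ℝ} {a : ℝ} (hf : IntegrableOn f (Ioi a)) :
    Tendsto (fun b => ∫ x in Ioi b, f x) atTop (𝓝 0) := by
  have h := (intervalIntegral_tendsto_integral_Ioi a hf tendsto_id).const_sub (∫ x in Ioi a, f x)
  rw [sub_self] at h
  refine h.congr' ?_
  filter_upwards [eventually_ge_atTop a] with b hb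
  have h2 := intervalIntegral.integral_interval_add_Ioi hf (hf.mono_set (Ioi_subset_Ioi hb))
  simp only [id]
  linarith

/-- The change of variables `(y, z) ↦ y + z` on the positive quadrant. -/
lemma integral_add_quad {ψ : ℝ → ℝ} {P : ℝ × ℝ → ℝ}
    (hP : Integrable (fun q => ψ (q.1 + q.2) * P q) quadVol) :
    Integrable (fun x => ψ x * ∫ z in Ioo 0 x, P (x - z, z)) posVol ∧
      ∫ x, ψ x * (∫ z in Ioo 0 x, P (x - z, z)) ∂posVol
        = ∫ q, ψ (q.1 + q.2) * P q ∂quadVol := by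
  set Q : Set (ℝ × ℝ) := Ioi 0 ×ˢ Ioi 0 with hQ
  have hQm : MeasurableSet Q := measurableSet_Ioi.prod measurableSet_Ioi
  set H : ℝ × ℝ → ℝ := Q.indicator (fun q => ψ (q.1 + q.2) * P q) with hH
  have hquad : quadVol = (volume.prod volume : Measure (ℝ × ℝ)).restrict Q :=
    Measure.prod_restrict _ _
  have hHi : Integrable H (volume.prod volume) := by
    rw [hH, integrable_indicator_iff hQm, IntegrableOn, ← hquad]; exact hP
  -- The shear (x, z) ↦ (x - z, z) preserves the planar measure.
  have hφ := measurePreserving_sub_prod (volume : Measure ℝ) (volume : Measure ℝ)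
  have hJ : Integrable (fun p : ℝ × ℝ => H (p.1 - p.2, p.2)) (volume.prod volume) :=
    (hφ.integrable_comp hHi.1).2 hHi
  have hval : ∫ p : ℝ × ℝ, H (p.1 - p.2, p.2) ∂(volume.prod volume)
      = ∫ q, ψ (q.1 + q.2) * P q ∂quadVol := by
    rw [hquad, ← integral_indicator hQm, ← hH]
    conv_rhs => rw [← hφ.map_eq]
    rw [integral_map hφ.measurable.aemeasurable]
    rw [hφ.map_eq]; exact hHi.1
  have hin : ∀ x : ℝ, ∫ z, H (x - z, z)
      = (Ioi (0 : ℝ)).indicator (fun x => ψ x * ∫ z in Ioo 0 x, P (x - z, z)) x := by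
    intro x
    have h1 : ∀ z, H (x - z, z) = (Ioo 0 x).indicator (fun z => ψ x * P (x - z, z)) z := by
      intro z
      by_cases hz : z ∈ Ioo 0 x
      · rw [hH, indicator_of_mem hz, indicator_of_mem]
        · simp
        · exact ⟨by simp only [mem_Ioi]; linarith [hz.2], hz.1⟩
      · rw [hH, indicator_of_notMem hz, indicator_of_notMem]
        rintro ⟨h1, h2⟩
        simp only [mem_Ioi] at h1 h2
        exact hz ⟨h2, by linarith⟩
    simp_rw [h1]
    rw [integral_indicator measurableSet_Ioo, integral_const_mul]
    by_cases hx : 0 < x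
    · rw [indicator_of_mem (show x ∈ Ioi (0 : ℝ) from hx)]
    · rw [indicator_of_notMem (show x ∉ Ioi (0 : ℝ) from hx), Ioo_eq_empty (by simpa using hx)]
      simp
  have h3 := hJ.integral_prod_left
  simp only [hin] at h3
  rw [integrable_indicator_iff measurableSet_Ioi] at h3
  refine ⟨h3, ?_⟩
  rw [← hval, integral_prod _ hJ]
  simp only [hin]
  rw [integral_indicator measurableSet_Ioi]

lemma MemL11.integrable_abs {a : ℝ → ℝ} (h : MemL11 a) :
    Integrable (fun x => |a x| * (1 + x)) posVol := by
  refine (Integrable.abs (show Integrable _ posVol from h)).congr ?_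
  filter_upwards [ae_pos] with x hx
  rw [abs_mul, abs_of_pos (by linarith : (0 : ℝ) < 1 + x)]

lemma MemL11.aesm {a : ℝ → ℝ} (h : MemL11 a) : AEStronglyMeasurable a posVol :=
  aesm_of_mul (w := fun x => 1 + x) (by fun_prop) (fun x hx => by positivity)
    (show Integrable _ posVol from h).1

lemma MemL11.integrable {a : ℝ → ℝ} (h : MemL11 a) : Integrable a posVol := by
  refine h.integrable_abs.mono' h.aesm ?_
  filter_upwards [ae_pos] with x hx
  rw [Real.norm_eq_abs]
  nlinarith [abs_nonneg (a x)]

lemma MemL11.integrable_id {a : ℝ → ℝ} (h : MemL11 a) : Integrable (fun x => x * a x) posVol := by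
  refine h.integrable_abs.mono' ((by fun_prop : AEStronglyMeasurable (fun x : ℝ => x) posVol).mul h.aesm) ?_
  filter_upwards [ae_pos] with x hx
  rw [norm_mul, Real.norm_eq_abs, Real.norm_eq_abs, abs_of_pos hx]
  nlinarith [abs_nonneg (a x)]

lemma memL11_of_integrable {a : ℝ → ℝ} (h : Integrable a posVol)
    (h' : Integrable (fun x => x * a x) posVol) : MemL11 a := by
  refine (h.add h').congr (Eventually.of_forall fun x => ?_)
  simp only [Pi.add_apply]; ring

lemma MemX.memL11 {a : ℝ → ℝ} (h : MemX a) : MemL11 a :=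
  memL11_of_integrable h.integrable h.integrable_id

section coag
variable {K : ℝ → ℝ → ℝ} {M : ℝ} {G : ℝ → ℝ}

/-- The weak form of the coagulation operator. -/
lemma coag_test (hK : BddKernel K M) (hG : MemL11 G) {ψ : ℝ → ℝ} (hψm : Measurable ψ)
    (hψ : ∀ x, 0 < x → |ψ x| ≤ x) :
    Integrable (fun x => ψ x * coag K G x) posVol ∧
      ∫ x, ψ x * coag K G x ∂posVol
        = (1 / 2) * (∫ q, ψ (q.1 + q.2) * pairing K G G q ∂quadVol)
          - ∫ q, ψ q.1 * pairing K G G q ∂quadVol := by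
  have hi1 : Integrable (fun q => ψ (q.1 + q.2) * pairing K G G q) quadVol :=
    (hK.integrable_weight hG.aesm hG.aesm hG.integrable_abs hG.integrable_abs
      (hψm.comp (measurable_fst.add measurable_snd)).aestronglyMeasurable fun y z hy hz =>
      (hψ (y + z) (by positivity)).trans (by nlinarith [mul_pos hy hz])).1
  have hi2 : Integrable (fun q => ψ q.1 * pairing K G G q) quadVol :=
    (hK.integrable_weight hG.aesm hG.aesm hG.integrable_abs hG.integrable_abs
      (hψm.comp measurable_fst).aestronglyMeasurable fun y z hy hz =>
      (hψ _ hy).trans (by nlinarith [mul_pos hy hz])).1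
  have hc := integral_add_quad hi1
  have he : (fun x => ψ x * coag K G x) = fun x =>
      (1 / 2) * (ψ x * ∫ z in Ioo 0 x, pairing K G G (x - z, z))
        - ∫ z, ψ x * pairing K G G (x, z) ∂posVol := by
    ext x
    rw [coag, integral_const_mul]
    have : ∀ z, pairing K G G (x, z) = G x * (K x z * G z) := fun z => by simp only [pairing]; ring
    simp_rw [this]
    rw [integral_const_mul]
    have : ∀ z, pairing K G G (x - z, z) = K (x - z) z * G (x - z) * G z :=
      fun z => by simp only [pairing]; ring
    simp_rw [this]
    ring
  have h2 := hi2.integral_prod_left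
  rw [he]
  refine ⟨(hc.1.const_mul _).sub h2, ?_⟩
  rw [integral_sub (hc.1.const_mul _) h2, integral_const_mul, hc.2, integral_prod _ hi2]

lemma integral_pairing_swap (hs : ∀ x y : ℝ, 0 < x → 0 < y → K x y = K y x) (φ : ℝ × ℝ → ℝ)
    (a b : ℝ → ℝ) :
    ∫ q, φ q * pairing K a b q ∂quadVol = ∫ q, φ q.swap * pairing K b a q ∂quadVol := by
  rw [quadVol, ← integral_prod_swap]
  refine integral_congr_ae ?_
  filter_upwards [ae_quad_pos] with q hq
  simp only [pairing, Prod.fst_swap, Prod.snd_swap]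
  rw [hs _ _ hq.1 hq.2]
  ring

lemma integrable_id_mul_coag (hK : BddKernel K M) (hG : MemL11 G) :
    Integrable (fun x => x * coag K G x) posVol :=
  (coag_test hK hG measurable_id fun _ hx => (abs_of_pos hx).le).1

/-- The mass which coagulation carries beyond `x` is the flux across `x`. -/
lemma setIntegral_id_mul_coag (hK : BddKernel K M) (hs : ∀ x y : ℝ, 0 < x → 0 < y → K x y = K y x)
    (hG : MemL11 G) {x : ℝ} (hx : 0 < x) :
    ∫ y in Ioi x, y * coag K G y = flux K G G x := by
  set ψ : ℝ → ℝ := (Ioi x).indicator id with hψ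
  have hψm : Measurable ψ := measurable_id.indicator measurableSet_Ioi
  have hψle : ∀ y, 0 < y → |ψ y| ≤ y := by
    intro y hy
    by_cases h : y ∈ Ioi x
    · rw [hψ, indicator_of_mem h]; exact (abs_of_pos hy).le
    · rw [hψ, indicator_of_notMem h, abs_zero]; exact hy.le
  have h := (coag_test hK hG hψm hψle).2
  have hl : ∫ y, ψ y * coag K G y ∂posVol = ∫ y in Ioi x, y * coag K G y := by
    have : ∀ y, ψ y * coag K G y = (Ioi x).indicator (fun y => y * coag K G y) y := by
      intro y
      by_cases h : y ∈ Ioi x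
      · rw [hψ, indicator_of_mem h, indicator_of_mem h]; rfl
      · rw [hψ, indicator_of_notMem h, indicator_of_notMem h, zero_mul]
    simp_rw [this]
    rw [integral_indicator measurableSet_Ioi, Measure.restrict_restrict measurableSet_Ioi,
      inter_eq_left.2 (Ioi_subset_Ioi hx.le)]
  rw [← hl, h]
  -- By symmetry of the kernel, half of y + z on {x < y + z} may be replaced by y. Subtracting the
  -- loss term y on {x < y} leaves y on the crossing set, up to the null set y = x.
  set φ : ℝ × ℝ → ℝ := {q : ℝ × ℝ | x < q.1 + q.2}.indicator (fun q => q.1) with hφ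
  have hφm : Measurable φ :=
    measurable_fst.indicator (measurableSet_lt measurable_const (measurable_fst.add measurable_snd))
  have hφi : ∀ χ : ℝ × ℝ → ℝ, Measurable χ → (∀ y z, 0 < y → 0 < z → |χ (y, z)| ≤ y + z) →
      Integrable (fun q => χ q * pairing K G G q) quadVol := fun χ h1 h2 =>
    (hK.integrable_weight hG.aesm hG.aesm hG.integrable_abs hG.integrable_abs
      h1.aestronglyMeasurable fun y z hy hz =>
      (h2 _ _ hy hz).trans (by nlinarith [mul_pos hy hz])).1
  have hφle : ∀ y z, 0 < y → 0 < z → |φ (y, z)| ≤ y + z := by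
    intro y z hy hz
    by_cases h : (y, z) ∈ {q : ℝ × ℝ | x < q.1 + q.2}
    · rw [hφ, indicator_of_mem h]; simp only; rw [abs_of_pos hy]; linarith
    · rw [hφ, indicator_of_notMem h, abs_zero]; positivity
  have hφi1 := hφi φ hφm hφle
  have hφi2 := hφi (fun q => φ q.swap) (hφm.comp measurable_swap) (fun y z hy hz => by
    have := hφle z y hz hy; simpa [add_comm] using this)
  have hψi := hφi (fun q => ψ q.1) (hψm.comp measurable_fst) (fun y z hy hz => by
    have := hψle y hy; simp only; linarith)
  have hsum : ∫ q, ψ (q.1 + q.2) * pairing K G G q ∂quadVol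
      = 2 * ∫ q, φ q * pairing K G G q ∂quadVol := by
    rw [two_mul]
    nth_rewrite 2 [integral_pairing_swap hs φ G G]
    rw [← integral_add hφi1 hφi2]
    refine integral_congr_ae (Eventually.of_forall fun q => ?_)
    simp only [hψ, hφ, indicator, mem_Ioi, mem_ofPred_eq, Prod.fst_swap, Prod.snd_swap, id]
    rw [add_comm q.2 q.1]
    split_ifs <;> ring
  rw [hsum, ← mul_assoc, one_div, inv_mul_cancel₀ two_ne_zero, one_mul, ← integral_sub hφi1 hψi, flux]
  refine integral_congr_ae ?_
  have hne : ∀ᵐ q ∂quadVol, q.1 ≠ x :=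
    Measure.quasiMeasurePreserving_fst.ae (Measure.ae_ne posVol x)
  filter_upwards [ae_quad_pos, hne] with q hq hqx
  by_cases h1 : x < q.1
  · rw [indicator_of_notMem (fun h => absurd h.1 (by linarith)), hψ, hφ,
      indicator_of_mem (show q.1 ∈ Ioi x from h1),
      indicator_of_mem (show q ∈ {q : ℝ × ℝ | x < q.1 + q.2} from by change x < q.1 + q.2; linarith)]
    simp
  · have h1' : q.1 < x := lt_of_le_of_ne (not_lt.1 h1) hqx
    rw [hψ, indicator_of_notMem (show q.1 ∉ Ioi x from h1)]
    by_cases h2 : x < q.1 + q.2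
    · rw [indicator_of_mem (show q ∈ crossing x from ⟨h1', h2⟩), hφ,
        indicator_of_mem (show q ∈ {q : ℝ × ℝ | x < q.1 + q.2} from h2)]
      ring
    · rw [indicator_of_notMem (show q ∉ crossing x from fun h => h2 h.2), hφ,
        indicator_of_notMem (show q ∉ {q : ℝ × ℝ | x < q.1 + q.2} from h2)]
      ring

/-- The substitution y = e^τ x turns e^{2τ} c(e^τ x) dτ into y c(y) dy / x². Hence the mild equation
compares y²G(y) at y = x and at y = e^t x. -/
lemma integral_semigroup (c : ℝ → ℝ) {x : ℝ} (hx : 0 < x) {t : ℝ} (ht : 0 ≤ t) :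
    ∫ s in (0 : ℝ)..t, semigroup (t - s) c x
      = (∫ y in x..(Real.exp t * x), y * c y) / x ^ 2 := by
  rw [intervalIntegral.integral_comp_sub_left (fun s => semigroup s c x) t, sub_self, sub_zero,
    intervalIntegral.integral_of_le ht, intervalIntegral.integral_of_le
      (by nlinarith [Real.one_le_exp ht]), ← integral_div]
  have himg : (fun τ => Real.exp τ * x) '' Ioc 0 t = Ioc x (Real.exp t * x) := by
    ext y
    constructor
    · rintro ⟨τ, ⟨h1, h2⟩, rfl⟩
      refine ⟨?_, ?_⟩
      · have := Real.one_lt_exp_iff.2 h1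
        simp only; nlinarith
      · exact mul_le_mul_of_nonneg_right (Real.exp_le_exp.2 h2) hx.le
    · rintro ⟨h1, h2⟩
      have hy : 0 < y := hx.trans h1
      refine ⟨Real.log (y / x), ⟨Real.log_pos (by rwa [one_lt_div hx]), ?_⟩, ?_⟩
      · rw [Real.log_le_iff_le_exp (by positivity), div_le_iff₀ hx]; exact h2
      · simp only
        rw [Real.exp_log (by positivity)]; field_simp
  rw [← himg, integral_image_eq_integral_abs_deriv_smul (f' := fun τ => Real.exp τ * x)
    measurableSet_Ioc (fun τ _ => ((Real.hasDerivAt_exp τ).mul_const x).hasDerivWithinAt)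
    (fun a _ b _ h => Real.exp_injective (mul_right_cancel₀ hx.ne' h))]
  refine setIntegral_congr_fun measurableSet_Ioc fun τ _ => ?_
  simp only [semigroup, smul_eq_mul]
  rw [abs_of_pos (by positivity), two_mul, Real.exp_add]
  field_simp

end coag

/-! ### Profiles are the nonnegative fixed points of the gain operator -/

section profile
variable {K : ℝ → ℝ → ℝ} {M : ℝ} {G : ℝ → ℝ}

lemma ae_posVol_of_forall_Ioi {p : ℝ → Prop}
    (h : ∀ a : ℝ, 0 < a → ∀ᵐ x ∂(volume.restrict (Ioi a)), p x) : ∀ᵐ x ∂posVol, p x := by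
  have h1 : Ioi (0 : ℝ) = ⋃ n : ℕ, Ioi (1 / ((n : ℝ) + 1)) := by
    ext x
    simp only [mem_Ioi, mem_iUnion]
    constructor
    · intro hx
      exact exists_nat_one_div_lt hx
    · rintro ⟨n, hn⟩
      exact lt_trans (by positivity) hn
  rw [posVol, h1, ae_restrict_iUnion_eq, eventually_iSup]
  exact fun n => h _ (by positivity)

lemma ae_comp_mul_left {p : ℝ → Prop} (h : ∀ᵐ x ∂posVol, p x) {b : ℝ} (hb : 0 < b) :
    ∀ᵐ x ∂posVol, p (b * x) := by
  have hq : Measure.QuasiMeasurePreserving (fun x : ℝ => b * x) volume volume := by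
    refine ⟨by fun_prop, ?_⟩
    rw [Real.map_volume_mul_left hb.ne']
    exact Measure.smul_absolutelyContinuous
  rw [posVol, ae_restrict_iff' measurableSet_Ioi] at h ⊢
  filter_upwards [hq.ae h] with x hx h0
  exact hx (mul_pos hb h0)

/-- Profiles are fixed points of the quadratic gain operator. -/
theorem IsProfile.eq_gain (hK : BddKernel K M)
    (hs : ∀ x y : ℝ, 0 < x → 0 < y → K x y = K y x) (hG : IsProfile K G) :
    G =ᵐ[posVol] gain K G G := by
  have hci : IntegrableOn (fun y => y * coag K G y) (Ioi 0) := integrable_id_mul_coag hK hG.memL11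
  have hx1 : IntegrableOn (fun y => y * G y) (Ioi 0) := hG.memL11.integrable_id
  -- D is the boundary term at infinity, the limit of y²G(y) along y = e^n x. Only the integer times
  -- t = n are used, so that one null set serves for all of them.
  set D : ℝ → ℝ := fun x => x ^ 2 * G x - ∫ y in Ioi x, y * coag K G y with hD
  set E : ℕ → ℝ := fun n => Real.exp n with hE
  have hEpos : ∀ n, 0 < E n := fun n => Real.exp_pos _
  have hEtop : Tendsto E atTop atTop := Real.tendsto_exp_atTop.comp tendsto_natCast_atTop_atTop
  have hmild : ∀ᵐ x ∂posVol, ∀ n : ℕ,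
      x ^ 2 * G x = (E n * x) ^ 2 * G (E n * x) + ∫ y in x..(E n * x), y * coag K G y := by
    rw [ae_all_iff]
    intro n
    filter_upwards [hG.mild n (Nat.cast_nonneg n), ae_pos] with x h hx
    rw [integral_semigroup _ hx (Nat.cast_nonneg n), semigroup] at h
    rw [h, two_mul, Real.exp_add]
    field_simp
    ring
  have hlim : ∀ᵐ x ∂posVol, Tendsto (fun n => (E n * x) ^ 2 * G (E n * x)) atTop (𝓝 (D x)) := by
    filter_upwards [hmild, ae_pos] with x h hx
    have h1 : Tendsto (fun n => ∫ y in x..(E n * x), y * coag K G y) atTop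
        (𝓝 (∫ y in Ioi x, y * coag K G y)) :=
      intervalIntegral_tendsto_integral_Ioi x (hci.mono_set (Ioi_subset_Ioi hx.le))
        (hEtop.atTop_mul_const hx)
    refine (h1.const_sub (x ^ 2 * G x)).congr fun n => ?_
    rw [h n]; ring
  have hzero : ∀ᵐ x ∂posVol, D x = 0 := by
    refine ae_posVol_of_forall_Ioi fun a ha => ?_
    have hac : volume.restrict (Ioi a) ≤ posVol :=
      Measure.restrict_mono_set _ (Ioi_subset_Ioi ha.le)
    have hsc : ∀ n, Integrable (fun x => E n * ((E n * x) * G (E n * x))) (volume.restrict (Ioi a)) :=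
      fun n => ((integrableOn_Ioi_comp_mul_left_iff (fun y => y * G y) a (hEpos n)).2
        (hx1.mono_set (Ioi_subset_Ioi (by have := hEpos n; positivity)))).const_mul (E n)
    have hval : ∀ n, ∫ x in Ioi a, ‖E n * ((E n * x) * G (E n * x))‖
        = ∫ y in Ioi (E n * a), ‖y * G y‖ := by
      intro n
      have h1 := integral_comp_mul_left_Ioi (fun y => ‖y * G y‖) a (hEpos n)
      have h2 : ∀ x, ‖E n * ((E n * x) * G (E n * x))‖ = E n * ‖(E n * x) * G (E n * x)‖ := by
        intro x
        rw [norm_mul, Real.norm_eq_abs (E n), abs_of_pos (hEpos n)]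
      simp_rw [h2]
      rw [integral_const_mul, h1, smul_eq_mul, ← mul_assoc,
        mul_inv_cancel₀ (hEpos n).ne', one_mul]
    -- By scaling these norms are the tails of ∫ y|G| beyond e^n a, whereas the integrands converge
    -- to |D(x)/x|. Fatou then forces D = 0.
    have ht : Tendsto (fun n => ∫⁻ x in Ioi a, ‖E n * ((E n * x) * G (E n * x))‖ₑ) atTop (𝓝 0) := by
      have h1 : ∀ n, ∫⁻ x in Ioi a, ‖E n * ((E n * x) * G (E n * x))‖ₑ
          = ENNReal.ofReal (∫ y in Ioi (E n * a), ‖y * G y‖) := by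
        intro n
        rw [← hval, ofReal_integral_norm_eq_lintegral_enorm (hsc n)]
      simp_rw [h1]
      rw [← ENNReal.ofReal_zero]
      refine ENNReal.tendsto_ofReal ?_
      exact (tendsto_setIntegral_Ioi_atTop hx1.norm).comp (hEtop.atTop_mul_const ha)
    have hfatou := lintegral_liminf_le' (μ := volume.restrict (Ioi a)) (u := atTop)
      (f := fun n x => ‖E n * ((E n * x) * G (E n * x))‖ₑ) fun n => (hsc n).1.enorm
    have h4 : ∀ᵐ x ∂volume.restrict (Ioi a),
        Tendsto (fun n => ‖E n * ((E n * x) * G (E n * x))‖ₑ) atTop (𝓝 ‖D x / x‖ₑ) := by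
      filter_upwards [Measure.absolutelyContinuous_of_le hac |>.ae_le hlim,
        ae_restrict_mem measurableSet_Ioi] with x h2 h3
      have hx : 0 < x := ha.trans h3
      refine (continuous_enorm.tendsto _).comp ((h2.div_const x).congr fun n => ?_)
      field_simp
    have h5 := aemeasurable_of_tendsto_metrizable_ae atTop (fun n => (hsc n).1.enorm) h4
    rw [ht.liminf_eq, nonpos_iff_eq_zero, lintegral_congr_ae
      (h4.mono fun x hx => hx.liminf_eq), lintegral_eq_zero_iff' h5] at hfatou
    filter_upwards [hfatou, ae_restrict_mem measurableSet_Ioi] with x h1 h3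
    have hx : 0 < x := ha.trans h3
    simpa only [Pi.zero_apply, enorm_eq_zero, div_eq_zero_iff, hx.ne', or_false] using h1
  filter_upwards [hzero, ae_pos] with x h hx
  rw [gain, ← setIntegral_id_mul_coag hK hs hG.memL11 hx, eq_div_iff (by positivity)]
  simp only [hD] at h
  linarith

/-- Nonnegative fixed points of the quadratic gain operator are profiles. -/
theorem isProfile_of_eq_gain (hK : BddKernel K M)
    (hs : ∀ x y : ℝ, 0 < x → 0 < y → K x y = K y x) (hG : MemL11 G)
    (h0 : ∀ᵐ x ∂posVol, 0 ≤ G x) (h : G =ᵐ[posVol] gain K G G) : IsProfile K G := by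
  refine ⟨hG, h0, fun t ht => ?_⟩
  have hci : IntegrableOn (fun y => y * coag K G y) (Ioi 0) := integrable_id_mul_coag hK hG
  have hae : ∀ᵐ x ∂posVol, G x = (∫ y in Ioi x, y * coag K G y) / x ^ 2 := by
    filter_upwards [h, ae_pos] with x h hx
    rw [setIntegral_id_mul_coag hK hs hG hx]; exact h
  -- The almost-everywhere equation is needed at x and at e^t x; dilations preserve null sets.
  filter_upwards [hae, ae_comp_mul_left hae (Real.exp_pos t), ae_pos] with x h1 h2 hx
  have hle : x ≤ Real.exp t * x := by nlinarith [Real.one_le_exp ht]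
  rw [integral_semigroup _ hx ht, semigroup, h2, h1, two_mul, Real.exp_add,
    ← intervalIntegral.integral_interval_add_Ioi (hci.mono_set (Ioi_subset_Ioi hx.le))
      (hci.mono_set (Ioi_subset_Ioi (hx.le.trans hle)))]
  field_simp
  ring

end profile

/-! ### The Bernstein transform of the gain operator -/

/-- The Bernstein transform `∫ (1 - e^{-px}) a(x) dx`. -/
noncomputable def bern (a : ℝ → ℝ) (p : ℝ) : ℝ := ∫ x, (1 - Real.exp (-(p * x))) * a x ∂posVol

/-- The derivative of the Bernstein transform. -/
noncomputable def bernDeriv (a : ℝ → ℝ) (p : ℝ) : ℝ := ∫ x, Real.exp (-(p * x)) * (x * a x) ∂posVol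

lemma exp_neg_mul_mem {p x : ℝ} (hp : 0 ≤ p) (hx : 0 ≤ x) :
    0 < Real.exp (-(p * x)) ∧ Real.exp (-(p * x)) ≤ 1 :=
  ⟨Real.exp_pos _, Real.exp_le_one_iff.2 (by nlinarith [mul_nonneg hp hx])⟩

lemma integrable_exp_mul {f : ℝ → ℝ} (hf : Integrable f posVol) {p : ℝ} (hp : 0 ≤ p) :
    Integrable (fun x => Real.exp (-(p * x)) * f x) posVol := by
  refine hf.abs.mono' ((by fun_prop : AEStronglyMeasurable _ posVol).mul hf.1) ?_
  filter_upwards [ae_pos] with x hx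
  have h := exp_neg_mul_mem hp hx.le
  rw [norm_mul, Real.norm_eq_abs, Real.norm_eq_abs, abs_of_pos h.1]
  nlinarith [abs_nonneg (f x)]

lemma integrable_bern {f : ℝ → ℝ} (hf : Integrable f posVol) {p : ℝ} (hp : 0 ≤ p) :
    Integrable (fun x => (1 - Real.exp (-(p * x))) * f x) posVol := by
  refine (hf.sub (integrable_exp_mul hf hp)).congr (Eventually.of_forall fun x => ?_)
  simp only [Pi.sub_apply]; ring

lemma hasDerivAt_bern {a : ℝ → ℝ} (ha : MemL11 a) {p : ℝ} (hp : 0 < p) :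
    HasDerivAt (bern a) (bernDeriv a p) p := by
  refine (hasDerivAt_integral_of_dominated_loc_of_deriv_le (μ := posVol) (s := Ioi 0)
    (F := fun p x => (1 - Real.exp (-(p * x))) * a x)
    (F' := fun p x => Real.exp (-(p * x)) * (x * a x))
    (bound := fun x => |x * a x|) (Ioi_mem_nhds hp) ?_ ?_ ?_ ?_ ?_ ?_).2
  · filter_upwards [Ioi_mem_nhds hp] with q hq
    exact (integrable_bern ha.integrable (le_of_lt hq)).1
  · exact integrable_bern ha.integrable hp.le
  · exact (integrable_exp_mul ha.integrable_id hp.le).1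
  · filter_upwards [ae_pos] with x hx q hq
    have h := exp_neg_mul_mem (le_of_lt hq) hx.le
    rw [norm_mul, Real.norm_eq_abs, Real.norm_eq_abs, abs_of_pos h.1]
    nlinarith [abs_nonneg (x * a x)]
  · exact ha.integrable_id.abs
  · refine Eventually.of_forall fun x q _ => ?_
    have h1 : HasDerivAt (fun q : ℝ => -(q * x)) (-(1 * x)) q := ((hasDerivAt_id q).mul_const x).neg
    have h2 := (h1.exp.const_sub 1).mul_const (a x)
    refine h2.congr_deriv ?_
    ring

/-- The weight `x² (d/dx) ((1 - e^{-px}) / x)`. -/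
noncomputable def bernKer (p x : ℝ) : ℝ := p * x * Real.exp (-(p * x)) - (1 - Real.exp (-(p * x)))

lemma bernKer_nonpos (p x : ℝ) : bernKer p x ≤ 0 := by
  have h1 := Real.add_one_le_exp (p * x)
  have h2 := Real.exp_pos (-(p * x))
  have h3 : Real.exp (-(p * x)) * Real.exp (p * x) = 1 := by rw [← Real.exp_add]; simp
  rw [bernKer]
  nlinarith

lemma integral_bernKer_mul {a : ℝ → ℝ} (ha : MemL11 a) {p : ℝ} (hp : 0 ≤ p) :
    ∫ x, bernKer p x * a x ∂posVol = p * bernDeriv a p - bern a p := by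
  rw [bernDeriv, bern, ← integral_const_mul, ← integral_sub
    ((integrable_exp_mul ha.integrable_id hp).const_mul p) (integrable_bern ha.integrable hp)]
  refine integral_congr_ae (Eventually.of_forall fun x => ?_)
  simp only [bernKer]; ring

lemma integral_Ioo_bernKer (p : ℝ) {y z : ℝ} (hy : 0 < y) (hz : 0 < z) :
    IntegrableOn (fun x : ℝ => bernKer p x / x ^ 2) (Ioo y (y + z)) ∧
      ∫ x in Ioo y (y + z), bernKer p x / x ^ 2
        = (1 - Real.exp (-(p * (y + z)))) / (y + z) - (1 - Real.exp (-(p * y))) / y := by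
  have hd : ∀ x ∈ uIcc y (y + z),
      HasDerivAt (fun x : ℝ => (1 - Real.exp (-(p * x))) / x) (bernKer p x / x ^ 2) x := by
    intro x hx
    rw [uIcc_of_le (by linarith)] at hx
    have hx0 : x ≠ 0 := (hy.trans_le hx.1).ne'
    have h1 : HasDerivAt (fun q : ℝ => -(p * q)) (-(p * 1)) x := ((hasDerivAt_id x).const_mul p).neg
    have h2 := (h1.exp.const_sub 1).div (hasDerivAt_id x) hx0
    refine h2.congr_deriv ?_
    simp only [bernKer, id]; ring
  have hc : ContinuousOn (fun x : ℝ => bernKer p x / x ^ 2) (uIcc y (y + z)) := by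
    refine ContinuousOn.div (by unfold bernKer; fun_prop) (by fun_prop) fun x hx => ?_
    rw [uIcc_of_le (by linarith)] at hx
    have := hy.trans_le hx.1
    positivity
  have hI : IntervalIntegrable (fun x : ℝ => bernKer p x / x ^ 2) volume y (y + z) :=
    hc.intervalIntegrable
  refine ⟨(intervalIntegrable_iff_integrableOn_Ioo_of_le (by linarith)).1 hI, ?_⟩
  rw [← integral_Ioc_eq_integral_Ioo, ← intervalIntegral.integral_of_le (by linarith),
    intervalIntegral.integral_eq_sub_of_hasDerivAt hd hI]

/-- The Bernstein transform turns coagulation into multiplication. -/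
theorem laplace_gain {K : ℝ → ℝ → ℝ} {M : ℝ} (hK : BddKernel K M)
    (hs : ∀ x y : ℝ, 0 < x → 0 < y → K x y = K y x) {a b : ℝ → ℝ} (ha : Integrable a posVol)
    (hb : Integrable b posVol) {p : ℝ} (hp : 0 ≤ p) :
    (∫ x, bernKer p x * gain K a b x ∂posVol) + ∫ x, bernKer p x * gain K b a x ∂posVol
      = -∫ q, ((1 - Real.exp (-(p * q.1))) * (1 - Real.exp (-(p * q.2)))) * pairing K a b q
          ∂quadVol := by
  -- χ is an antiderivative of `bernKer p x / x ^ 2`, so the weak form of the flux yields the weight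
  -- y(χ(y+z) - χ(y)).
  set χ : ℝ → ℝ := fun x => (1 - Real.exp (-(p * x))) / x with hχ
  have hχm : Measurable χ := by fun_prop
  have hχ0 : ∀ x, 0 < x → 0 ≤ x * χ x ∧ x * χ x ≤ 1 ∧ x * χ x = 1 - Real.exp (-(p * x)) := by
    intro x hx
    have h := exp_neg_mul_mem hp hx.le
    have h2 : x * χ x = 1 - Real.exp (-(p * x)) := by simp only [hχ]; field_simp
    rw [h2]; exact ⟨by linarith, by linarith, rfl⟩
  have hθ : ∀ y z, 0 < y → 0 < z →
      y * ∫ x in Ioo y (y + z), |bernKer p x / x ^ 2| ≤ 1 * 1 := by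
    intro y z hy hz
    have h1 : ∀ x : ℝ, |bernKer p x / x ^ 2| = -(bernKer p x / x ^ 2) := fun x =>
      abs_of_nonpos (div_nonpos_of_nonpos_of_nonneg (bernKer_nonpos p x) (sq_nonneg x))
    simp_rw [h1]
    rw [integral_neg, (integral_Ioo_bernKer p hy hz).2]
    have h2 := hχ0 y hy
    have h3 : 0 ≤ χ (y + z) := by
      have := hχ0 (y + z) (by positivity)
      exact nonneg_of_mul_nonneg_right this.1 (by positivity)
    change y * -(χ (y + z) - χ y) ≤ 1 * 1
    nlinarith [mul_nonneg hy.le h3]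
  have key : ∀ f g : ℝ → ℝ, Integrable f posVol → Integrable g posVol →
      ∫ x, bernKer p x * gain K f g x ∂posVol
        = ∫ q, (q.1 * (χ (q.1 + q.2) - χ q.1)) * pairing K f g q ∂quadVol := by
    intro f g hf hg
    have h := (flux_test hK (θ := fun x => bernKer p x / x ^ 2) (w₁ := fun _ => 1)
      (w₂ := fun _ => 1) (by unfold bernKer; fun_prop)
      (fun y z hy hz => (integral_Ioo_bernKer p hy hz).1) hθ hf.1 hg.1 (by simpa using hf.abs)
      (by simpa using hg.abs)).2.2
    have h1 : ∀ x, bernKer p x / x ^ 2 * flux K f g x = bernKer p x * gain K f g x := by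
      intro x; rw [gain]; ring
    simp_rw [h1] at h
    rw [h]
    refine integral_congr_ae ?_
    filter_upwards [ae_quad_pos] with q hq
    rw [(integral_Ioo_bernKer p hq.1 hq.2).2]
  have hint : ∀ φ : ℝ × ℝ → ℝ, Measurable φ → (∀ y z, 0 < y → 0 < z → |φ (y, z)| ≤ 1) →
      Integrable (fun q => φ q * pairing K a b q) quadVol := fun φ h1 h2 =>
    (hK.integrable_weight (w₁ := fun _ => 1) (w₂ := fun _ => 1) ha.1 hb.1 (by simpa using ha.abs)
      (by simpa using hb.abs) h1.aestronglyMeasurable fun y z hy hz => by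
        simpa using h2 y z hy hz).1
  have hbd : ∀ y z, 0 < y → 0 < z → |y * (χ (y + z) - χ y)| ≤ 1 := by
    intro y z hy hz
    have h1 := hχ0 y hy
    have h2 := hχ0 (y + z) (by positivity)
    have h3 : 0 ≤ χ (y + z) := nonneg_of_mul_nonneg_right h2.1 (by positivity)
    rw [abs_le]
    constructor <;> nlinarith [mul_nonneg hy.le h3, mul_nonneg hz.le h3]
  rw [key a b ha hb, key b a hb ha, integral_pairing_swap hs _ b a, ← integral_add, ← integral_neg]
  · refine integral_congr_ae ?_
    filter_upwards [ae_quad_pos] with q hq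
    simp only [Prod.fst_swap, Prod.snd_swap]
    have h1 := (hχ0 q.1 hq.1).2.2
    have h2 := (hχ0 q.2 hq.2).2.2
    have h3 := (hχ0 (q.1 + q.2) (add_pos hq.1 hq.2)).2.2
    have h4 : Real.exp (-(p * (q.1 + q.2))) = Real.exp (-(p * q.1)) * Real.exp (-(p * q.2)) := by
      rw [← Real.exp_add]; ring_nf
    rw [h4] at h3
    rw [add_comm q.2 q.1]
    -- The product appears only after symmetrizing in (y, z): 1 - e^{-p(y+z)} - (1 - e^{-py}) - (1 -
    -- e^{-pz}) factorises.
    have : q.1 * (χ (q.1 + q.2) - χ q.1) + q.2 * (χ (q.1 + q.2) - χ q.2)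
        = -((1 - Real.exp (-(p * q.1))) * (1 - Real.exp (-(p * q.2)))) := by linarith
    rw [← add_mul, this]; ring
  · exact hint _ (by fun_prop) hbd
  · exact hint (fun q => q.swap.1 * (χ (q.swap.1 + q.swap.2) - χ q.swap.1))
      (by simp only [Prod.fst_swap, Prod.snd_swap]; fun_prop) (fun y z hy hz => hbd z y hz hy)

lemma integral_bern_mul_bern (a b : ℝ → ℝ) (p : ℝ) :
    ∫ q, ((1 - Real.exp (-(p * q.1))) * (1 - Real.exp (-(p * q.2)))) * pairing (fun _ _ => 1) a b q
      ∂quadVol = bern a p * bern b p := by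
  rw [bern, bern, ← integral_prod_mul]
  refine integral_congr_ae (Eventually.of_forall fun q => ?_)
  simp only [pairing]; ring

lemma IsPerturbation.kernel_symm {W : ℝ → ℝ → ℝ} (hW : IsPerturbation W) (ε : ℝ) (x y : ℝ)
    (hx : 0 < x) (hy : 0 < y) : kernel W ε x y = kernel W ε y x := by
  rw [kernel, kernel, hW.symm x y hx hy]

/-- The Riccati-type relation between U - pU' and U² becomes linear for p/U, since (p/U)' = (U -
pU')/U². -/
lemma hasDerivAt_div_sq {U U' p : ℝ} {f : ℝ → ℝ} (hf : HasDerivAt f U' p) (hU : f p = U)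
    (h0 : U ≠ 0) (c : ℝ) :
    HasDerivAt (fun q => q / f q - c * q) ((U - p * U') / U ^ 2 - c) p := by
  subst hU
  have h := ((hasDerivAt_id p).div hf h0).sub ((hasDerivAt_id p).const_mul c)
  refine h.congr_deriv ?_
  simp

/-! ### A priori bounds for profiles of mass one -/

section apriori
variable {W : ℝ → ℝ → ℝ} {ε : ℝ} {G : ℝ → ℝ}

lemma IsProfile.integral_id (hm : mass G = 1) : ∫ x, x * G x ∂posVol = 1 := hm

lemma IsProfile.bern_pos (hG : IsProfile (kernel W ε) G) (hm : mass G = 1) {p : ℝ} (hp : 0 < p) :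
    0 < bern G p := by
  have hnn : 0 ≤ᵐ[posVol] fun x => (1 - Real.exp (-(p * x))) * G x := by
    filter_upwards [ae_pos, hG.nonneg] with x hx h
    exact mul_nonneg (by linarith [(exp_neg_mul_mem hp.le hx.le).2]) h
  refine lt_of_le_of_ne (integral_nonneg_of_ae hnn) fun h => ?_
  rw [bern, eq_comm, integral_eq_zero_iff_of_nonneg_ae hnn (integrable_bern hG.memL11.integrable hp.le)] at h
  have h1 : ∫ x, x * G x ∂posVol = 0 := by
    refine integral_eq_zero_of_ae ?_
    filter_upwards [h, ae_pos] with x h hx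
    have h2 : Real.exp (-(p * x)) < 1 := by
      rw [← Real.exp_zero]; exact Real.exp_lt_exp.2 (by nlinarith [mul_pos hp hx])
    rcases mul_eq_zero.1 h with h3 | h3
    · linarith
    · simp [h3]
  rw [IsProfile.integral_id hm] at h1
  exact one_ne_zero h1

/-- Transforming G = B_K(G,G) expresses 2(U - pU') as a double integral of K against nonnegative
factors, and 2 ≤ K ≤ 2 + ε. Nonnegativity of G is essential here. -/
lemma IsProfile.bern_ode (hW : IsPerturbation W) (hε : 0 ≤ ε) (hG : IsProfile (kernel W ε) G)
    {p : ℝ} (hp : 0 < p) :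
    bern G p ^ 2 ≤ bern G p - p * bernDeriv G p ∧
      bern G p - p * bernDeriv G p ≤ (1 + ε / 2) * bern G p ^ 2 := by
  have hK := hW.bddKernel_kernel hε
  have hGi := hG.memL11.integrable
  have h := laplace_gain hK (hW.kernel_symm ε) hGi hGi hp.le
  have h1 : ∫ x, bernKer p x * gain (kernel W ε) G G x ∂posVol = p * bernDeriv G p - bern G p := by
    rw [← integral_bernKer_mul hG.memL11 hp.le]
    refine integral_congr_ae ?_
    filter_upwards [hG.eq_gain hK (hW.kernel_symm ε)] with x hx
    rw [← hx]
  rw [h1] at h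
  have hi : ∀ {L : ℝ → ℝ → ℝ} {M : ℝ}, BddKernel L M → Integrable (fun q : ℝ × ℝ =>
      ((1 - Real.exp (-(p * q.1))) * (1 - Real.exp (-(p * q.2)))) * pairing L G G q) quadVol := by
    intro L M hL
    refine (hL.integrable_weight (w₁ := fun _ => 1) (w₂ := fun _ => 1) hGi.1 hGi.1
      (by simpa using hGi.abs) (by simpa using hGi.abs) (by fun_prop) fun y z hy hz => ?_).1
    have a := exp_neg_mul_mem hp.le hy.le
    have b := exp_neg_mul_mem hp.le hz.le
    simp only
    rw [abs_of_nonneg (mul_nonneg (by linarith) (by linarith))]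
    nlinarith
  have hnn : ∀ᵐ q ∂quadVol, 0 ≤ G q.1 ∧ 0 ≤ G q.2 :=
    (Measure.quasiMeasurePreserving_fst.ae hG.nonneg).and
      (Measure.quasiMeasurePreserving_snd.ae hG.nonneg)
  have hl : 2 * (bern G p * bern G p) ≤ ∫ q : ℝ × ℝ, ((1 - Real.exp (-(p * q.1)))
      * (1 - Real.exp (-(p * q.2)))) * pairing (kernel W ε) G G q ∂quadVol := by
    rw [← integral_bern_mul_bern, ← integral_const_mul]
    refine integral_mono_ae ((hi bddKernel_one).const_mul 2) (hi hK) ?_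
    filter_upwards [ae_quad_pos, hnn] with q hq hg
    have a := exp_neg_mul_mem hp.le hq.1.le
    have b := exp_neg_mul_mem hp.le hq.2.le
    have c := mul_nonneg hε (hW.nonneg _ _ hq.1 hq.2)
    have d : 0 ≤ ((1 - Real.exp (-(p * q.1))) * (1 - Real.exp (-(p * q.2)))) * (G q.1 * G q.2) :=
      mul_nonneg (mul_nonneg (by linarith) (by linarith)) (mul_nonneg hg.1 hg.2)
    simp only [pairing, kernel]
    nlinarith [mul_nonneg c d]
  have hu : ∫ q : ℝ × ℝ, ((1 - Real.exp (-(p * q.1)))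
      * (1 - Real.exp (-(p * q.2)))) * pairing (kernel W ε) G G q ∂quadVol
      ≤ (2 + ε) * (bern G p * bern G p) := by
    rw [← integral_bern_mul_bern, ← integral_const_mul]
    refine integral_mono_ae (hi hK) ((hi bddKernel_one).const_mul (2 + ε)) ?_
    filter_upwards [ae_quad_pos, hnn] with q hq hg
    have a := exp_neg_mul_mem hp.le hq.1.le
    have b := exp_neg_mul_mem hp.le hq.2.le
    have c := mul_nonneg hε (sub_nonneg.2 (hW.le_one _ _ hq.1 hq.2))
    have d : 0 ≤ ((1 - Real.exp (-(p * q.1))) * (1 - Real.exp (-(p * q.2)))) * (G q.1 * G q.2) :=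
      mul_nonneg (mul_nonneg (by linarith) (by linarith)) (mul_nonneg hg.1 hg.2)
    simp only [pairing, kernel]
    nlinarith [mul_nonneg c d]
  constructor <;> nlinarith

/-- The mass is the initial slope of the transform; this is the initial condition in every later
comparison in p. -/
lemma tendsto_bern_div {G : ℝ → ℝ} (hG : MemL11 G) :
    Tendsto (fun p => bern G p / p) (𝓝[>] 0) (𝓝 (∫ x, x * G x ∂posVol)) := by
  have h1 : ∀ p, bern G p / p = ∫ x, (1 - Real.exp (-(p * x))) / p * G x ∂posVol := by
    intro p
    rw [bern, ← integral_div]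
    refine integral_congr_ae (Eventually.of_forall fun x => ?_)
    simp only; ring
  simp_rw [h1]
  refine tendsto_integral_filter_of_dominated_convergence (fun x => |x * G x|) ?_ ?_
    hG.integrable_id.abs ?_
  · exact Eventually.of_forall fun p =>
      (by fun_prop : AEStronglyMeasurable _ posVol).mul hG.aesm
  · filter_upwards [self_mem_nhdsWithin] with p hp
    filter_upwards [ae_pos] with x hx
    have hp : 0 < p := hp
    have h2 := exp_neg_mul_mem hp.le hx.le
    have h3 := Real.add_one_le_exp (-(p * x))
    rw [norm_mul, abs_mul, Real.norm_eq_abs, Real.norm_eq_abs]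
    refine mul_le_mul_of_nonneg_right ?_ (abs_nonneg _)
    rw [abs_of_nonneg (div_nonneg (by linarith) hp.le), abs_of_pos hx, div_le_iff₀ hp]
    linarith
  · refine Eventually.of_forall fun x => ?_
    refine Tendsto.mul_const _ ?_
    have h2 : HasDerivAt (fun p : ℝ => 1 - Real.exp (-(p * x))) x 0 := by
      have h3 : HasDerivAt (fun q : ℝ => -(q * x)) (-(1 * x)) 0 := ((hasDerivAt_id 0).mul_const x).neg
      refine (h3.exp.const_sub 1).congr_deriv ?_
      simp
    have h4 := (hasDerivAt_iff_tendsto_slope.1 h2).mono_left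
      (nhdsWithin_mono 0 (fun p (hp : 0 < p) => hp.ne'))
    refine h4.congr fun p => ?_
    simp [slope_def_field]

/-- The derivative of p/U lies in [1, 1 + ε/2] and p/U → 1 as p → 0, so 1 + p ≤ p/U ≤ 1 + (1 +
ε/2)p. -/
lemma IsProfile.bern_bounds (hW : IsPerturbation W) (hε : 0 ≤ ε) (hG : IsProfile (kernel W ε) G)
    (hm : mass G = 1) {p : ℝ} (hp : 0 < p) :
    p / (1 + (1 + ε / 2) * p) ≤ bern G p ∧ bern G p ≤ p / (1 + p) := by
  have hpos := fun {q : ℝ} (hq : 0 < q) => hG.bern_pos hm hq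
  have hder : ∀ c : ℝ, ∀ q : ℝ, 0 < q → HasDerivAt (fun q => q / bern G q - c * q)
      ((bern G q - q * bernDeriv G q) / bern G q ^ 2 - c) q := fun c q hq =>
    hasDerivAt_div_sq (hasDerivAt_bern hG.memL11 hq) rfl (hpos hq).ne' c
  have hlim : ∀ c : ℝ, Tendsto (fun q => q / bern G q - c * q) (𝓝[>] 0) (𝓝 1) := by
    intro c
    have h1 := (tendsto_bern_div hG.memL11).inv₀ (by rw [IsProfile.integral_id hm]; exact one_ne_zero)
    rw [IsProfile.integral_id hm, inv_one] at h1
    have h2 : Tendsto (fun q : ℝ => c * q) (𝓝[>] 0) (𝓝 (c * 0)) :=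
      ((continuous_const_mul c).tendsto 0).mono_left nhdsWithin_le_nhds
    have h3 := h1.sub h2
    simp only [mul_zero, sub_zero, inv_div] at h3
    exact h3
  have hmono : MonotoneOn (fun q => q / bern G q - 1 * q) (Ioi 0) := by
    refine monotoneOn_of_hasDerivWithinAt_nonneg (convex_Ioi 0)
      (fun q hq => (hder 1 q hq).continuousAt.continuousWithinAt)
      (fun q hq => (hder 1 q (by rwa [interior_Ioi] at hq)).hasDerivWithinAt) fun q hq => ?_
    rw [interior_Ioi] at hq
    have h1 := (hG.bern_ode hW hε hq).1
    rw [sub_nonneg, le_div_iff₀ (pow_pos (hpos hq) 2)]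
    linarith
  have hanti : AntitoneOn (fun q => q / bern G q - (1 + ε / 2) * q) (Ioi 0) := by
    refine antitoneOn_of_hasDerivWithinAt_nonpos (convex_Ioi 0)
      (fun q hq => (hder _ q hq).continuousAt.continuousWithinAt)
      (fun q hq => (hder _ q (by rwa [interior_Ioi] at hq)).hasDerivWithinAt) fun q hq => ?_
    rw [interior_Ioi] at hq
    have h1 := (hG.bern_ode hW hε hq).2
    rw [sub_nonpos, div_le_iff₀ (pow_pos (hpos hq) 2)]
    linarith
  have hsmall : ∀ᶠ q in 𝓝[>] (0 : ℝ), 0 < q ∧ q < p := by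
    filter_upwards [self_mem_nhdsWithin, mem_nhdsWithin_of_mem_nhds (Iio_mem_nhds hp)] with q h1 h2
    exact ⟨h1, h2⟩
  have h1 : 1 ≤ p / bern G p - 1 * p :=
    le_of_tendsto (hlim 1) (hsmall.mono fun q hq => hmono hq.1 hp hq.2.le)
  have h2 : p / bern G p - (1 + ε / 2) * p ≤ 1 :=
    ge_of_tendsto (hlim _) (hsmall.mono fun q hq => hanti hq.1 hp hq.2.le)
  have hU := hpos hp
  constructor
  · rw [div_le_iff₀ (by positivity)]
    have h3 : p / bern G p ≤ 1 + (1 + ε / 2) * p := by linarith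
    rw [div_le_iff₀ hU] at h3
    linarith
  · rw [le_div_iff₀ (by positivity)]
    have h3 : 1 + p ≤ p / bern G p := by linarith
    rw [le_div_iff₀ hU] at h3
    linarith

lemma tendsto_bern_atTop {a : ℝ → ℝ} (ha : Integrable a posVol) :
    Tendsto (bern a) atTop (𝓝 (∫ x, a x ∂posVol)) := by
  refine tendsto_integral_filter_of_dominated_convergence (fun x => |a x|) ?_ ?_ ha.abs ?_
  · exact Eventually.of_forall fun p =>
      (by fun_prop : AEStronglyMeasurable _ posVol).mul ha.1
  · filter_upwards [eventually_ge_atTop 0] with p hp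
    filter_upwards [ae_pos] with x hx
    have h2 := exp_neg_mul_mem hp hx.le
    rw [norm_mul, Real.norm_eq_abs, Real.norm_eq_abs, abs_of_nonneg (by linarith)]
    nlinarith [abs_nonneg (a x)]
  · filter_upwards [ae_pos] with x hx
    have h1 : Tendsto (fun p : ℝ => Real.exp (-(p * x))) atTop (𝓝 0) :=
      Real.tendsto_exp_neg_atTop_nhds_zero.comp (tendsto_id.atTop_mul_const hx)
    simpa using (h1.const_sub 1).mul_const (a x)

lemma IsProfile.integral_bounds (hW : IsPerturbation W) (hε : 0 ≤ ε)
    (hG : IsProfile (kernel W ε) G) (hm : mass G = 1) :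
    1 / (1 + ε / 2) ≤ ∫ x, G x ∂posVol ∧ ∫ x, G x ∂posVol ≤ 1 := by
  have h := tendsto_bern_atTop hG.memL11.integrable
  constructor
  · have h1 : Tendsto (fun p : ℝ => 1 / (p⁻¹ + (1 + ε / 2))) atTop (𝓝 (1 / (0 + (1 + ε / 2)))) :=
      tendsto_const_nhds.div (tendsto_inv_atTop_zero.add_const _) (by positivity)
    rw [zero_add] at h1
    refine le_of_tendsto_of_tendsto h1 h ?_
    filter_upwards [eventually_gt_atTop 0] with p hp
    have h2 := (hG.bern_bounds hW hε hm hp).1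
    refine le_trans (le_of_eq ?_) h2
    field_simp
  · refine le_of_tendsto h ?_
    filter_upwards [eventually_gt_atTop 0] with p hp
    refine (hG.bern_bounds hW hε hm hp).2.trans ?_
    rw [div_le_one (by positivity)]; linarith

/-- The difference vanishes at 0 and is nondecreasing because e^s ≥ 1 + s. With t = px it controls a
truncated second moment by p - U(p). -/
lemma sq_exp_neg_le {t : ℝ} (ht : 0 ≤ t) :
    t ^ 2 / 2 * Real.exp (-t) ≤ t - 1 + Real.exp (-t) := by
  have hd : ∀ s : ℝ, HasDerivAt (fun s : ℝ => s - 1 + Real.exp (-s) - s ^ 2 / 2 * Real.exp (-s))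
      (1 - Real.exp (-s) * (1 + s - s ^ 2 / 2)) s := by
    intro s
    have h1 : HasDerivAt (fun s : ℝ => Real.exp (-s)) (Real.exp (-s) * -1) s :=
      (hasDerivAt_neg s).exp
    have h2 : HasDerivAt (fun s : ℝ => s ^ 2 / 2) s s := by
      refine ((hasDerivAt_pow 2 s).div_const 2).congr_deriv ?_
      simp
    refine ((((hasDerivAt_id s).sub_const 1).add h1).sub (h2.mul h1)).congr_deriv ?_
    ring
  have hmono : MonotoneOn (fun s : ℝ => s - 1 + Real.exp (-s) - s ^ 2 / 2 * Real.exp (-s)) (Ici 0) := by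
    refine monotoneOn_of_hasDerivWithinAt_nonneg (convex_Ici 0)
      (fun s _ => (hd s).continuousAt.continuousWithinAt) (fun s _ => (hd s).hasDerivWithinAt)
      fun s hs => ?_
    rw [interior_Ici] at hs
    have h1 := Real.add_one_le_exp s
    have h2 := Real.exp_pos (-s)
    have h3 : Real.exp (-s) * Real.exp s = 1 := by rw [← Real.exp_add]; simp
    nlinarith [sq_nonneg s]
  have h := hmono (self_mem_Ici) (mem_Ici.2 ht) ht
  simp only [neg_zero, Real.exp_zero] at h
  linarith

/-- The truncated moment is at most 2(p - U(p))/p², and the lower bound on U gives p - U ≤ (1 +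
ε/2)p². The bound is uniform in p, so that the truncation can be removed. -/
lemma IsProfile.integral_sq_exp_le (hW : IsPerturbation W) (hε : 0 ≤ ε)
    (hG : IsProfile (kernel W ε) G) (hm : mass G = 1) {p : ℝ} (hp : 0 < p) :
    Integrable (fun x => x ^ 2 * Real.exp (-(p * x)) * G x) posVol ∧
      ∫ x, x ^ 2 * Real.exp (-(p * x)) * G x ∂posVol ≤ 2 + ε := by
  have hi : Integrable (fun x => 2 / p ^ 2 * (p * (x * G x) - (1 - Real.exp (-(p * x))) * G x)) posVol :=
    ((hG.memL11.integrable_id.const_mul p).sub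
      (integrable_bern hG.memL11.integrable hp.le)).const_mul _
  have hle : ∀ᵐ x ∂posVol, x ^ 2 * Real.exp (-(p * x)) * G x
      ≤ 2 / p ^ 2 * (p * (x * G x) - (1 - Real.exp (-(p * x))) * G x) := by
    filter_upwards [ae_pos, hG.nonneg] with x hx hg
    have h := mul_le_mul_of_nonneg_right (sq_exp_neg_le (mul_pos hp hx).le) hg
    have h2 : 2 / p ^ 2 * (p * (x * G x) - (1 - Real.exp (-(p * x))) * G x)
        = 2 / p ^ 2 * ((p * x - 1 + Real.exp (-(p * x))) * G x) := by ring
    rw [h2]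
    refine le_trans (le_of_eq ?_) (mul_le_mul_of_nonneg_left h (by positivity))
    field_simp
  have hint : Integrable (fun x => x ^ 2 * Real.exp (-(p * x)) * G x) posVol := by
    refine hi.mono' ((by fun_prop : AEStronglyMeasurable _ posVol).mul hG.memL11.aesm) ?_
    filter_upwards [hle, hG.nonneg] with x h hg
    rw [Real.norm_eq_abs, abs_of_nonneg (by positivity)]
    exact h
  refine ⟨hint, (integral_mono_ae hint hi hle).trans ?_⟩
  rw [integral_const_mul, integral_sub (hG.memL11.integrable_id.const_mul p)
    (integrable_bern hG.memL11.integrable hp.le), integral_const_mul, IsProfile.integral_id hm]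
  change 2 / p ^ 2 * (p * 1 - bern G p) ≤ 2 + ε
  have h := (hG.bern_bounds hW hε hm hp).1
  have h1 : p * 1 - bern G p ≤ (1 + ε / 2) * p ^ 2 := by
    have h2 : p - (1 + ε / 2) * p ^ 2 ≤ p / (1 + (1 + ε / 2) * p) := by
      rw [le_div_iff₀ (by positivity)]
      nlinarith [mul_nonneg (sq_nonneg (1 + ε / 2)) (pow_pos hp 3).le]
    linarith
  calc 2 / p ^ 2 * (p * 1 - bern G p) ≤ 2 / p ^ 2 * ((1 + ε / 2) * p ^ 2) :=
        mul_le_mul_of_nonneg_left h1 (by positivity)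
    _ = 2 + ε := by field_simp

/-- Fatou as p = 1/(n+1) → 0 in the truncated bound. The constant tends to the second moment 2 of
e^{-x}, which the Scheffé argument exploits. -/
lemma IsProfile.integral_sq_le (hW : IsPerturbation W) (hε : 0 ≤ ε)
    (hG : IsProfile (kernel W ε) G) (hm : mass G = 1) :
    Integrable (fun x => x ^ 2 * G x) posVol ∧ ∫ x, x ^ 2 * G x ∂posVol ≤ 2 + ε := by
  have hnn : 0 ≤ᵐ[posVol] fun x => x ^ 2 * G x := by
    filter_upwards [hG.nonneg] with x hx
    exact mul_nonneg (sq_nonneg x) hx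
  have haesm : AEStronglyMeasurable (fun x => x ^ 2 * G x) posVol :=
    (by fun_prop : AEStronglyMeasurable _ posVol).mul hG.memL11.aesm
  have hp : ∀ n : ℕ, (0 : ℝ) < 1 / ((n : ℝ) + 1) := fun n => by positivity
  have hn := fun n : ℕ => hG.integral_sq_exp_le hW hε hm (hp n)
  have hle : ∫⁻ x, ENNReal.ofReal (x ^ 2 * G x) ∂posVol ≤ ENNReal.ofReal (2 + ε) := by
    have hF := lintegral_liminf_le' (μ := posVol) (u := atTop) (f := fun (n : ℕ) x =>
      ENNReal.ofReal (x ^ 2 * Real.exp (-(1 / ((n : ℝ) + 1) * x)) * G x))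
      fun n => (hn n).1.1.aemeasurable.ennreal_ofReal
    have hlim : ∀ x, Tendsto (fun n : ℕ =>
        ENNReal.ofReal (x ^ 2 * Real.exp (-(1 / ((n : ℝ) + 1) * x)) * G x)) atTop
        (𝓝 (ENNReal.ofReal (x ^ 2 * G x))) := by
      intro x
      refine ENNReal.tendsto_ofReal ?_
      have h1 : Tendsto (fun n : ℕ => -(1 / ((n : ℝ) + 1) * x)) atTop (𝓝 (-(0 * x))) :=
        (tendsto_one_div_add_atTop_nhds_zero_nat.mul_const x).neg
      have h2 := (Real.continuous_exp.tendsto _).comp h1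
      have h3 := (h2.const_mul (x ^ 2)).mul_const (G x)
      simpa using h3
    rw [lintegral_congr fun x => (hlim x).liminf_eq] at hF
    refine hF.trans (liminf_le_of_le (by isBoundedDefault) fun b hb => ?_)
    obtain ⟨n, hbn⟩ := hb.exists
    refine hbn.trans ?_
    rw [← ofReal_integral_eq_lintegral_ofReal (hn n).1]
    · exact ENNReal.ofReal_le_ofReal (hn n).2
    · filter_upwards [hG.nonneg] with x hx
      exact mul_nonneg (mul_nonneg (sq_nonneg x) (Real.exp_pos _).le) hx
  have hint : Integrable (fun x => x ^ 2 * G x) posVol := by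
    refine ⟨haesm, ?_⟩
    rw [hasFiniteIntegral_iff_ofReal hnn]
    exact hle.trans_lt ENNReal.ofReal_lt_top
  refine ⟨hint, ?_⟩
  rw [integral_eq_lintegral_of_nonneg_ae hnn haesm]
  exact ENNReal.toReal_le_of_le_ofReal (by positivity) hle

lemma IsProfile.memX (hW : IsPerturbation W) (hε : 0 ≤ ε) (hG : IsProfile (kernel W ε) G)
    (hm : mass G = 1) : MemX G := by
  refine (hG.memL11.integrable.add (hG.integral_sq_le hW hε hm).1).congr
    (Eventually.of_forall fun x => ?_)
  simp only [Pi.add_apply]; ring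

/-- From `abs_flux_le` with ∫G ≤ 1; the constant 3 is the kernel bound 2 + ε at ε = 1. -/
lemma IsProfile.id_mul_le (hW : IsPerturbation W) (hε : 0 ≤ ε) (hε1 : ε ≤ 1)
    (hG : IsProfile (kernel W ε) G) (hm : mass G = 1) : ∀ᵐ x ∂posVol, |x * G x| ≤ 3 := by
  have hK := hW.bddKernel_kernel hε
  have hGi := hG.memL11.integrable
  have h0 : ∫ x, |G x| ∂posVol ≤ 1 := by
    refine le_trans (le_of_eq ?_) (hG.integral_bounds hW hε hm).2
    exact integral_congr_ae (by filter_upwards [hG.nonneg] with x hx using abs_of_nonneg hx)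
  have h1 : 0 ≤ ∫ x, |G x| ∂posVol := integral_nonneg fun x => abs_nonneg _
  filter_upwards [hG.eq_gain hK (hW.kernel_symm ε), ae_pos] with x h hx
  have h2 := abs_flux_le hK hGi hGi hx
  rw [h, gain, abs_mul, abs_div, abs_of_pos hx, abs_of_pos (by positivity : 0 < x ^ 2)]
  have h3 : |flux (kernel W ε) G G x| ≤ x * 3 := by
    refine h2.trans (mul_le_mul_of_nonneg_left ?_ hx.le)
    nlinarith [mul_le_one₀ h0 h1 h0]
  calc x * (|flux (kernel W ε) G G x| / x ^ 2) = |flux (kernel W ε) G G x| / x := by field_simp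
    _ ≤ 3 := by rw [div_le_iff₀ hx]; linarith

end apriori

/-! ### Laplace transforms and weak convergence of bounded functions -/

lemma integrable_exp_neg : Integrable (fun x : ℝ => Real.exp (-x)) posVol :=
  integrableOn_exp_neg_Ioi 0

lemma integral_exp_neg : ∫ x, Real.exp (-x) ∂posVol = 1 := integral_exp_neg_Ioi_zero

/-- After replacing f by a compactly supported continuous function, this is Weierstrass
approximation in the variable s = e^{-x} on [0, 1]. -/
lemma exists_polynomial_exp_near {f : ℝ → ℝ} (hf : Integrable f posVol) {η : ℝ} (hη : 0 < η) :
    ∃ q : Polynomial ℝ,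
      Integrable (fun x => Real.exp (-x) * q.eval (Real.exp (-x))) posVol ∧
      ∫ x, |f x - Real.exp (-x) * q.eval (Real.exp (-x))| ∂posVol ≤ η := by
  have hf' : Integrable ((Ioi (0 : ℝ)).indicator f) volume := by
    rw [integrable_indicator_iff measurableSet_Ioi]; exact hf
  obtain ⟨g, hgs, hgle, hgc, hgi⟩ := hf'.exists_hasCompactSupport_integral_sub_le (half_pos hη)
  obtain ⟨R, hR⟩ : ∃ R : ℝ, ∀ x, R < x → g x = 0 := by
    obtain ⟨R, hR⟩ := hgs.isCompact.bddAbove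
    exact ⟨R, fun x hx => image_eq_zero_of_notMem_tsupport fun h => absurd (hR h) (not_le.2 hx)⟩
  -- φ vanishes near s = 0, hence is continuous on [0, 1]. The division by s leaves a spare factor
  -- e^{-x}, which turns a uniform error η/2 into an L¹ error η/2.
  set φ : ℝ → ℝ := fun s => g (-Real.log s) / s with hφ
  have hφ0 : ∀ s, 0 ≤ s → s < Real.exp (-R) → φ s = 0 := by
    intro s hs hs2
    rcases hs.eq_or_lt with rfl | hs
    · simp [hφ]
    · simp only [hφ]
      rw [hR, zero_div]
      have := (Real.log_lt_iff_lt_exp hs).2 hs2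
      linarith
  have hφc : ContinuousOn φ (Icc 0 1) := by
    intro s hs
    rcases hs.1.eq_or_lt with h0 | h0
    · have : φ =ᶠ[𝓝[Icc 0 1] s] fun _ => 0 := by
        have h1 : Iio (Real.exp (-R)) ∈ 𝓝 s := Iio_mem_nhds (by rw [← h0]; exact Real.exp_pos _)
        filter_upwards [mem_nhdsWithin_of_mem_nhds h1, self_mem_nhdsWithin] with t ht1 ht2
        exact hφ0 t ht2.1 ht1
      exact (continuousWithinAt_const.congr_of_eventuallyEq this
        (by rw [← h0]; exact hφ0 0 le_rfl (Real.exp_pos _)))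
    · refine ContinuousAt.continuousWithinAt ?_
      refine ContinuousAt.div ?_ continuousAt_id h0.ne'
      exact hgc.continuousAt.comp (Real.continuousAt_log h0.ne').neg
  obtain ⟨q, hq⟩ := exists_polynomial_near_of_continuousOn 0 1 φ hφc (η / 2) (half_pos hη)
  have hb : ∀ x, 0 < x → |g x - Real.exp (-x) * q.eval (Real.exp (-x))| ≤ η / 2 * Real.exp (-x) := by
    intro x hx
    have hs : Real.exp (-x) ∈ Icc (0 : ℝ) 1 :=
      ⟨(Real.exp_pos _).le, Real.exp_le_one_iff.2 (by linarith)⟩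
    have h1 := hq _ hs
    have h2 : g x = Real.exp (-x) * φ (Real.exp (-x)) := by
      simp only [hφ, Real.log_exp, neg_neg]
      field_simp
    rw [h2, ← mul_sub, abs_mul, abs_of_pos (Real.exp_pos _), abs_sub_comm, mul_comm]
    exact mul_le_mul_of_nonneg_right h1.le (Real.exp_pos _).le
  have hgi' : Integrable g posVol := hgi.restrict
  have hdi : Integrable (fun x => g x - Real.exp (-x) * q.eval (Real.exp (-x))) posVol := by
    refine (integrable_exp_neg.const_mul (η / 2)).mono' ?_ ?_
    · refine hgi'.1.sub (Continuous.aestronglyMeasurable ?_)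
      exact (by fun_prop : Continuous fun x : ℝ => Real.exp (-x)).mul
        (q.continuous.comp (by fun_prop))
    · filter_upwards [ae_pos] with x hx using hb x hx
  have hqi : Integrable (fun x => Real.exp (-x) * q.eval (Real.exp (-x))) posVol := by
    refine (hgi'.sub hdi).congr (Eventually.of_forall fun x => ?_)
    simp
  refine ⟨q, hqi, ?_⟩
  have h1 : ∫ x, |f x - g x| ∂posVol ≤ η / 2 := by
    refine le_trans ?_ hgle
    have : ∫ x, |f x - g x| ∂posVol = ∫ x, ‖(Ioi (0 : ℝ)).indicator f x - g x‖ ∂posVol := by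
      refine setIntegral_congr_fun measurableSet_Ioi fun x hx => ?_
      simp only [indicator_of_mem hx, Real.norm_eq_abs]
    rw [this]
    exact setIntegral_le_integral (hf'.sub hgi).norm (Eventually.of_forall fun x => norm_nonneg _)
  have h2 : ∫ x, |g x - Real.exp (-x) * q.eval (Real.exp (-x))| ∂posVol ≤ η / 2 := by
    calc _ ≤ ∫ x, η / 2 * Real.exp (-x) ∂posVol := by
          refine integral_mono_ae hdi.abs (integrable_exp_neg.const_mul _) ?_
          filter_upwards [ae_pos] with x hx using hb x hx
      _ = η / 2 := by rw [integral_const_mul, integral_exp_neg, mul_one]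
  have hfg : Integrable (fun x => f x - g x) posVol := hf.sub hgi'
  calc _ ≤ ∫ x, (|f x - g x| + |g x - Real.exp (-x) * q.eval (Real.exp (-x))|) ∂posVol := by
        refine integral_mono (hf.sub hqi).abs (hfg.abs.add hdi.abs) fun x => ?_
        exact abs_sub_le _ _ _
    _ ≤ η := by
        rw [integral_add hfg.abs hdi.abs]
        linarith

lemma integrable_mul_of_bdd {f d : ℝ → ℝ} (hf : Integrable f posVol)
    (hd : AEStronglyMeasurable d posVol) {C : ℝ} (hC : ∀ᵐ x ∂posVol, |d x| ≤ C) :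
    Integrable (fun x => f x * d x) posVol :=
  hf.mul_bdd hd hC

/-- A bounded sequence whose Laplace transforms vanish in the limit vanishes weakly. -/
theorem tendsto_integral_of_laplace {d : ℕ → ℝ → ℝ} {C : ℝ}
    (hdm : ∀ n, AEStronglyMeasurable (d n) posVol) (hdb : ∀ n, ∀ᵐ x ∂posVol, |d n x| ≤ C)
    (hd : ∀ p : ℝ, 0 < p → Tendsto (fun n => ∫ x, Real.exp (-(p * x)) * d n x ∂posVol) atTop (𝓝 0))
    {f : ℝ → ℝ} (hf : Integrable f posVol) :
    Tendsto (fun n => ∫ x, f x * d n x ∂posVol) atTop (𝓝 0) := by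
  have hC : 0 ≤ C := by
    have h1 := hdb 0
    have : posVol ≠ 0 := by
      rw [posVol, Ne, Measure.restrict_eq_zero]; simp
    have := ae_neBot.2 this
    obtain ⟨x, hx⟩ := h1.exists
    exact (abs_nonneg _).trans hx
  have hpow : ∀ q : Polynomial ℝ, Tendsto (fun n => ∫ x,
      (Real.exp (-x) * q.eval (Real.exp (-x))) * d n x ∂posVol) atTop (𝓝 0) := by
    intro q
    -- The spare factor e^{-x} makes every exponent k + 1 positive, where the Laplace hypothesis
    -- applies.
    have hk : ∀ (k : ℕ) (x : ℝ), Real.exp (-x) * Real.exp (-x) ^ k = Real.exp (-(((k : ℝ) + 1) * x)) := by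
      intro k x
      rw [← Real.exp_nat_mul, ← Real.exp_add]; ring_nf
    have hi : ∀ (k n : ℕ), Integrable (fun x => Real.exp (-(((k : ℝ) + 1) * x)) * d n x) posVol := by
      intro k n
      refine integrable_mul_of_bdd ?_ (hdm n) (hdb n)
      have h1 : (0 : ℝ) < (k : ℝ) + 1 := by positivity
      have := integrableOn_exp_mul_Ioi (neg_lt_zero.2 h1) 0
      simp only [neg_mul] at this
      exact this
    have h1 : ∀ n, ∫ x, (Real.exp (-x) * q.eval (Real.exp (-x))) * d n x ∂posVol
        = ∑ k ∈ Finset.range (q.natDegree + 1), q.coeff k *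
          ∫ x, Real.exp (-(((k : ℝ) + 1) * x)) * d n x ∂posVol := by
      intro n
      simp_rw [← integral_const_mul]
      rw [← integral_finsetSum _ fun k _ => (hi k n).const_mul _]
      refine integral_congr_ae (Eventually.of_forall fun x => ?_)
      simp only [Polynomial.eval_eq_sum_range, Finset.mul_sum, Finset.sum_mul, ← hk]
      refine Finset.sum_congr rfl fun k _ => ?_
      ring
    simp_rw [h1]
    have h2 := tendsto_finsetSum (Finset.range (q.natDegree + 1)) fun k _ =>
      (hd ((k : ℝ) + 1) (by positivity)).const_mul (q.coeff k)
    simpa using h2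
  rw [Metric.tendsto_atTop]
  intro η hη
  obtain ⟨q, hqi, hq⟩ := exists_polynomial_exp_near hf (η := η / (2 * (C + 1))) (by positivity)
  obtain ⟨N, hN⟩ := Metric.tendsto_atTop.1 (hpow q) (η / 2) (half_pos hη)
  refine ⟨N, fun n hn => ?_⟩
  have h1 := hN n hn
  rw [Real.dist_eq, sub_zero] at h1 ⊢
  have hi1 := integrable_mul_of_bdd hqi (hdm n) (hdb n)
  have hfq : Integrable (fun x => f x - Real.exp (-x) * q.eval (Real.exp (-x))) posVol := hf.sub hqi
  have hi2 := integrable_mul_of_bdd hfq (hdm n) (hdb n)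
  have h2 : ∫ x, f x * d n x ∂posVol
      = (∫ x, (f x - Real.exp (-x) * q.eval (Real.exp (-x))) * d n x ∂posVol)
        + ∫ x, (Real.exp (-x) * q.eval (Real.exp (-x))) * d n x ∂posVol := by
    rw [← integral_add hi2 hi1]
    refine integral_congr_ae (Eventually.of_forall fun x => ?_)
    simp only; ring
  have h3 : |∫ x, (f x - Real.exp (-x) * q.eval (Real.exp (-x))) * d n x ∂posVol|
      ≤ η / (2 * (C + 1)) * C := by
    calc _ ≤ ∫ x, |f x - Real.exp (-x) * q.eval (Real.exp (-x))| * C ∂posVol := by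
          rw [← Real.norm_eq_abs]
          refine norm_integral_le_of_norm_le ((hf.sub hqi).abs.mul_const C) ?_
          filter_upwards [hdb n] with x hx
          rw [norm_mul, Real.norm_eq_abs, Real.norm_eq_abs]
          exact mul_le_mul_of_nonneg_left hx (abs_nonneg _)
      _ ≤ _ := by
          rw [integral_mul_const]
          exact mul_le_mul_of_nonneg_right hq hC
  have h4 : η / (2 * (C + 1)) * C ≤ η / 2 := by
    rw [div_mul_eq_mul_div, div_le_div_iff₀ (by positivity) (by positivity)]
    nlinarith
  rw [h2]
  calc _ ≤ _ := abs_add_le _ _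
    _ < η := by linarith

/-- A bounded function is determined by its Laplace transform. -/
lemma ae_eq_zero_of_laplace {d : ℝ → ℝ} {C : ℝ} (hdm : AEStronglyMeasurable d posVol)
    (hdb : ∀ᵐ x ∂posVol, |d x| ≤ C)
    (hd : ∀ p : ℝ, 0 < p → ∫ x, Real.exp (-(p * x)) * d x ∂posVol = 0) : d =ᵐ[posVol] 0 := by
  have hi := integrable_mul_of_bdd integrable_exp_neg hdm hdb
  have hii := integrable_mul_of_bdd hi hdm hdb
  -- The constant sequence d tested against the integrable function e^{-x}d gives ∫ e^{-x}d² = 0.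
  have h := tendsto_integral_of_laplace (d := fun _ => d) (fun _ => hdm) (fun _ => hdb)
    (fun p hp => by simp only [hd p hp]; exact tendsto_const_nhds) hi
  have h0 := tendsto_nhds_unique tendsto_const_nhds h
  rw [integral_eq_zero_iff_of_nonneg (fun x => ?_) hii] at h0
  · filter_upwards [h0] with x hx
    simpa [Real.exp_ne_zero] using hx
  · have : Real.exp (-x) * d x * d x = Real.exp (-x) * (d x) ^ 2 := by ring
    simp only [Pi.zero_apply, this]; positivity

/-! ### The exponential profile and tail integrals -/

lemma integrable_pow_exp (n : ℕ) {p : ℝ} (hp : 0 < p) :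
    Integrable (fun x : ℝ => x ^ n * Real.exp (-(p * x))) posVol := by
  have h := integrableOn_rpow_mul_exp_neg_mul_rpow (p := 1) (s := n) (b := p)
    (by have : (0 : ℝ) ≤ n := n.cast_nonneg
        linarith) one_pos hp
  refine Integrable.congr (f := fun x : ℝ => x ^ (n : ℝ) * Real.exp (-p * x ^ (1 : ℝ))) h ?_
  exact Eventually.of_forall fun x => by simp only [Real.rpow_natCast, Real.rpow_one, neg_mul]

lemma integral_pow_exp (n : ℕ) {p : ℝ} (hp : 0 < p) :
    ∫ x, x ^ n * Real.exp (-(p * x)) ∂posVol = n.factorial / p ^ (n + 1) := by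
  have h := Real.integral_rpow_mul_exp_neg_mul_Ioi (a := n + 1) (r := p) (by positivity) hp
  rw [Real.Gamma_nat_eq_factorial] at h
  have h1 : ((n : ℝ) + 1) = ((n + 1 : ℕ) : ℝ) := by push_cast; rfl
  simp only [add_sub_cancel_right] at h
  simp_rw [Real.rpow_natCast] at h
  rw [h, h1, Real.rpow_natCast, one_div, inv_pow]
  field_simp

/-- The self-similar profile of the constant kernel `2`. -/
noncomputable def expProfile (x : ℝ) : ℝ := Real.exp (-x)

lemma integrable_pow_expProfile (n : ℕ) : Integrable (fun x => x ^ n * expProfile x) posVol := by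
  simpa [expProfile] using integrable_pow_exp n one_pos

lemma integral_pow_expProfile (n : ℕ) : ∫ x, x ^ n * expProfile x ∂posVol = n.factorial := by
  simpa [expProfile] using integral_pow_exp n one_pos

lemma expProfile_pos (x : ℝ) : 0 < expProfile x := Real.exp_pos _

lemma memX_expProfile : MemX expProfile := by
  refine ((integrable_pow_expProfile 0).add (integrable_pow_expProfile 2)).congr
    (Eventually.of_forall fun x => ?_)
  simp only [Pi.add_apply]; ring

lemma nX_expProfile : nX expProfile = 3 := by
  have h : ∀ x, |expProfile x| * (1 + x ^ 2) = x ^ 0 * expProfile x + x ^ 2 * expProfile x := by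
    intro x; rw [abs_of_pos (expProfile_pos x)]; ring
  simp_rw [nX, h]
  rw [integral_add (integrable_pow_expProfile 0) (integrable_pow_expProfile 2),
    integral_pow_expProfile, integral_pow_expProfile]
  norm_num [Nat.factorial]

/-- The tail integral. -/
noncomputable def tail (r : ℝ → ℝ) (x : ℝ) : ℝ := ∫ z in Ioi x, r z

lemma continuousOn_tail {r : ℝ → ℝ} (hr : Integrable r posVol) : ContinuousOn (tail r) (Ici 0) :=
  IntegrableOn.continuousOn_Ici_primitive_Ioi hr

lemma tail_expProfile (x : ℝ) : tail expProfile x = Real.exp (-x) := integral_exp_neg_Ioi x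

lemma posVol_restrict_Ioi {x : ℝ} (hx : 0 ≤ x) :
    posVol.restrict (Ioi x) = volume.restrict (Ioi x) := by
  rw [Measure.restrict_restrict measurableSet_Ioi, inter_eq_left.2 (Ioi_subset_Ioi hx)]

lemma posVol_restrict_Ioo {x y : ℝ} (hx : 0 ≤ x) :
    posVol.restrict (Ioo x y) = volume.restrict (Ioo x y) := by
  rw [Measure.restrict_restrict measurableSet_Ioo, inter_eq_left.2]
  exact fun z hz => hx.trans_lt hz.1

lemma abs_tail_le {r : ℝ → ℝ} (hr : Integrable r posVol) {x : ℝ} (hx : 0 ≤ x) :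
    |tail r x| ≤ ∫ z, |r z| ∂posVol := by
  calc |tail r x| ≤ ∫ z in Ioi x, |r z| := abs_integral_le_integral_abs
    _ ≤ _ := by
      rw [← posVol_restrict_Ioi hx]
      exact setIntegral_le_integral hr.abs (Eventually.of_forall fun x => abs_nonneg _)

lemma tail_sub {a b : ℝ → ℝ} (ha : Integrable a posVol) (hb : Integrable b posVol) {x : ℝ}
    (hx : 0 ≤ x) : tail (fun z => a z - b z) x = tail a x - tail b x :=
  integral_sub (IntegrableOn.mono_set ha (Ioi_subset_Ioi hx))
    (IntegrableOn.mono_set hb (Ioi_subset_Ioi hx))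

lemma flux_one_eq {a b : ℝ → ℝ} (ha : Integrable a posVol) (hb : Integrable b posVol) (x : ℝ) :
    flux (fun _ _ => 1) a b x = ∫ y in Ioo 0 x, y * a y * tail b (x - y) := by
  rw [flux_eq_iterated bddKernel_one ha hb]
  simp only [one_mul]; rfl

lemma mul_exp_neg_le (x : ℝ) : x * Real.exp (-x) ≤ 1 := by
  have h1 := Real.add_one_le_exp x
  have h2 : Real.exp (-x) * Real.exp x = 1 := by rw [← Real.exp_add]; simp
  nlinarith [Real.exp_pos (-x)]

/-! ### Convergence of profiles to the exponential as ε → 0 -/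

section closeness
variable {W : ℕ → ℝ → ℝ → ℝ} {ε : ℕ → ℝ} {G : ℕ → ℝ → ℝ}

lemma tendsto_bern_profile (hW : ∀ n, IsPerturbation (W n)) (h0 : ∀ n, 0 ≤ ε n)
    (hε : Tendsto ε atTop (𝓝 0)) (hG : ∀ n, IsProfile (kernel (W n) (ε n)) (G n))
    (hm : ∀ n, mass (G n) = 1) {p : ℝ} (hp : 0 < p) :
    Tendsto (fun n => bern (G n) p) atTop (𝓝 (p / (1 + p))) := by
  refine tendsto_of_tendsto_of_tendsto_of_le_of_le ?_ tendsto_const_nhds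
    (fun n => ((hG n).bern_bounds (hW n) (h0 n) (hm n) hp).1)
    fun n => ((hG n).bern_bounds (hW n) (h0 n) (hm n) hp).2
  have h1 : Tendsto (fun n => 1 + (1 + ε n / 2) * p) atTop (𝓝 (1 + (1 + 0 / 2) * p)) :=
    (((hε.div_const 2).const_add 1).mul_const p).const_add 1
  have h2 := (tendsto_const_nhds (x := p)).div h1 (by simp; positivity)
  rw [zero_div, add_zero, one_mul] at h2
  exact h2

/-- The two-sided inequality for U - pU' determines U' from U in the limit, so no limit has to be
differentiated. -/
lemma tendsto_bernDeriv_profile (hW : ∀ n, IsPerturbation (W n)) (h0 : ∀ n, 0 ≤ ε n)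
    (hε : Tendsto ε atTop (𝓝 0)) (hG : ∀ n, IsProfile (kernel (W n) (ε n)) (G n))
    (hm : ∀ n, mass (G n) = 1) {p : ℝ} (hp : 0 < p) :
    Tendsto (fun n => bernDeriv (G n) p) atTop (𝓝 (1 / (1 + p) ^ 2)) := by
  have hU := tendsto_bern_profile hW h0 hε hG hm hp
  have h1 : Tendsto (fun n => bern (G n) p - p * bernDeriv (G n) p) atTop
      (𝓝 ((p / (1 + p)) ^ 2)) := by
    refine tendsto_of_tendsto_of_tendsto_of_le_of_le (hU.pow 2) ?_
      (fun n => ((hG n).bern_ode (hW n) (h0 n) hp).1)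
      fun n => ((hG n).bern_ode (hW n) (h0 n) hp).2
    have h2 := (((hε.div_const 2).const_add 1).mul (hU.pow 2))
    simpa using h2
  have h2 := (hU.sub h1).div_const p
  have h3 : (p / (1 + p) - (p / (1 + p)) ^ 2) / p = 1 / (1 + p) ^ 2 := by field_simp; ring
  rw [h3] at h2
  refine h2.congr fun n => ?_
  field_simp
  ring

/-- U' is the Laplace transform of xG and tends to 1/(1+p)², the transform of xe^{-x}. The
differences are bounded by 3 + 1 = 4, so convergence of the transforms implies weak convergence. -/
lemma weak_tendsto_profile (hW : ∀ n, IsPerturbation (W n)) (h0 : ∀ n, 0 ≤ ε n)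
    (h1 : ∀ n, ε n ≤ 1)
    (hε : Tendsto ε atTop (𝓝 0)) (hG : ∀ n, IsProfile (kernel (W n) (ε n)) (G n))
    (hm : ∀ n, mass (G n) = 1) {f : ℝ → ℝ} (hf : Integrable f posVol) :
    Tendsto (fun n => ∫ x, f x * (x * G n x - x * expProfile x) ∂posVol) atTop (𝓝 0) := by
  have hei := integrable_pow_expProfile 1
  simp only [pow_one] at hei
  refine tendsto_integral_of_laplace (C := 4) (fun n =>
    (hG n).memL11.integrable_id.1.sub hei.1) (fun n => ?_) (fun p hp => ?_) hf
  · filter_upwards [(hG n).id_mul_le (hW n) (h0 n) (h1 n) (hm n), ae_pos] with x hx hx0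
    have h2 : |x * expProfile x| ≤ 1 := by
      rw [abs_of_pos (mul_pos hx0 (expProfile_pos x))]; exact mul_exp_neg_le x
    exact (abs_sub _ _).trans (by linarith)
  · have h2 : ∀ n, ∫ x, Real.exp (-(p * x)) * (x * G n x - x * expProfile x) ∂posVol
        = bernDeriv (G n) p - 1 / (1 + p) ^ 2 := by
      intro n
      have h3 : ∫ x, Real.exp (-(p * x)) * (x * expProfile x) ∂posVol = 1 / (1 + p) ^ 2 := by
        have h4 := integral_pow_exp 1 (p := 1 + p) (by positivity)
        simp only [pow_one, Nat.factorial_one, Nat.cast_one] at h4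
        rw [← h4]
        refine integral_congr_ae (Eventually.of_forall fun x => ?_)
        simp only [expProfile]
        rw [mul_left_comm, ← Real.exp_add]; ring_nf
      rw [← h3, bernDeriv, ← integral_sub (integrable_exp_mul (hG n).memL11.integrable_id hp.le)
        (integrable_exp_mul hei hp.le)]
      exact integral_congr_ae (Eventually.of_forall fun x => mul_sub _ _ _)
    refine Tendsto.congr (fun n => (h2 n).symm) ?_
    have h3 := (tendsto_bernDeriv_profile hW h0 hε hG hm hp).sub_const (1 / (1 + p) ^ 2)
    rwa [sub_self] at h3

/-- On (s, R) weak convergence of xG is tested against 1/x; beyond R the unit masses leave at most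
2/R. -/
lemma tendsto_tail_profile (hW : ∀ n, IsPerturbation (W n)) (h0 : ∀ n, 0 ≤ ε n)
    (h1 : ∀ n, ε n ≤ 1)
    (hε : Tendsto ε atTop (𝓝 0)) (hG : ∀ n, IsProfile (kernel (W n) (ε n)) (G n))
    (hm : ∀ n, mass (G n) = 1) {s : ℝ} (hs : 0 < s) :
    Tendsto (fun n => tail (G n) s - Real.exp (-s)) atTop (𝓝 0) := by
  have hei := integrable_pow_expProfile 1
  simp only [pow_one] at hei
  have hdi : ∀ n, Integrable (fun x => x * G n x - x * expProfile x) posVol := fun n =>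
    (hG n).memL11.integrable_id.sub hei
  have hd1 : ∀ n, ∫ x, |x * G n x - x * expProfile x| ∂posVol ≤ 2 := by
    intro n
    have h2 : ∫ x, |x * G n x| ∂posVol = 1 := by
      rw [← IsProfile.integral_id (hm n)]
      refine integral_congr_ae ?_
      filter_upwards [(hG n).nonneg, ae_pos] with x h3 h4 using abs_of_nonneg (by positivity)
    have h3 : ∫ x, |x * expProfile x| ∂posVol = 1 := by
      have h4 := integral_pow_expProfile 1
      simp only [pow_one, Nat.factorial_one, Nat.cast_one] at h4
      rw [← h4]
      refine integral_congr_ae ?_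
      filter_upwards [ae_pos] with x h4 using abs_of_pos (mul_pos h4 (expProfile_pos x))
    calc _ ≤ ∫ x, (|x * G n x| + |x * expProfile x|) ∂posVol :=
          integral_mono (hdi n).abs ((hG n).memL11.integrable_id.abs.add hei.abs) fun x => abs_sub _ _
      _ = 2 := by
          rw [integral_add (hG n).memL11.integrable_id.abs hei.abs, h2, h3]; norm_num
  rw [Metric.tendsto_atTop]
  intro η hη
  set R : ℝ := s + 4 / η with hR
  have hRs : s < R := by rw [hR]; have : 0 < 4 / η := by positivity
                         linarith
  have hR0 : 0 < R := hs.trans hRs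
  have hf : Integrable ((Ioo s R).indicator fun x : ℝ => x⁻¹) posVol := by
    rw [integrable_indicator_iff measurableSet_Ioo, IntegrableOn, posVol_restrict_Ioo hs.le]
    refine (intervalIntegrable_iff_integrableOn_Ioo_of_le hRs.le).1 ?_
    refine ContinuousOn.intervalIntegrable ?_
    refine continuousOn_inv₀.mono fun x hx => ?_
    rw [uIcc_of_le hRs.le] at hx
    exact (hs.trans_le hx.1).ne'
  obtain ⟨N, hN⟩ := Metric.tendsto_atTop.1 (weak_tendsto_profile hW h0 h1 hε hG hm hf) (η / 2)
    (half_pos hη)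
  refine ⟨N, fun n hn => ?_⟩
  have h2 := hN n hn
  rw [Real.dist_eq, sub_zero] at h2 ⊢
  rw [← tail_expProfile, ← tail_sub (hG n).memL11.integrable memX_expProfile.integrable hs.le]
  set d : ℝ → ℝ := fun x => x * G n x - x * expProfile x with hd
  have hgi : Integrable (fun x => G n x - expProfile x) posVol :=
    (hG n).memL11.integrable.sub memX_expProfile.integrable
  have h3 : tail (fun z => G n z - expProfile z) s
      = (∫ x, (Ioo s R).indicator (fun x : ℝ => x⁻¹) x * d x ∂posVol)
        + ∫ x in Ici R, (G n x - expProfile x) := by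
    have h4 : Ioi s = Ioo s R ∪ Ici R := (Ioo_union_Ici_eq_Ioi hRs).symm
    rw [tail, h4, setIntegral_union _ measurableSet_Ici]
    · congr 1
      have h5 : ∀ x, (Ioo s R).indicator (fun x : ℝ => x⁻¹) x * d x
          = (Ioo s R).indicator (fun x => G n x - expProfile x) x := by
        intro x
        by_cases hx : x ∈ Ioo s R
        · rw [indicator_of_mem hx, indicator_of_mem hx]
          have : x ≠ 0 := (hs.trans hx.1).ne'
          simp only [hd]; field_simp
        · rw [indicator_of_notMem hx, indicator_of_notMem hx, zero_mul]
      simp_rw [h5]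
      rw [integral_indicator measurableSet_Ioo, posVol_restrict_Ioo hs.le]
    · exact IntegrableOn.mono_set hgi fun x hx => hs.trans hx.1
    · exact IntegrableOn.mono_set hgi fun x hx => hR0.trans_le hx
    · exact Set.disjoint_left.2 fun x hx hx2 => absurd hx.2 (not_lt.2 hx2)
  have h4 : |∫ x in Ici R, (G n x - expProfile x)| ≤ 2 / R := by
    calc _ ≤ ∫ x in Ici R, |d x| / R := by
          rw [← Real.norm_eq_abs]
          refine norm_integral_le_of_norm_le
            (IntegrableOn.mono_set (s := Ici R) (t := Ioi 0) ((hdi n).abs.div_const R)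
              fun x hx => hR0.trans_le hx) ?_
          filter_upwards [ae_restrict_mem measurableSet_Ici] with x hx
          rw [Real.norm_eq_abs, le_div_iff₀ hR0]
          simp only [hd]
          rw [← mul_sub, abs_mul, abs_of_pos (hR0.trans_le hx), mul_comm]
          exact mul_le_mul_of_nonneg_right hx (abs_nonneg _)
      _ ≤ ∫ x, |d x| / R ∂posVol := by
          refine setIntegral_mono_set (s := Ici R) (t := Ioi 0) ((hdi n).abs.div_const R)
            (Eventually.of_forall fun x => by positivity)
            (Eventually.of_forall fun x hx => hR0.trans_le hx)
      _ ≤ 2 / R := by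
          rw [integral_div]
          exact div_le_div_of_nonneg_right (hd1 n) hR0.le
  have h5 : 2 / R < η / 2 := by
    rw [div_lt_div_iff₀ hR0 two_pos]
    have : η * R = η * s + 4 := by rw [hR]; field_simp
    nlinarith [mul_pos hη hs]
  rw [h3]
  calc _ ≤ _ := abs_add_le _ _
    _ < η := by linarith

end closeness

lemma flux_one_expProfile {x : ℝ} (hx : 0 < x) :
    flux (fun _ _ => 1) expProfile expProfile x = x ^ 2 / 2 * Real.exp (-x) := by
  have hi := memX_expProfile.integrable
  rw [flux_one_eq hi hi]
  have h : ∀ y, y * expProfile y * tail expProfile (x - y) = Real.exp (-x) * y := by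
    intro y
    rw [tail_expProfile, expProfile, mul_assoc, ← Real.exp_add, mul_comm]
    ring_nf
  simp_rw [h]
  rw [integral_const_mul, ← integral_Ioc_eq_integral_Ioo,
    ← intervalIntegral.integral_of_le hx.le, integral_id]
  ring

lemma aesm_tail_comp {r : ℝ → ℝ} (hr : Integrable r posVol) (x : ℝ) :
    AEStronglyMeasurable (fun y => tail r (x - y)) (volume.restrict (Ioo 0 x)) := by
  refine ContinuousOn.aestronglyMeasurable ?_ measurableSet_Ioo
  refine (continuousOn_tail hr).comp (by fun_prop) fun y hy => ?_
  simp only [mem_Ici]; linarith [hy.2]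

section closeness
variable {W : ℕ → ℝ → ℝ → ℝ} {ε : ℕ → ℝ} {G : ℕ → ℝ → ℝ}

lemma IsProfile.integral_abs_le {W : ℝ → ℝ → ℝ} {ε : ℝ} {G : ℝ → ℝ} (hW : IsPerturbation W)
    (hε : 0 ≤ ε) (hG : IsProfile (kernel W ε) G) (hm : mass G = 1) :
    ∫ x, |G x| ∂posVol ≤ 1 := by
  refine le_trans (le_of_eq ?_) (hG.integral_bounds hW hε hm).2
  exact integral_congr_ae (by filter_upwards [hG.nonneg] with x hx using abs_of_nonneg hx)

/-- The flux is the integral over (0, x) of yG(y) times the tail at x - y. Replacing the tail by its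
limit costs nothing because yG is bounded and tails converge boundedly; what remains is weak
convergence against e^{-(x-y)}. -/
lemma tendsto_flux_profile (hW : ∀ n, IsPerturbation (W n)) (h0 : ∀ n, 0 ≤ ε n)
    (h1 : ∀ n, ε n ≤ 1)
    (hε : Tendsto ε atTop (𝓝 0)) (hG : ∀ n, IsProfile (kernel (W n) (ε n)) (G n))
    (hm : ∀ n, mass (G n) = 1) {x : ℝ} (hx : 0 < x) :
    Tendsto (fun n => flux (fun _ _ => 1) (G n) (G n) x) atTop (𝓝 (x ^ 2 / 2 * Real.exp (-x))) := by
  have hGi := fun n => (hG n).memL11.integrable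
  have hei := memX_expProfile.integrable
  have hGL := fun n => (hG n).integral_abs_le (hW n) (h0 n) (hm n)
  have hb : ∀ n, ∀ᵐ y ∂volume.restrict (Ioo 0 x), |y * G n y| ≤ 3 := fun n =>
    ae_mono (Measure.restrict_mono_set _ fun y hy => hy.1)
      ((hG n).id_mul_le (hW n) (h0 n) (h1 n) (hm n))
  have hT : ∀ n, ∀ y ∈ Ioo 0 x, |tail (G n) (x - y) - Real.exp (-(x - y))| ≤ 2 := by
    intro n y hy
    have h2 := (abs_tail_le (hGi n) (sub_nonneg.2 hy.2.le)).trans (hGL n)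
    have h3 : |Real.exp (-(x - y))| ≤ 1 := by
      rw [abs_of_pos (Real.exp_pos _)]; exact Real.exp_le_one_iff.2 (by linarith [hy.2])
    exact (abs_sub _ _).trans (by linarith)
  have hTm : ∀ n, AEStronglyMeasurable (fun y => tail (G n) (x - y) - Real.exp (-(x - y)))
      (volume.restrict (Ioo 0 x)) := fun n => (aesm_tail_comp (hGi n) x).sub (by fun_prop)
  have hfin : ∀ c : ℝ, Integrable (fun _ : ℝ => c) (volume.restrict (Ioo 0 x)) := fun c =>
    integrableOn_const (by simp)
  have hTi : ∀ n, Integrable (fun y => tail (G n) (x - y) - Real.exp (-(x - y)))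
      (volume.restrict (Ioo 0 x)) := fun n => (hfin 2).mono' (hTm n)
        ((ae_restrict_mem measurableSet_Ioo).mono fun y hy => hT n y hy)
  have hGm : ∀ n, AEStronglyMeasurable (fun y => y * G n y) (volume.restrict (Ioo 0 x)) := fun n =>
    (hG n).memL11.integrable_id.1.mono_measure (Measure.restrict_mono_set _ fun y hy => hy.1)
  have hA : Tendsto (fun n => ∫ y in Ioo 0 x, (y * G n y) *
      (tail (G n) (x - y) - Real.exp (-(x - y)))) atTop (𝓝 0) := by
    have h2 : Tendsto (fun n => ∫ y in Ioo 0 x, 3 * |tail (G n) (x - y) - Real.exp (-(x - y))|)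
        atTop (𝓝 (∫ y in Ioo 0 x, (0 : ℝ))) := by
      refine tendsto_integral_of_dominated_convergence (fun _ => 6)
        (fun n => (hTm n).norm.const_mul 3) (hfin 6) (fun n => ?_) ?_
      · filter_upwards [ae_restrict_mem measurableSet_Ioo] with y hy
        rw [norm_mul, Real.norm_eq_abs, Real.norm_eq_abs, abs_abs]
        have := hT n y hy
        rw [abs_of_pos three_pos]; linarith
      · filter_upwards [ae_restrict_mem measurableSet_Ioo] with y hy
        have := (tendsto_tail_profile hW h0 h1 hε hG hm (sub_pos.2 hy.2)).abs.const_mul 3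
        simpa using this
    rw [integral_zero] at h2
    refine squeeze_zero_norm (fun n => ?_) h2
    refine norm_integral_le_of_norm_le ((hTi n).abs.const_mul 3) ?_
    filter_upwards [hb n] with y hy
    rw [norm_mul, Real.norm_eq_abs, Real.norm_eq_abs]
    exact mul_le_mul_of_nonneg_right hy (abs_nonneg _)
  have hf : Integrable ((Ioo 0 x).indicator fun y : ℝ => Real.exp (-(x - y))) posVol := by
    rw [integrable_indicator_iff measurableSet_Ioo, IntegrableOn, posVol_restrict_Ioo le_rfl]
    refine (intervalIntegrable_iff_integrableOn_Ioo_of_le hx.le).1 ?_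
    exact Continuous.intervalIntegrable (by fun_prop) _ _
  have hB := weak_tendsto_profile hW h0 h1 hε hG hm hf
  have hsum := (hA.add hB).add_const (x ^ 2 / 2 * Real.exp (-x))
  rw [add_zero, zero_add] at hsum
  refine hsum.congr fun n => ?_
  rw [← flux_one_expProfile hx, flux_one_eq (hGi n) (hGi n), flux_one_eq hei hei]
  have h2 : ∀ y, (Ioo 0 x).indicator (fun y : ℝ => Real.exp (-(x - y))) y *
      (y * G n y - y * expProfile y)
      = (Ioo 0 x).indicator (fun y => Real.exp (-(x - y)) * (y * G n y)
        - y * expProfile y * tail expProfile (x - y)) y := by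
    intro y
    by_cases hy : y ∈ Ioo 0 x
    · rw [indicator_of_mem hy, indicator_of_mem hy, tail_expProfile]; ring
    · rw [indicator_of_notMem hy, indicator_of_notMem hy, zero_mul]
  simp_rw [h2]
  have hexpb : ∀ᵐ y ∂volume.restrict (Ioo 0 x), ‖Real.exp (-(x - y))‖ ≤ 1 := by
    filter_upwards [ae_restrict_mem measurableSet_Ioo] with y hy
    rw [Real.norm_eq_abs, abs_of_pos (Real.exp_pos _)]
    exact Real.exp_le_one_iff.2 (by linarith [hy.2])
  have hi1 : Integrable (fun y => Real.exp (-(x - y)) * (y * G n y)) (volume.restrict (Ioo 0 x)) := by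
    refine Integrable.bdd_mul (c := 1) ((hfin 3).mono' (hGm n) (hb n)) (by fun_prop) hexpb
  have hi2 : Integrable (fun y => y * expProfile y * tail expProfile (x - y))
      (volume.restrict (Ioo 0 x)) := by
    refine (intervalIntegrable_iff_integrableOn_Ioo_of_le hx.le).1 ?_
    simp_rw [tail_expProfile, expProfile]
    exact Continuous.intervalIntegrable (by fun_prop) _ _
  have hi3 : Integrable (fun y => (y * G n y) * (tail (G n) (x - y) - Real.exp (-(x - y))))
      (volume.restrict (Ioo 0 x)) := (hTi n).bdd_mul (c := 3) (hGm n) (hb n)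
  rw [integral_indicator measurableSet_Ioo, posVol_restrict_Ioo le_rfl, integral_sub hi1 hi2,
    add_assoc, sub_add_cancel, ← integral_add hi3 hi1]
  refine integral_congr_ae (Eventually.of_forall fun y => ?_)
  simp only; ring

/-- The fixed-point equation gives G pointwise as flux over x², so convergence of the flux becomes
pointwise convergence; the W part of the flux is at most εx. -/
lemma tendsto_profile_ae (hW : ∀ n, IsPerturbation (W n)) (h0 : ∀ n, 0 ≤ ε n)
    (h1 : ∀ n, ε n ≤ 1)
    (hε : Tendsto ε atTop (𝓝 0)) (hG : ∀ n, IsProfile (kernel (W n) (ε n)) (G n))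
    (hm : ∀ n, mass (G n) = 1) :
    ∀ᵐ x ∂posVol, Tendsto (fun n => G n x) atTop (𝓝 (expProfile x)) := by
  have heq : ∀ᵐ x ∂posVol, ∀ n, G n x = gain (kernel (W n) (ε n)) (G n) (G n) x :=
    ae_all_iff.2 fun n => (hG n).eq_gain ((hW n).bddKernel_kernel (h0 n)) ((hW n).kernel_symm _)
  filter_upwards [heq, ae_pos] with x h hx
  have hGi := fun n => (hG n).memL11.integrable
  have hA : Tendsto (fun n => ε n * flux (W n) (G n) (G n) x) atTop (𝓝 0) := by
    have h2 := hε.mul_const x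
    rw [zero_mul] at h2
    refine squeeze_zero_norm (fun n => ?_) h2
    rw [norm_mul, Real.norm_eq_abs, Real.norm_eq_abs, abs_of_nonneg (h0 n)]
    refine mul_le_mul_of_nonneg_left ?_ (h0 n)
    refine (abs_flux_le (hW n).bddKernel (hGi n) (hGi n) hx).trans ?_
    have h3 := (hG n).integral_abs_le (hW n) (h0 n) (hm n)
    have h4 : 0 ≤ ∫ x, |G n x| ∂posVol := integral_nonneg fun x => abs_nonneg _
    have h5 := mul_le_one₀ h3 h4 h3
    nlinarith
  have hB := (((tendsto_flux_profile hW h0 h1 hε hG hm hx).const_mul 2).add hA).div_const (x ^ 2)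
  have h2 : (2 * (x ^ 2 / 2 * Real.exp (-x)) + 0) / x ^ 2 = expProfile x := by
    rw [expProfile]; field_simp; ring
  rw [h2] at hB
  refine hB.congr fun n => ?_
  rw [h n, gain, flux_kernel (hW n) _ (hGi n) (hGi n)]

/-- Profiles of mass `1` converge to the profile of the constant kernel. -/
theorem tendsto_nX_profile (hW : ∀ n, IsPerturbation (W n)) (h0 : ∀ n, 0 ≤ ε n)
    (h1 : ∀ n, ε n ≤ 1)
    (hε : Tendsto ε atTop (𝓝 0)) (hG : ∀ n, IsProfile (kernel (W n) (ε n)) (G n))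
    (hm : ∀ n, mass (G n) = 1) :
    Tendsto (fun n => nX (fun x => G n x - expProfile x)) atTop (𝓝 0) := by
  have hX := fun n => (hG n).memX (hW n) (h0 n) (hm n)
  -- Scheffé: |d| = d + 2d⁻ for d = G - e^{-x}. The negative part is dominated by e^{-x}, and the
  -- weighted integral of d is at most (1 - 1) + (2 + ε - 2) = ε.
  set P : ℕ → ℝ → ℝ := fun n x => max (expProfile x - G n x) 0 * (1 + x ^ 2) with hP
  have hdi : ∀ n, Integrable (fun x => (G n x - expProfile x) * (1 + x ^ 2)) posVol := fun n =>
    (hX n).sub memX_expProfile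
  have hPm : ∀ n, AEStronglyMeasurable (P n) posVol := fun n =>
    AEStronglyMeasurable.mul (((memX_expProfile.aesm.sub (hX n).aesm).aemeasurable.max
      aemeasurable_const).aestronglyMeasurable) (by fun_prop)
  have hPle : ∀ n, ∀ᵐ x ∂posVol, ‖P n x‖ ≤ expProfile x * (1 + x ^ 2) := by
    intro n
    filter_upwards [(hG n).nonneg] with x hx
    rw [hP, Real.norm_eq_abs, abs_of_nonneg (by positivity)]
    refine mul_le_mul_of_nonneg_right (max_le (by linarith) (expProfile_pos x).le) (by positivity)
  have hPi : ∀ n, Integrable (P n) posVol := fun n =>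
    Integrable.mono' memX_expProfile (hPm n) (hPle n)
  have hPlim : Tendsto (fun n => ∫ x, P n x ∂posVol) atTop (𝓝 0) := by
    have h2 : Tendsto (fun n => ∫ x, P n x ∂posVol) atTop (𝓝 (∫ x : ℝ, (0 : ℝ) ∂posVol)) := by
      refine tendsto_integral_of_dominated_convergence _ hPm memX_expProfile hPle ?_
      filter_upwards [tendsto_profile_ae hW h0 h1 hε hG hm] with x hx
      have h3 := ((hx.const_sub (expProfile x)).max (tendsto_const_nhds (x := (0 : ℝ)))).mul_const
        (1 + x ^ 2)
      simpa using h3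
    simpa using h2
  have hid : ∀ n, nX (fun x => G n x - expProfile x) ≤ ε n + 2 * ∫ x, P n x ∂posVol := by
    intro n
    have h2 : nX (fun x => G n x - expProfile x)
        = (∫ x, (G n x - expProfile x) * (1 + x ^ 2) ∂posVol) + 2 * ∫ x, P n x ∂posVol := by
      rw [nX, ← integral_const_mul, ← integral_add (hdi n) ((hPi n).const_mul 2)]
      refine integral_congr_ae (Eventually.of_forall fun x => ?_)
      simp only [hP]
      rcases le_total 0 (G n x - expProfile x) with h | h
      · rw [abs_of_nonneg h, max_eq_right (by linarith)]; ring
      · rw [abs_of_nonpos h, max_eq_left (by linarith)]; ring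
    have h3 : ∫ x, (G n x - expProfile x) * (1 + x ^ 2) ∂posVol ≤ ε n := by
      have h4 : ∀ x, (G n x - expProfile x) * (1 + x ^ 2)
          = (G n x + x ^ 2 * G n x) - (x ^ 0 * expProfile x + x ^ 2 * expProfile x) := by
        intro x; ring
      have h5 := (hG n).integral_sq_le (hW n) (h0 n) (hm n)
      simp_rw [h4]
      have h7 : Integrable (fun x => G n x + x ^ 2 * G n x) posVol := (hX n).integrable.add h5.1
      have h8 : Integrable (fun x => x ^ 0 * expProfile x + x ^ 2 * expProfile x) posVol :=
        (integrable_pow_expProfile 0).add (integrable_pow_expProfile 2)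
      rw [integral_sub h7 h8,
        integral_add (hX n).integrable h5.1,
        integral_add (integrable_pow_expProfile 0) (integrable_pow_expProfile 2),
        integral_pow_expProfile, integral_pow_expProfile]
      have h6 := ((hG n).integral_bounds (hW n) (h0 n) (hm n)).2
      norm_num [Nat.factorial]
      linarith [h5.2]
    linarith
  refine squeeze_zero (fun n => nX_nonneg _) hid ?_
  simpa using hε.add (hPlim.const_mul 2)

end closeness

/-- Profiles of mass `1` for small `ε` are close to the profile of the constant kernel, uniformly
in the perturbation. -/
theorem exists_forall_profile_close {δ : ℝ} (hδ : 0 < δ) :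
    ∃ ε₀ : ℝ, 0 < ε₀ ∧ ε₀ ≤ 1 ∧ ∀ W : ℝ → ℝ → ℝ, IsPerturbation W → ∀ ε : ℝ, 0 ≤ ε → ε ≤ ε₀ →
      ∀ G : ℝ → ℝ, IsProfile (kernel W ε) G → mass G = 1 →
        nX (fun x => G x - expProfile x) ≤ δ := by
  by_contra! hcon
  have hpos : ∀ n : ℕ, (0 : ℝ) < 1 / ((n : ℝ) + 1) := fun n => by positivity
  have hle1 : ∀ n : ℕ, 1 / ((n : ℝ) + 1) ≤ 1 := fun n => by
    rw [div_le_one (by positivity)]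
    have : (0 : ℝ) ≤ n := n.cast_nonneg
    linarith
  -- The perturbation varies along the contradicting sequence; this is what makes ε₀ independent of
  -- W.
  choose W hW ε h0 hε G hG hm hδG using fun n : ℕ => hcon (1 / ((n : ℝ) + 1)) (hpos n) (hle1 n)
  have hε0 : Tendsto ε atTop (𝓝 0) :=
    squeeze_zero h0 hε tendsto_one_div_add_atTop_nhds_zero_nat
  have h := tendsto_nX_profile hW h0 (fun n => (hε n).trans (hle1 n)) hε0 hG hm
  obtain ⟨n, hn⟩ := (h.eventually (gt_mem_nhds hδ)).exists
  exact absurd hn (not_lt.2 (hδG n).le)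

/-! ### Injectivity of the linearization -/

lemma bern_expProfile {p : ℝ} (hp : 0 < p) : bern expProfile p = p / (1 + p) := by
  have h1 := integral_pow_exp 0 (p := 1 + p) (by positivity)
  have h2 := integral_pow_expProfile 0
  simp only [pow_zero, one_mul, Nat.factorial_zero, Nat.cast_one, zero_add, pow_one] at h1 h2
  have h3 : ∫ x, Real.exp (-(p * x)) * expProfile x ∂posVol = 1 / (1 + p) := by
    rw [← h1]
    refine integral_congr_ae (Eventually.of_forall fun x => ?_)
    simp only [expProfile]
    rw [← Real.exp_add]; ring_nf
  have h4 : ∀ x, (1 - Real.exp (-(p * x))) * expProfile x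
      = expProfile x - Real.exp (-(p * x)) * expProfile x := fun x => by ring
  simp_rw [bern, h4]
  rw [integral_sub memX_expProfile.integrable (integrable_exp_mul memX_expProfile.integrable hp.le),
    h2, h3]
  field_simp
  ring

lemma abs_bernKer_le {p x : ℝ} (hp : 0 ≤ p) (hx : 0 < x) :
    |bernKer p x| ≤ (p + 1) * (1 + x ^ 2) := by
  have h := exp_neg_mul_mem hp hx.le
  rw [abs_le, bernKer]
  have h1 : 0 ≤ p * x * Real.exp (-(p * x)) := by positivity
  have h2 : p * x * Real.exp (-(p * x)) ≤ p * x := mul_le_of_le_one_right (by positivity) h.2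
  constructor <;> nlinarith [mul_nonneg hp (sq_nonneg (x - 1)), sq_nonneg x, mul_nonneg hp (sq_nonneg x)]

lemma MemX.integrable_bernKer {a : ℝ → ℝ} (ha : MemX a) {p : ℝ} (hp : 0 ≤ p) :
    Integrable (fun x => bernKer p x * a x) posVol :=
  ha.integrable_mul (by unfold bernKer; fun_prop) fun _ hx => abs_bernKer_le hp hx

/-- The linearization of the profile equation at the exponential profile is injective on functions
of vanishing mass. -/
theorem eq_zero_of_linearized {h : ℝ → ℝ} (hh : MemX h) (hm : ∫ x, x * h x ∂posVol = 0)
    (heq : h =ᵐ[posVol] fun x => 2 * gain (fun _ _ => 1) expProfile h x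
      + 2 * gain (fun _ _ => 1) h expProfile x) : h =ᵐ[posVol] 0 := by
  have he := memX_expProfile
  have hg1 := (gain_memX bddKernel_one he hh).1
  have hg2 := (gain_memX bddKernel_one hh he).1
  have ode : ∀ p, 0 < p → p * bernDeriv h p - bern h p = -(2 * (p / (1 + p)) * bern h p) := by
    intro p hp
    have h1 := laplace_gain bddKernel_one (fun _ _ _ _ => rfl) he.integrable hh.integrable hp.le
    rw [integral_bern_mul_bern, bern_expProfile hp] at h1
    rw [← integral_bernKer_mul hh.memL11 hp.le]
    have h2 : ∫ x, bernKer p x * h x ∂posVol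
        = ∫ x, (2 * (bernKer p x * gain (fun _ _ => 1) expProfile h x)
          + 2 * (bernKer p x * gain (fun _ _ => 1) h expProfile x)) ∂posVol := by
      refine integral_congr_ae ?_
      filter_upwards [heq] with x hx
      rw [hx]; ring
    rw [h2, integral_add ((hg1.integrable_bernKer hp.le).const_mul 2)
      ((hg2.integrable_bernKer hp.le).const_mul 2), integral_const_mul, integral_const_mul]
    linarith
  -- The first-order linear equation has this first integral; its value at p = 0 is the mass of h,
  -- which is zero.
  have hd : ∀ p, 0 < p → HasDerivAt (fun p => bern h p / p * (1 + p) ^ 2) 0 p := by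
    intro p hp
    have h1 := ((hasDerivAt_bern hh.memL11 hp).div (hasDerivAt_id p) hp.ne').mul
      (((hasDerivAt_id p).const_add 1).pow 2)
    refine h1.congr_deriv ?_
    have h2 := ode p hp
    have h3 : bernDeriv h p = (bern h p -(2 * (p / (1 + p)) * bern h p)) / p := by
      rw [eq_div_iff hp.ne']; linarith
    simp only [id, h3, Pi.pow_apply, Pi.div_apply]
    field_simp
    ring
  have hc : ∀ p, 0 < p → bern h p = 0 := by
    intro p hp
    have h1 : Tendsto (fun q => bern h q / q * (1 + q) ^ 2) (𝓝[>] 0) (𝓝 (0 * (1 + 0) ^ 2)) := by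
      refine Tendsto.mul ?_ ?_
      · have h2 := tendsto_bern_div hh.memL11
        rwa [hm] at h2
      · exact ((by fun_prop : Continuous fun q : ℝ => (1 + q) ^ 2).tendsto 0).mono_left
          nhdsWithin_le_nhds
    have h2 : ∀ q ∈ Ioi (0 : ℝ), bern h q / q * (1 + q) ^ 2 = bern h p / p * (1 + p) ^ 2 :=
      fun q hq => isOpen_Ioi.is_const_of_deriv_eq_zero isPreconnected_Ioi
        (fun t ht => (hd t ht).differentiableAt.differentiableWithinAt)
        (fun t ht => (hd t ht).deriv) hq hp
    have h3 : Tendsto (fun q => bern h q / q * (1 + q) ^ 2) (𝓝[>] 0)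
        (𝓝 (bern h p / p * (1 + p) ^ 2)) :=
      tendsto_const_nhds.congr' (by filter_upwards [self_mem_nhdsWithin] with q hq using (h2 q hq).symm)
    have h4 := tendsto_nhds_unique h3 h1
    have h5 : (1 + p) ^ 2 ≠ 0 := by positivity
    simpa [h5, hp.ne'] using h4
  have hb : ∀ p, 0 < p → ∫ x, Real.exp (-(p * x)) * (x * h x) ∂posVol = 0 := by
    intro p hp
    have h1 := ode p hp
    rw [hc p hp] at h1
    have h2 : p * bernDeriv h p = 0 := by linarith
    exact (mul_eq_zero.1 h2).resolve_left hp.ne'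
  -- The equation itself makes xh bounded, and the derivative of the Bernstein transform is the
  -- Laplace transform of xh.
  have hx := ae_eq_zero_of_laplace (C := 4 * ((∫ y, |expProfile y| ∂posVol) * ∫ z, |h z| ∂posVol))
    hh.integrable_id.1 (by
      filter_upwards [heq, ae_pos] with x hx hx0
      have h1 := abs_flux_le bddKernel_one he.integrable hh.integrable hx0
      have h2 := abs_flux_le bddKernel_one hh.integrable he.integrable hx0
      have h3 : x * h x = (2 * flux (fun _ _ => 1) expProfile h x
          + 2 * flux (fun _ _ => 1) h expProfile x) / x := by
        rw [hx, gain, gain]; field_simp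
      rw [h3, abs_div, abs_of_pos hx0, div_le_iff₀ hx0]
      refine (abs_add_le _ _).trans ?_
      rw [abs_mul, abs_mul, abs_of_pos (two_pos : (0 : ℝ) < 2)]
      linarith) hb
  filter_upwards [hx, ae_pos] with x h1 h2
  exact (mul_eq_zero.1 h1).resolve_left h2.ne'

/-! ### Tools for the explicit solution: a Schur test and integration by parts -/

/-- Schur test for an integral operator on the half-line. -/
theorem schur_test {κ : ℝ × ℝ → ℝ} (hκ : Measurable κ) {f w : ℝ → ℝ}
    (hf : AEStronglyMeasurable f posVol)
    (hκi : ∀ y, 0 < y → Integrable (fun x => κ (x, y)) posVol)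
    (hκw : ∀ y, 0 < y → ∫ x, |κ (x, y)| ∂posVol ≤ w y)
    (hfw : Integrable (fun y => |f y| * w y) posVol) :
    Integrable (fun x => ∫ y, κ (x, y) * f y ∂posVol) posVol ∧
      ∫ x, |∫ y, κ (x, y) * f y ∂posVol| ∂posVol ≤ ∫ y, |f y| * w y ∂posVol := by
  have hFm : AEStronglyMeasurable (fun q : ℝ × ℝ => κ q * f q.2) quadVol :=
    hκ.aestronglyMeasurable.mul hf.comp_snd
  have hn : ∀ y, ∫ x, ‖κ (x, y) * f y‖ ∂posVol = (∫ x, |κ (x, y)| ∂posVol) * |f y| := by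
    intro y
    simp_rw [norm_mul, Real.norm_eq_abs]
    rw [integral_mul_const]
  have hm : AEStronglyMeasurable (fun y => (∫ x, |κ (x, y)| ∂posVol) * |f y|) posVol := by
    refine AEStronglyMeasurable.mul ?_ hf.norm
    have h1 : Measurable fun p : ℝ × ℝ => |κ (p.2, p.1)| :=
      (hκ.comp measurable_swap).norm
    exact h1.stronglyMeasurable.integral_prod_right.aestronglyMeasurable
  have hle : ∀ᵐ y ∂posVol, (∫ x, |κ (x, y)| ∂posVol) * |f y| ≤ |f y| * w y := by
    filter_upwards [ae_pos] with y hy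
    rw [mul_comm]
    exact mul_le_mul_of_nonneg_left (hκw y hy) (abs_nonneg _)
  have hi2 : Integrable (fun y => (∫ x, |κ (x, y)| ∂posVol) * |f y|) posVol := by
    refine hfw.mono' hm ?_
    filter_upwards [hle] with y hy
    rw [Real.norm_eq_abs, abs_of_nonneg]
    · exact hy
    · exact mul_nonneg (integral_nonneg fun x => abs_nonneg _) (abs_nonneg _)
  have hF : Integrable (fun q : ℝ × ℝ => κ q * f q.2) quadVol := by
    rw [integrable_prod_iff' hFm]
    refine ⟨?_, ?_⟩
    · filter_upwards [ae_pos] with y hy using (hκi y hy).mul_const _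
    · simpa only [hn] using hi2
  refine ⟨hF.integral_prod_left, ?_⟩
  calc _ ≤ ∫ x, ∫ y, ‖κ (x, y) * f y‖ ∂posVol ∂posVol :=
        integral_mono hF.integral_prod_left.abs hF.norm.integral_prod_left fun x =>
          norm_integral_le_integral_norm (fun y => κ (x, y) * f y)
    _ = ∫ y, ∫ x, ‖κ (x, y) * f y‖ ∂posVol ∂posVol :=
        integral_integral_swap (f := fun x y => ‖κ (x, y) * f y‖) hF.norm
    _ ≤ _ := by
        simp_rw [hn]
        exact integral_mono_ae hi2 hfw hle

lemma intervalIntegrable_of_posVol {r : ℝ → ℝ} (hr : Integrable r posVol) {a b : ℝ} (ha : 0 ≤ a)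
    (hb : 0 ≤ b) : IntervalIntegrable r volume a b :=
  intervalIntegrable_iff.2 (IntegrableOn.mono_set hr fun _ hx => (le_min ha hb).trans_lt hx.1)

lemma tail_eq_sub {r : ℝ → ℝ} (hr : Integrable r posVol) {a x : ℝ} (ha : 0 ≤ a) (hx : 0 ≤ x) :
    tail r x = tail r a - ∫ y in a..x, r y := by
  have h := intervalIntegral.integral_Ioi_sub_Ioi' (f := r) (μ := volume) (a := a) (b := x)
    (IntegrableOn.mono_set hr (Ioi_subset_Ioi ha)) (IntegrableOn.mono_set hr (Ioi_subset_Ioi hx))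
  rw [tail, tail]; linarith

/-- Integration by parts against a tail integral. -/
theorem tail_by_parts {r φ φ' : ℝ → ℝ} (hr : Integrable r posVol) {a b : ℝ} (ha : 0 ≤ a)
    (hab : a ≤ b) (hφ : ContDiffOn ℝ 1 φ (Icc a b)) (hd : ∀ x ∈ Icc a b, HasDerivAt φ (φ' x) x)
    (hφ' : ContinuousOn φ' (Icc a b)) :
    ∫ y in a..b, φ y * r y = φ a * tail r a - φ b * tail r b + ∫ y in a..b, φ' y * tail r y := by
  have hb : 0 ≤ b := ha.trans hab
  have hu : uIcc a b = Icc a b := uIcc_of_le hab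
  have hri := intervalIntegrable_of_posVol hr ha hb
  have h1 := (hu ▸ hφ : ContDiffOn ℝ 1 φ (uIcc a b)).absolutelyContinuousOnInterval
  -- Since r is merely integrable, its primitive is absolutely continuous rather than C¹.
  have h2 := hri.absolutelyContinuousOnInterval_intervalIntegral (c := a) left_mem_uIcc
  have h3 := h1.integral_mul_deriv_eq_deriv_mul h2
  have hφi : IntervalIntegrable φ' volume a b := (hu ▸ hφ').intervalIntegrable
  have hTc : ContinuousOn (tail r) (uIcc a b) :=
    (continuousOn_tail hr).mono fun x hx => by rw [hu] at hx; exact ha.trans hx.1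
  have h4 : ∫ y in a..b, φ y * r y = ∫ y in a..b, φ y * deriv (fun x => ∫ v in a..x, r v) y := by
    refine intervalIntegral.integral_congr_ae ?_
    filter_upwards [hri.ae_hasDerivAt_integral] with y hy hy2
    rw [(hy (uIoc_subset_uIcc hy2) a left_mem_uIcc).deriv]
  have h5 : ∫ y in a..b, deriv φ y * ∫ v in a..y, r v
      = ∫ y in a..b, (φ' y * tail r a - φ' y * tail r y) := by
    refine intervalIntegral.integral_congr fun y hy => ?_
    rw [hu] at hy
    rw [(hd y hy).deriv, tail_eq_sub hr ha (ha.trans hy.1)]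
    ring
  have h6 : ∫ y in a..b, φ' y = φ b - φ a :=
    intervalIntegral.integral_eq_sub_of_hasDerivAt (fun x hx => hd x (hu ▸ hx)) hφi
  have h7 : IntervalIntegrable (fun y => φ' y * tail r y) volume a b :=
    ((hu ▸ hφ' : ContinuousOn φ' (uIcc a b)).mul hTc).intervalIntegrable
  rw [h4, h3, h5, intervalIntegral.integral_sub (hφi.mul_const _) h7,
    intervalIntegral.integral_mul_const, h6, intervalIntegral.integral_same,
    tail_eq_sub hr ha hb]
  ring

/-! ### The potential of the linearized problem and its bound in the weighted space -/

/-- The amplitude solving `(d/dx) Z = e^x tail r x / x²`. -/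
noncomputable def amp (r : ℝ → ℝ) (c x : ℝ) : ℝ :=
  c + ∫ y in (1 : ℝ)..x, Real.exp y * tail r y / y ^ 2

/-- The potential of the linearized problem, a solution of `x V' = tail r + (1 - x) V`. -/
noncomputable def pot (r : ℝ → ℝ) (c x : ℝ) : ℝ := x * Real.exp (-x) * amp r c x

/-- The derivative of the potential. -/
noncomputable def potDeriv (r : ℝ → ℝ) (c x : ℝ) : ℝ :=
  tail r x / x + (1 - x) * Real.exp (-x) * amp r c x

section pot
variable {r : ℝ → ℝ} (hr : MemX r) (c : ℝ)
include hr

lemma continuousOn_amp_integrand :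
    ContinuousOn (fun y => Real.exp y * tail r y / y ^ 2) (Ioi 0) := by
  refine ContinuousOn.div ?_ (by fun_prop) fun x hx => pow_ne_zero _ (ne_of_gt hx)
  exact (by fun_prop : ContinuousOn Real.exp (Ioi 0)).mul
    ((continuousOn_tail hr.integrable).mono Ioi_subset_Ici_self)

lemma intervalIntegrable_amp_integrand {a b : ℝ} (ha : 0 < a) (hb : 0 < b) :
    IntervalIntegrable (fun y => Real.exp y * tail r y / y ^ 2) volume a b :=
  ((continuousOn_amp_integrand hr).mono fun _ hx => (lt_min ha hb).trans_le hx.1).intervalIntegrable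

lemma hasDerivAt_amp {x : ℝ} (hx : 0 < x) :
    HasDerivAt (amp r c) (Real.exp x * tail r x / x ^ 2) x := by
  have hc := continuousOn_amp_integrand hr
  exact (intervalIntegral.integral_hasDerivAt_right (intervalIntegrable_amp_integrand hr one_pos hx)
    (hc.stronglyMeasurableAtFilter isOpen_Ioi x hx) (hc.continuousAt (Ioi_mem_nhds hx))).const_add c

lemma continuousOn_amp : ContinuousOn (amp r c) (Ioi 0) := fun _ hx =>
  (hasDerivAt_amp hr c hx).continuousAt.continuousWithinAt

lemma hasDerivAt_pot {x : ℝ} (hx : 0 < x) : HasDerivAt (pot r c) (potDeriv r c x) x := by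
  have h1 := ((hasDerivAt_id x).mul (hasDerivAt_neg x).exp).mul (hasDerivAt_amp hr c hx)
  refine h1.congr_deriv ?_
  have h2 : Real.exp (-x) * Real.exp x = 1 := by rw [← Real.exp_add]; simp
  simp only [potDeriv, id, Pi.mul_apply]
  field_simp
  linear_combination (tail r x) * h2

lemma continuousOn_pot : ContinuousOn (pot r c) (Ioi 0) := fun _ hx =>
  (hasDerivAt_pot hr c hx).continuousAt.continuousWithinAt

lemma continuousOn_potDeriv : ContinuousOn (potDeriv r c) (Ioi 0) := by
  refine ContinuousOn.add (ContinuousOn.div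
    ((continuousOn_tail hr.integrable).mono Ioi_subset_Ici_self) continuousOn_id
    fun x hx => ne_of_gt hx) ?_
  exact (by fun_prop : ContinuousOn (fun x : ℝ => (1 - x) * Real.exp (-x)) (Ioi 0)).mul
    (continuousOn_amp hr c)

lemma abs_tail_le_nX {x : ℝ} (hx : 0 ≤ x) : |tail r x| ≤ nX r :=
  (abs_tail_le hr.integrable hx).trans hr.integral_abs_le

/-- On (0, 1] the integrand is at most 3 · `nX r` / y², because e < 3, so the amplitude grows no
faster than 1/x at the origin. -/
lemma mul_abs_amp_le {x : ℝ} (hx : 0 < x) (hx1 : x ≤ 1) : x * |amp r c x| ≤ |c| + 3 * nX r := by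
  have hn := nX_nonneg r
  have h1 : |∫ y in (1 : ℝ)..x, Real.exp y * tail r y / y ^ 2|
      ≤ ∫ y in x..1, 3 * nX r * (y ^ 2)⁻¹ := by
    rw [intervalIntegral.integral_symm, abs_neg, ← Real.norm_eq_abs]
    have hci : ContinuousOn (fun y : ℝ => 3 * nX r * (y ^ 2)⁻¹) (uIcc x 1) := by
      refine continuousOn_const.mul (ContinuousOn.inv₀ (by fun_prop) fun y hy => ?_)
      rw [uIcc_of_le hx1] at hy
      exact pow_ne_zero _ (hx.trans_le hy.1).ne'
    refine intervalIntegral.norm_integral_le_of_norm_le hx1 (Eventually.of_forall fun y hy => ?_)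
      hci.intervalIntegrable
    have hy0 : 0 < y := hx.trans hy.1
    rw [Real.norm_eq_abs, abs_div, abs_mul, abs_of_pos (Real.exp_pos y), abs_of_pos (pow_pos hy0 2),
      div_eq_mul_inv]
    have h3 : Real.exp y ≤ 3 := (Real.exp_le_exp.2 hy.2).trans
      (by have := Real.exp_one_lt_d9; linarith)
    gcongr
    exact abs_tail_le_nX hr hy0.le
  have h2 : ∫ y in x..1, 3 * nX r * (y ^ 2)⁻¹ = 3 * nX r * (x⁻¹ - 1) := by
    rw [intervalIntegral.integral_const_mul]
    congr 1
    have hd : ∀ y ∈ uIcc x 1, HasDerivAt (fun y : ℝ => -y⁻¹) ((y ^ 2)⁻¹) y := by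
      intro y hy
      rw [uIcc_of_le hx1] at hy
      exact (hasDerivAt_inv (hx.trans_le hy.1).ne').neg.congr_deriv (neg_neg _)
    rw [intervalIntegral.integral_eq_sub_of_hasDerivAt hd]
    · simp; ring
    · refine ContinuousOn.intervalIntegrable (ContinuousOn.inv₀ (by fun_prop) fun y hy => ?_)
      rw [uIcc_of_le hx1] at hy
      exact pow_ne_zero _ (hx.trans_le hy.1).ne'
  have h3 : |amp r c x| ≤ |c| + 3 * nX r * (x⁻¹ - 1) := by
    rw [← h2]; exact (abs_add_le _ _).trans (by linarith)
  have h4 := mul_le_mul_of_nonneg_left h3 hx.le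
  have h5 : x * (|c| + 3 * nX r * (x⁻¹ - 1)) = x * |c| + 3 * nX r * (1 - x) := by
    field_simp
  nlinarith [abs_nonneg c, mul_nonneg hn hx.le]

lemma abs_pot_le {x : ℝ} (hx : 0 < x) (hx1 : x ≤ 1) : |pot r c x| ≤ |c| + 3 * nX r := by
  refine le_trans ?_ (mul_abs_amp_le hr c hx hx1)
  rw [pot, abs_mul, abs_mul, abs_of_pos hx, abs_of_pos (Real.exp_pos _)]
  have : Real.exp (-x) ≤ 1 := Real.exp_le_one_iff.2 (by linarith)
  nlinarith [mul_nonneg hx.le (abs_nonneg (amp r c x))]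

/-- Near the origin the singularities of the two terms of `potDeriv` cancel. -/
lemma potDeriv_eq {x : ℝ} (hx : 0 < x) (hx1 : x ≤ 1) :
    potDeriv r c x = (tail r 1 + pot r c 1) + (∫ y in x..1, (r y + pot r c y) / y) - pot r c x := by
  have hu : uIcc x 1 = Icc x 1 := uIcc_of_le hx1
  have hpos : ∀ y ∈ Icc x 1, 0 < y := fun y hy => hx.trans_le hy.1
  -- A bound C/x on either term would not be integrable at 0. Written as integrals over (x, 1), both
  -- contain the tail against 1/y², with opposite signs; what survives has the weight 1/y, harmless
  -- after integration in x.
  have h1 := tail_by_parts hr.integrable hx.le hx1 (φ := fun y => y⁻¹) (φ' := fun y => -(y ^ 2)⁻¹)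
    ((contDiffOn_inv ℝ).mono fun y hy => (hpos y hy).ne')
    (fun y hy => hasDerivAt_inv (hpos y hy).ne')
    (ContinuousOn.neg (ContinuousOn.inv₀ (by fun_prop) fun y hy => pow_ne_zero _ (hpos y hy).ne'))
  have hcp : ContinuousOn (fun y => pot r c y / y) (uIcc x 1) :=
    ((continuousOn_pot hr c).mono fun y hy => hpos y (hu ▸ hy)).div continuousOn_id
      fun y hy => (hpos y (hu ▸ hy)).ne'
  have hct : ContinuousOn (fun y => -(y ^ 2)⁻¹ * tail r y) (uIcc x 1) := by
    refine ContinuousOn.mul (ContinuousOn.neg (ContinuousOn.inv₀ (by fun_prop) fun y hy =>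
      pow_ne_zero _ (hpos y (hu ▸ hy)).ne')) ((continuousOn_tail hr.integrable).mono fun y hy =>
        (hpos y (hu ▸ hy)).le)
  have h2 : ∀ y ∈ uIcc x 1, HasDerivAt (fun y => Real.exp (-y) * amp r c y)
      (-(-(y ^ 2)⁻¹ * tail r y) - pot r c y / y) y := by
    intro y hy
    have hy0 := hpos y (hu ▸ hy)
    refine ((hasDerivAt_neg y).exp.mul (hasDerivAt_amp hr c hy0)).congr_deriv ?_
    have h3 : Real.exp (-y) * Real.exp y = 1 := by rw [← Real.exp_add]; simp
    rw [pot]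
    field_simp
    linear_combination (tail r y) * h3
  have h3 := intervalIntegral.integral_eq_sub_of_hasDerivAt h2
    (hct.neg.sub hcp).intervalIntegrable
  have hcn : IntervalIntegrable (fun y => -(-(y ^ 2)⁻¹ * tail r y)) volume x 1 :=
    hct.neg.intervalIntegrable
  rw [intervalIntegral.integral_sub hcn hcp.intervalIntegrable,
    intervalIntegral.integral_neg] at h3
  have h4 : IntervalIntegrable (fun y => y⁻¹ * r y) volume x 1 := by
    refine (intervalIntegrable_of_posVol hr.integrable hx.le zero_le_one).continuousOn_mul ?_
    exact ContinuousOn.inv₀ continuousOn_id fun y hy => (hpos y (hu ▸ hy)).ne'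
  have h5 : ∫ y in x..1, (r y + pot r c y) / y
      = (∫ y in x..1, y⁻¹ * r y) + ∫ y in x..1, pot r c y / y := by
    rw [← intervalIntegral.integral_add h4 hcp.intervalIntegrable]
    congr 1; ext y; ring
  rw [h5, h1, potDeriv, pot, pot, one_mul]
  simp only [inv_one, one_mul]
  linear_combination h3

end pot

lemma integral_indicator_Iio_posVol {y : ℝ} (g : ℝ → ℝ) :
    ∫ x, (Iio y).indicator g x ∂posVol = ∫ x in Ioo 0 y, g x := by
  rw [integral_indicator measurableSet_Iio, Measure.restrict_restrict measurableSet_Iio]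
  congr 2
  ext x; simp [and_comm]

lemma integrable_indicator_Iio_posVol {y : ℝ} {g : ℝ → ℝ} (hg : IntegrableOn g (Ioo 0 y)) :
    Integrable ((Iio y).indicator g) posVol := by
  rw [integrable_indicator_iff measurableSet_Iio, IntegrableOn,
    Measure.restrict_restrict measurableSet_Iio]
  refine IntegrableOn.mono_set hg ?_
  intro x hx; exact ⟨hx.2, hx.1⟩

/-- Exchanging integrals gives half the second moment of |r|, the reason for the weight x² in X. -/
lemma MemX.integral_id_mul_tail {r : ℝ → ℝ} (hr : MemX r) :
    Integrable (fun x => x * tail r x) posVol ∧ ∫ x, |x * tail r x| ∂posVol ≤ nX r := by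
  have hA : MeasurableSet {q : ℝ × ℝ | q.1 < q.2} := measurableSet_lt measurable_fst measurable_snd
  have hs : ∀ x y : ℝ, {q : ℝ × ℝ | q.1 < q.2}.indicator (fun q => q.1) (x, y)
      = (Iio y).indicator (fun x => x) x := fun x y => rfl
  have hv : ∀ y : ℝ, 0 < y → ∫ x in Ioo 0 y, x = y ^ 2 / 2 := by
    intro y hy
    rw [← integral_Ioc_eq_integral_Ioo, ← intervalIntegral.integral_of_le hy.le, integral_id]
    ring
  have h := schur_test (κ := {q : ℝ × ℝ | q.1 < q.2}.indicator fun q => q.1) (f := r)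
    (w := fun y => 1 + y ^ 2) (measurable_fst.indicator hA) hr.aesm (fun y hy => by
      simp only [hs]
      refine integrable_indicator_Iio_posVol ?_
      exact (continuous_id.integrableOn_Icc (a := 0) (b := y)).mono_set Ioo_subset_Icc_self)
    (fun y hy => by
      have h1 : ∀ᵐ x ∂posVol, |{q : ℝ × ℝ | q.1 < q.2}.indicator (fun q => q.1) (x, y)|
          = (Iio y).indicator (fun x => x) x := by
        filter_upwards [ae_pos] with x hx
        rw [hs, abs_of_nonneg (indicator_apply_nonneg (fun _ => hx.le))]
      rw [integral_congr_ae h1, integral_indicator_Iio_posVol, hv y hy]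
      nlinarith [sq_nonneg y]) hr.integrable_abs
  have he : ∀ x, 0 < x → ∫ y, {q : ℝ × ℝ | q.1 < q.2}.indicator (fun q => q.1) (x, y) * r y ∂posVol
      = x * tail r x := by
    intro x hx
    have h1 : ∀ y, {q : ℝ × ℝ | q.1 < q.2}.indicator (fun q => q.1) (x, y) * r y
        = (Ioi x).indicator (fun y => x * r y) y := by
      intro y
      by_cases hy : x < y
      · rw [indicator_of_mem (show (x, y) ∈ {q : ℝ × ℝ | q.1 < q.2} from hy),
          indicator_of_mem (show y ∈ Ioi x from hy)]
      · rw [indicator_of_notMem (show (x, y) ∉ {q : ℝ × ℝ | q.1 < q.2} from hy),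
          indicator_of_notMem (show y ∉ Ioi x from hy), zero_mul]
    simp_rw [h1]
    rw [integral_indicator measurableSet_Ioi, posVol_restrict_Ioi hx.le, integral_const_mul, tail]
  have hae : (fun x => ∫ y, {q : ℝ × ℝ | q.1 < q.2}.indicator (fun q => q.1) (x, y) * r y ∂posVol)
      =ᵐ[posVol] fun x => x * tail r x := by
    filter_upwards [ae_pos] with x hx using he x hx
  refine ⟨h.1.congr hae, le_trans (le_of_eq (integral_congr_ae ?_)) h.2⟩
  filter_upwards [hae] with x hx
  rw [hx]

lemma integral_Ioi_cube_exp {y : ℝ} :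
    IntegrableOn (fun x : ℝ => x ^ 3 * Real.exp (-x)) (Ioi 0) ∧
    ∫ x in Ioi y, x ^ 3 * Real.exp (-x) = (y ^ 3 + 3 * y ^ 2 + 6 * y + 6) * Real.exp (-y) := by
  have h1 : IntegrableOn (fun x : ℝ => x ^ 3 * Real.exp (-x)) (Ioi 0) := by
    have h := integrable_pow_exp 3 one_pos
    simp only [one_mul] at h
    exact h
  refine ⟨h1, ?_⟩
  have h2 : ∀ x ∈ Ici y, HasDerivAt (fun x : ℝ => -((x ^ 3 + 3 * x ^ 2 + 6 * x + 6) * Real.exp (-x)))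
      (x ^ 3 * Real.exp (-x)) x := by
    intro x _
    have h3 := (((((hasDerivAt_pow 3 x).add ((hasDerivAt_pow 2 x).const_mul 3)).add
      ((hasDerivAt_id x).const_mul 6)).add_const (6 : ℝ)).mul (hasDerivAt_neg x).exp).neg
    refine h3.congr_deriv ?_
    simp only [Pi.add_apply, id]
    push_cast
    ring
  have h4 : Tendsto (fun x : ℝ => -((x ^ 3 + 3 * x ^ 2 + 6 * x + 6) * Real.exp (-x))) atTop
      (𝓝 (-(0 + 3 * 0 + 6 * 0 + 6 * 0))) := by
    have h5 : ∀ n : ℕ, Tendsto (fun x : ℝ => x ^ n * Real.exp (-x)) atTop (𝓝 0) :=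
      fun n => Real.tendsto_pow_mul_exp_neg_atTop_nhds_zero n
    refine Tendsto.neg ?_
    refine ((((h5 3).add ((h5 2).const_mul 3)).add ((h5 1).const_mul 6)).add
      ((h5 0).const_mul 6)).congr fun x => ?_
    ring
  have h6 : IntegrableOn (fun x : ℝ => x ^ 3 * Real.exp (-x)) (Ioi y) := by
    rcases le_total 0 y with hy | hy
    · exact h1.mono_set (Ioi_subset_Ioi hy)
    · rw [← Ioc_union_Ioi_eq_Ioi hy]
      refine IntegrableOn.union ?_ h1
      exact (Continuous.integrableOn_Icc (by fun_prop)).mono_set Ioc_subset_Icc_self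
  rw [integral_Ioi_of_hasDerivAt_of_tendsto' h2 h6 h4]
  ring

/-- The kernel `x³ e^{-x} e^y / y²` on `1 < y < x`. -/
noncomputable def farKer : ℝ × ℝ → ℝ :=
  {q : ℝ × ℝ | 1 < q.2 ∧ q.2 < q.1}.indicator
    fun q => q.1 ^ 3 * Real.exp (-q.1) * (Real.exp q.2 / q.2 ^ 2)

/-- The kernel `1 / y` on `x < y < 1`. -/
noncomputable def nearKer : ℝ × ℝ → ℝ :=
  {q : ℝ × ℝ | q.1 < q.2 ∧ q.2 < 1}.indicator fun q => q.2⁻¹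

lemma nearKer_nonneg {q : ℝ × ℝ} (hq : 0 < q.2) : 0 ≤ nearKer q :=
  indicator_apply_nonneg fun _ => (inv_pos.2 hq).le

lemma farKer_nonneg {q : ℝ × ℝ} (hq : 0 < q.1) : 0 ≤ farKer q :=
  indicator_apply_nonneg fun _ => by positivity

lemma farKer_apply {x y : ℝ} : farKer (x, y) = (if 1 < y then 1 else 0) * (Real.exp y / y ^ 2) *
    (Ioi y).indicator (fun x => x ^ 3 * Real.exp (-x)) x := by
  unfold farKer
  by_cases h1 : 1 < y <;> by_cases h2 : y < x
  · rw [indicator_of_mem (show (x, y) ∈ {q : ℝ × ℝ | 1 < q.2 ∧ q.2 < q.1} from ⟨h1, h2⟩),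
      indicator_of_mem (show x ∈ Ioi y from h2), if_pos h1]
    ring
  · rw [indicator_of_notMem (fun h => h2 h.2), indicator_of_notMem (show x ∉ Ioi y from h2),
      mul_zero]
  all_goals rw [indicator_of_notMem (fun h => h1 h.1), if_neg h1, zero_mul, zero_mul]

/-- For y > 1 the column integral is (y³ + 3y² + 6y + 6)/y² ≤ 16y, with 16 = 1 + 3 + 6 + 6. -/
lemma farKer_schur {f : ℝ → ℝ} (hf : Integrable (fun y => y * f y) posVol)
    (hfm : AEStronglyMeasurable f posVol) :
    Integrable (fun x => ∫ y, farKer (x, y) * f y ∂posVol) posVol ∧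
      ∫ x, |∫ y, farKer (x, y) * f y ∂posVol| ∂posVol ≤ 16 * ∫ y, |y * f y| ∂posVol := by
  have hm : Measurable farKer := by
    refine Measurable.indicator (by fun_prop) ?_
    exact (measurableSet_lt measurable_const measurable_snd).inter
      (measurableSet_lt measurable_snd measurable_fst)
  have hfa : ∀ᵐ y ∂posVol, |y * f y| * 16 = |f y| * (16 * y) := by
    filter_upwards [ae_pos] with y hy
    rw [abs_mul, abs_of_pos hy]; ring
  have h := schur_test (w := fun y => 16 * y) hm hfm (fun y hy => by
      simp only [farKer_apply]
      refine Integrable.const_mul ?_ _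
      rw [integrable_indicator_iff measurableSet_Ioi, IntegrableOn, posVol_restrict_Ioi hy.le]
      exact integral_Ioi_cube_exp (y := 0).1.mono_set (Ioi_subset_Ioi hy.le))
    (fun y hy => by
      have h1 : ∀ᵐ x ∂posVol, |farKer (x, y)| = farKer (x, y) := by
        filter_upwards [ae_pos] with x hx using abs_of_nonneg (farKer_nonneg hx)
      rw [integral_congr_ae h1]
      simp only [farKer_apply]
      rw [integral_const_mul, integral_indicator measurableSet_Ioi, posVol_restrict_Ioi hy.le,
        integral_Ioi_cube_exp.2]
      by_cases h1 : 1 < y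
      · have h2 : Real.exp y * Real.exp (-y) = 1 := by rw [← Real.exp_add]; simp
        have h3 : (if 1 < y then (1 : ℝ) else 0) * (Real.exp y / y ^ 2)
            * ((y ^ 3 + 3 * y ^ 2 + 6 * y + 6) * Real.exp (-y))
            = (y ^ 3 + 3 * y ^ 2 + 6 * y + 6) / y ^ 2 := by
          rw [if_pos h1]
          linear_combination ((y ^ 3 + 3 * y ^ 2 + 6 * y + 6) / y ^ 2) * h2
        rw [h3, div_le_iff₀ (by positivity)]
        have h4 : 1 ≤ y ^ 2 := by nlinarith
        have h5 : y ≤ y ^ 3 := by nlinarith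
        nlinarith
      · rw [if_neg h1, zero_mul, zero_mul]; positivity)
    ((hf.abs.mul_const 16).congr hfa)
  refine ⟨h.1, h.2.trans (le_of_eq ?_)⟩
  rw [← integral_const_mul]
  refine integral_congr_ae ?_
  filter_upwards [hfa] with y hy
  rw [← hy]; ring

lemma nearKer_apply {x y : ℝ} : nearKer (x, y) = (if y < 1 then 1 else 0) *
    (Iio y).indicator (fun _ => y⁻¹) x := by
  unfold nearKer
  by_cases h1 : y < 1 <;> by_cases h2 : x < y
  · rw [indicator_of_mem (show (x, y) ∈ {q : ℝ × ℝ | q.1 < q.2 ∧ q.2 < 1} from ⟨h2, h1⟩),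
      indicator_of_mem (show x ∈ Iio y from h2), if_pos h1]
    ring
  · rw [indicator_of_notMem (fun h => h2 h.1), indicator_of_notMem (show x ∉ Iio y from h2),
      mul_zero]
  all_goals rw [indicator_of_notMem (fun h => h1 h.2), if_neg h1, zero_mul]

/-- The columns are 1/y on (0, y), of total mass one: the logarithmic singularity disappears in L¹.
-/
lemma nearKer_schur {f : ℝ → ℝ} (hf : Integrable f posVol) :
    Integrable (fun x => ∫ y, nearKer (x, y) * f y ∂posVol) posVol ∧
      ∫ x, |∫ y, nearKer (x, y) * f y ∂posVol| ∂posVol ≤ ∫ y, |f y| ∂posVol := by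
  have hm : Measurable nearKer := by
    refine Measurable.indicator (by fun_prop) ?_
    exact (measurableSet_lt measurable_fst measurable_snd).inter
      (measurableSet_lt measurable_snd measurable_const)
  have h := schur_test (w := fun _ => 1) hm hf.1 (fun y hy => by
      simp only [nearKer_apply]
      exact Integrable.const_mul (integrable_indicator_Iio_posVol (integrableOn_const (by simp))) _)
    (fun y hy => by
      have h1 : ∀ x, |nearKer (x, y)| = nearKer (x, y) := fun x => abs_of_nonneg (nearKer_nonneg hy)
      simp only [h1]
      simp only [nearKer_apply]
      rw [integral_const_mul, integral_indicator_Iio_posVol]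
      simp only [integral_const, MeasurableSet.univ, measureReal_restrict_apply, univ_inter,
        Real.volume_real_Ioo, smul_eq_mul, sub_zero, max_eq_left hy.le, mul_inv_cancel₀ hy.ne']
      split_ifs <;> norm_num)
    (by simpa using hf.abs)
  simpa using h

lemma integral_nearKer_mul (f : ℝ → ℝ) {x : ℝ} (hx : 0 < x) :
    ∫ y, nearKer (x, y) * f y ∂posVol = ∫ y in Ioo x 1, y⁻¹ * f y := by
  have h : ∀ y, nearKer (x, y) * f y = (Ioo x 1).indicator (fun y => y⁻¹ * f y) y := by
    intro y
    unfold nearKer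
    by_cases hy : x < y ∧ y < 1
    · rw [indicator_of_mem (show (x, y) ∈ {q : ℝ × ℝ | q.1 < q.2 ∧ q.2 < 1} from hy),
        indicator_of_mem (show y ∈ Ioo x 1 from hy)]
    · rw [indicator_of_notMem (show (x, y) ∉ {q : ℝ × ℝ | q.1 < q.2 ∧ q.2 < 1} from hy),
        indicator_of_notMem (show y ∉ Ioo x 1 from hy), zero_mul]
  simp_rw [h]
  rw [integral_indicator measurableSet_Ioo, posVol_restrict_Ioo hx.le]

lemma integral_farKer_mul (f : ℝ → ℝ) (x : ℝ) :
    ∫ y, farKer (x, y) * f y ∂posVol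
      = x ^ 3 * Real.exp (-x) * ∫ y in Ioo 1 x, Real.exp y / y ^ 2 * f y := by
  have h : ∀ y, farKer (x, y) * f y = (Ioo 1 x).indicator
      (fun y => x ^ 3 * Real.exp (-x) * (Real.exp y / y ^ 2 * f y)) y := by
    intro y
    unfold farKer
    by_cases hy : 1 < y ∧ y < x
    · rw [indicator_of_mem (show (x, y) ∈ {q : ℝ × ℝ | 1 < q.2 ∧ q.2 < q.1} from hy),
        indicator_of_mem (show y ∈ Ioo 1 x from hy)]
      ring
    · rw [indicator_of_notMem (show (x, y) ∉ {q : ℝ × ℝ | 1 < q.2 ∧ q.2 < q.1} from hy),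
        indicator_of_notMem (show y ∉ Ioo 1 x from hy), zero_mul]
  simp_rw [h]
  rw [integral_indicator measurableSet_Ioo, posVol_restrict_Ioo zero_le_one, integral_const_mul]

/-! ### Estimates of the potential near zero and near infinity -/

section pot
variable {r : ℝ → ℝ} (hr : MemX r) (c : ℝ)
include hr

lemma abs_potDeriv_le_near {x : ℝ} (hx : 0 < x) (hx1 : x ≤ 1) :
    |potDeriv r c x| ≤ 2 * |c| + 7 * nX r
      + ∫ y, nearKer (x, y) * (|r y| + 3 * (|c| + 3 * nX r) * expProfile y) ∂posVol := by
  have hn := nX_nonneg r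
  have h1 : |∫ y in x..1, (r y + pot r c y) / y|
      ≤ ∫ y in Ioo x 1, y⁻¹ * (|r y| + 3 * (|c| + 3 * nX r) * expProfile y) := by
    rw [← integral_Ioc_eq_integral_Ioo, ← intervalIntegral.integral_of_le hx1, ← Real.norm_eq_abs]
    refine intervalIntegral.norm_integral_le_of_norm_le hx1 (Eventually.of_forall fun y hy => ?_) ?_
    · have hy0 : 0 < y := hx.trans hy.1
      rw [Real.norm_eq_abs, abs_div, abs_of_pos hy0, div_eq_inv_mul]
      refine mul_le_mul_of_nonneg_left ?_ (inv_pos.2 hy0).le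
      refine (abs_add_le _ _).trans (add_le_add_right ?_ _)
      refine (abs_pot_le hr c hy0 hy.2).trans ?_
      -- On (0, 1] a constant is at most three times its product with e^{-y}. This makes the
      -- majorant integrable on the whole half-line, as the Schur test requires.
      have h3 : 1 / 3 ≤ expProfile y := by
        have h4 : Real.exp (-1) ≤ expProfile y := Real.exp_le_exp.2 (by linarith [hy.2])
        have h5 : Real.exp (-1) * Real.exp 1 = 1 := by rw [← Real.exp_add]; simp
        have h6 := Real.exp_one_lt_d9
        nlinarith [Real.exp_pos (-1)]
      nlinarith [mul_le_mul_of_nonneg_left h3 (by positivity : 0 ≤ |c| + 3 * nX r)]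
    · refine IntervalIntegrable.continuousOn_mul ?_ ?_
      · exact (intervalIntegrable_of_posVol hr.integrable.abs hx.le zero_le_one).add
          ((intervalIntegrable_of_posVol memX_expProfile.integrable hx.le zero_le_one).const_mul _)
      · refine ContinuousOn.inv₀ continuousOn_id fun y hy => ?_
        rw [uIcc_of_le hx1] at hy
        exact (hx.trans_le hy.1).ne'
  rw [integral_nearKer_mul _ hx, potDeriv_eq hr c hx hx1]
  have h2 := abs_tail_le_nX hr zero_le_one
  have h3 := abs_pot_le hr c one_pos le_rfl
  have h4 := abs_pot_le hr c hx hx1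
  refine (abs_sub _ _).trans ?_
  have h5 := abs_add_le (tail r 1 + pot r c 1) (∫ y in x..1, (r y + pot r c y) / y)
  have h6 := abs_add_le (tail r 1) (pot r c 1)
  linarith

omit hr in
lemma sq_mul_abs_pot_le {x : ℝ} (hx : 1 ≤ x) :
    x ^ 2 * |pot r c x| ≤ |c| * (x ^ 3 * expProfile x) + ∫ y, farKer (x, y) * |tail r y| ∂posVol := by
  have hx0 : 0 < x := one_pos.trans_le hx
  have h1 : |∫ y in (1 : ℝ)..x, Real.exp y * tail r y / y ^ 2|
      ≤ ∫ y in Ioo 1 x, Real.exp y / y ^ 2 * |tail r y| := by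
    rw [← integral_Ioc_eq_integral_Ioo, ← intervalIntegral.integral_of_le hx]
    refine (intervalIntegral.abs_integral_le_integral_abs hx).trans (le_of_eq ?_)
    refine intervalIntegral.integral_congr fun y hy => ?_
    rw [uIcc_of_le hx] at hy
    have hy0 : 0 < y := one_pos.trans_le hy.1
    rw [abs_div, abs_mul, abs_of_pos (Real.exp_pos y), abs_of_pos (pow_pos hy0 2)]
    ring
  rw [integral_farKer_mul, pot, abs_mul, abs_mul, abs_of_pos hx0, abs_of_pos (Real.exp_pos _)]
  have h2 : |amp r c x| ≤ |c| + ∫ y in Ioo 1 x, Real.exp y / y ^ 2 * |tail r y| :=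
    (abs_add_le _ _).trans (by linarith)
  have h3 := mul_le_mul_of_nonneg_left h2 (by positivity : 0 ≤ x ^ 3 * Real.exp (-x))
  rw [expProfile]
  linarith

omit hr in
lemma abs_potDeriv_le_far {x : ℝ} (hx : 1 ≤ x) :
    x ^ 2 * |potDeriv r c x| ≤ |x * tail r x| + x ^ 2 * |pot r c x| := by
  have hx0 : 0 < x := one_pos.trans_le hx
  have h1 : potDeriv r c x = tail r x / x + (1 - x) / x * pot r c x := by
    rw [potDeriv, pot]; field_simp
  have h2 : |(1 - x) / x| ≤ 1 := by
    rw [abs_div, abs_of_pos hx0, div_le_one hx0, abs_le]; constructor <;> linarith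
  have h3 : |potDeriv r c x| ≤ |tail r x / x| + |pot r c x| := by
    rw [h1]
    refine (abs_add_le _ _).trans (add_le_add_right ?_ _)
    rw [abs_mul]
    exact mul_le_of_le_one_left (abs_nonneg _) h2
  have h4 : x ^ 2 * |tail r x / x| = |x * tail r x| := by
    rw [abs_div, abs_mul, abs_of_pos hx0]; field_simp
  have h5 := mul_le_mul_of_nonneg_left h3 (sq_nonneg x)
  linarith

/-- The a priori bound for the potential. -/
theorem memX_potDeriv : MemX (potDeriv r c) ∧ nX (potDeriv r c) ≤ 96 * (nX r + |c|) := by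
  have hn := nX_nonneg r
  have hc := abs_nonneg c
  set f : ℝ → ℝ := fun y => |r y| + 3 * (|c| + 3 * nX r) * expProfile y with hf
  have hfi : Integrable f posVol :=
    hr.integrable.abs.add (memX_expProfile.integrable.const_mul _)
  have hA := nearKer_schur hfi
  have hT := hr.integral_id_mul_tail
  have hTm : AEStronglyMeasurable (tail r) posVol :=
    ((continuousOn_tail hr.integrable).mono Ioi_subset_Ici_self).aestronglyMeasurable
      measurableSet_Ioi
  have hTa : (fun y => |y * tail r y|) =ᵐ[posVol] fun y => y * |tail r y| := by
    filter_upwards [ae_pos] with y hy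
    rw [abs_mul, abs_of_pos hy]
  have hB := farKer_schur (f := fun y => |tail r y|) (hT.1.abs.congr hTa) hTm.norm
  have hB2 : ∫ y, |y * (|tail r y|)| ∂posVol ≤ nX r := by
    refine le_trans (le_of_eq (integral_congr_ae ?_)) hT.2
    exact Eventually.of_forall fun y => by simp only [abs_mul, abs_abs]
  have hf1 : ∫ y, |f y| ∂posVol ≤ nX r + 3 * (|c| + 3 * nX r) := by
    have h1 : ∀ y, |f y| = |r y| + 3 * (|c| + 3 * nX r) * (y ^ 0 * expProfile y) := by
      intro y
      have := expProfile_pos y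
      rw [abs_of_nonneg (by positivity), pow_zero, one_mul]
    simp_rw [h1]
    rw [integral_add hr.integrable.abs ((integrable_pow_expProfile 0).const_mul _),
      integral_const_mul, integral_pow_expProfile]
    have := hr.integral_abs_le
    simp only [Nat.factorial_zero, Nat.cast_one]
    linarith
  have hA0 : ∀ x, 0 ≤ ∫ y, nearKer (x, y) * f y ∂posVol := fun x => by
    refine integral_nonneg_of_ae ?_
    filter_upwards [ae_pos] with y hy
    have := expProfile_pos y
    exact mul_nonneg (nearKer_nonneg hy) (by positivity)
  have hB0 : ∀ x, 0 < x → 0 ≤ ∫ y, farKer (x, y) * |tail r y| ∂posVol := fun x hx =>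
    integral_nonneg fun y => mul_nonneg (farKer_nonneg hx) (abs_nonneg _)
  -- One majorant for both regions: the first two terms serve x ≤ 1, the others x ≥ 1, where 1 + x²
  -- ≤ 2x². Its integral has the coefficient 42 + 20 + 2 + 32 = 96 in front of `nX r`.
  set F : ℝ → ℝ := fun x => 6 * (2 * |c| + 7 * nX r) * (x ^ 0 * expProfile x)
    + 2 * (∫ y, nearKer (x, y) * f y ∂posVol) + 2 * |x * tail r x|
    + 2 * |c| * (x ^ 3 * expProfile x)
    + 2 * (∫ y, farKer (x, y) * |tail r y| ∂posVol) with hF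
  have hi1 : Integrable (fun x => 6 * (2 * |c| + 7 * nX r) * (x ^ 0 * expProfile x)) posVol :=
    (integrable_pow_expProfile 0).const_mul _
  have hi2 : Integrable (fun x => 6 * (2 * |c| + 7 * nX r) * (x ^ 0 * expProfile x)
    + 2 * (∫ y, nearKer (x, y) * f y ∂posVol)) posVol := hi1.add (hA.1.const_mul 2)
  have hi3 : Integrable (fun x => 6 * (2 * |c| + 7 * nX r) * (x ^ 0 * expProfile x)
    + 2 * (∫ y, nearKer (x, y) * f y ∂posVol) + 2 * |x * tail r x|) posVol :=
    hi2.add (hT.1.abs.const_mul 2)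
  have hi4 : Integrable (fun x => 6 * (2 * |c| + 7 * nX r) * (x ^ 0 * expProfile x)
    + 2 * (∫ y, nearKer (x, y) * f y ∂posVol) + 2 * |x * tail r x|
    + 2 * |c| * (x ^ 3 * expProfile x)) posVol :=
    hi3.add ((integrable_pow_expProfile 3).const_mul _)
  have hi5 : Integrable F posVol := hi4.add (hB.1.const_mul 2)
  have hFint : ∫ x, F x ∂posVol ≤ 96 * (nX r + |c|) := by
    rw [hF, integral_add hi4 (hB.1.const_mul 2),
      integral_add hi3 ((integrable_pow_expProfile 3).const_mul _),
      integral_add hi2 (hT.1.abs.const_mul 2), integral_add hi1 (hA.1.const_mul 2),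
      integral_const_mul, integral_const_mul, integral_const_mul, integral_const_mul,
      integral_const_mul, integral_pow_expProfile, integral_pow_expProfile]
    have h1 := (le_abs_self _).trans (abs_integral_le_integral_abs.trans hA.2)
    have h2 := (le_abs_self _).trans (abs_integral_le_integral_abs.trans hB.2)
    have h3 := hT.2
    have h4 : ((Nat.factorial 3 : ℕ) : ℝ) = 6 := by norm_num [Nat.factorial]
    rw [h4, Nat.factorial_zero, Nat.cast_one]
    linarith
  have hle : ∀ x, 0 < x → |potDeriv r c x| * (1 + x ^ 2) ≤ F x := by
    intro x hx
    have hB0x := hB0 x hx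
    have hA0x := hA0 x
    have he := expProfile_pos x
    rcases le_total x 1 with hx1 | hx1
    · have h1 := abs_potDeriv_le_near hr c hx hx1
      have h2 : |potDeriv r c x| * (1 + x ^ 2) ≤ 2 * |potDeriv r c x| := by
        nlinarith [abs_nonneg (potDeriv r c x), mul_nonneg (abs_nonneg (potDeriv r c x)) hx.le]
      have h3 : 1 ≤ 3 * expProfile x := by
        have h4 : Real.exp (-1) ≤ expProfile x := Real.exp_le_exp.2 (by linarith)
        have h5 : Real.exp (-1) * Real.exp 1 = 1 := by rw [← Real.exp_add]; simp
        have h6 := Real.exp_one_lt_d9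
        nlinarith [Real.exp_pos (-1)]
      have h4 : 2 * (2 * |c| + 7 * nX r) ≤ 6 * (2 * |c| + 7 * nX r) * (x ^ 0 * expProfile x) := by
        rw [pow_zero, one_mul]
        nlinarith [mul_le_mul_of_nonneg_left h3 (by positivity : 0 ≤ 2 * (2 * |c| + 7 * nX r))]
      have h5 : 0 ≤ 2 * |x * tail r x| := by positivity
      have h6 : 0 ≤ 2 * |c| * (x ^ 3 * expProfile x) := by positivity
      simp only [hF]
      linarith
    · have h1 := abs_potDeriv_le_far (r := r) c hx1
      have h2 := sq_mul_abs_pot_le (r := r) c hx1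
      have h3 : |potDeriv r c x| * (1 + x ^ 2) ≤ 2 * (x ^ 2 * |potDeriv r c x|) := by
        nlinarith [mul_nonneg (abs_nonneg (potDeriv r c x)) (by nlinarith : 0 ≤ x ^ 2 - 1)]
      have h4 : 0 ≤ 6 * (2 * |c| + 7 * nX r) * (x ^ 0 * expProfile x) := by positivity
      simp only [hF]
      linarith
  have hm : AEStronglyMeasurable (potDeriv r c) posVol :=
    (continuousOn_potDeriv hr c).aestronglyMeasurable measurableSet_Ioi
  have hi : Integrable (fun x => |potDeriv r c x| * (1 + x ^ 2)) posVol := by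
    refine hi5.mono' (hm.norm.mul (by fun_prop)) ?_
    filter_upwards [ae_pos] with x hx
    rw [Real.norm_eq_abs, abs_of_nonneg (by positivity)]
    exact hle x hx
  refine ⟨memX_of_abs hm hi, le_trans ?_ hFint⟩
  refine integral_mono_ae hi hi5 ?_
  filter_upwards [ae_pos] with x hx using hle x hx

/-- Both the potential and its derivative are integrable on (1, ∞). -/
lemma tendsto_pot_atTop : Tendsto (pot r c) atTop (𝓝 0) := by
  have hT := hr.integral_id_mul_tail
  have hTm : AEStronglyMeasurable (tail r) posVol :=
    ((continuousOn_tail hr.integrable).mono Ioi_subset_Ici_self).aestronglyMeasurable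
      measurableSet_Ioi
  have hTa : (fun y => |y * tail r y|) =ᵐ[posVol] fun y => y * |tail r y| := by
    filter_upwards [ae_pos] with y hy
    rw [abs_mul, abs_of_pos hy]
  have hB := farKer_schur (f := fun y => |tail r y|) (hT.1.abs.congr hTa) hTm.norm
  have hd : IntegrableOn (potDeriv r c) (Ioi 1) :=
    IntegrableOn.mono_set (memX_potDeriv hr c).1.integrable (Ioi_subset_Ioi zero_le_one)
  have hF : IntegrableOn (fun x => |c| * (x ^ 3 * expProfile x)
      + ∫ y, farKer (x, y) * |tail r y| ∂posVol) (Ioi 1) :=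
    IntegrableOn.mono_set (((integrable_pow_expProfile 3).const_mul _).add hB.1)
      (Ioi_subset_Ioi zero_le_one)
  have hp : IntegrableOn (pot r c) (Ioi 1) := by
    refine Integrable.mono' hF (((continuousOn_pot hr c).mono
      (Ioi_subset_Ioi zero_le_one)).aestronglyMeasurable measurableSet_Ioi) ?_
    filter_upwards [ae_restrict_mem measurableSet_Ioi] with x hx
    have hx1 : (1 : ℝ) < x := hx
    refine le_trans ?_ (sq_mul_abs_pot_le (r := r) c hx1.le)
    rw [Real.norm_eq_abs]
    exact le_mul_of_one_le_left (abs_nonneg _) (by nlinarith)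
  exact tendsto_zero_of_hasDerivAt_of_integrableOn_Ioi
    (fun x hx => hasDerivAt_pot hr c (one_pos.trans hx)) hd hp

end pot

/-! ### Solvability of the linearized problem -/

/-- The solutions of the linearized problem with right-hand side `r`. -/
noncomputable def linSol (r : ℝ → ℝ) (c x : ℝ) : ℝ := r x - 2 * potDeriv r c x

section
variable {r : ℝ → ℝ} (hr : MemX r) (c : ℝ)
include hr

lemma memX_linSol : MemX (linSol r c) := hr.sub ((memX_potDeriv hr c).1.const_mul 2)

lemma nX_linSol_le : nX (linSol r c) ≤ 193 * (nX r + |c|) := by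
  have h := nX_sub_le hr ((memX_potDeriv hr c).1.const_mul 2)
  rw [nX_const_mul, abs_of_pos two_pos] at h
  have h2 := (memX_potDeriv hr c).2
  refine h.trans ?_
  linarith [abs_nonneg c]

lemma tail_linSol {x : ℝ} (hx : 0 < x) : tail (linSol r c) x = tail r x + 2 * pot r c x := by
  have h1 : IntegrableOn (potDeriv r c) (Ioi x) :=
    IntegrableOn.mono_set (memX_potDeriv hr c).1.integrable (Ioi_subset_Ioi hx.le)
  have h2 := integral_Ioi_of_hasDerivAt_of_tendsto'
    (fun y hy => hasDerivAt_pot hr c (hx.trans_le hy)) h1 (tendsto_pot_atTop hr c)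
  have h3 : tail (linSol r c) x = tail r x - ∫ y in Ioi x, 2 * potDeriv r c y :=
    integral_sub (IntegrableOn.mono_set hr.integrable (Ioi_subset_Ioi hx.le)) (h1.const_mul 2)
  rw [h3, integral_const_mul, h2]
  ring

lemma intervalIntegrable_mul_tail_linSol {φ : ℝ → ℝ} (hφ : Continuous φ) {x : ℝ} (hx : 0 ≤ x) :
    IntervalIntegrable (fun y => φ y * tail (linSol r c) y) volume 0 x :=
  (hφ.continuousOn.mul ((continuousOn_tail (memX_linSol hr c).integrable).mono fun y hy => by
    rw [uIcc_of_le hx] at hy; exact hy.1)).intervalIntegrable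

/-- With T = `tail r`, V = `pot` and Z = `amp`, the tail of the solution is T + 2V, and e^x(T + 2V)
= e^xT + 2xZ = (x²Z)'. The boundary term at 0 vanishes because xZ is bounded there. This identity
dictates the equation defining `amp`. -/
lemma integral_exp_mul_tail_linSol {x : ℝ} (hx : 0 < x) :
    ∫ y in (0 : ℝ)..x, Real.exp y * tail (linSol r c) y = x ^ 2 * amp r c x := by
  have hd : ∀ y ∈ Ioo 0 x, HasDerivAt (fun y => y ^ 2 * amp r c y)
      (Real.exp y * tail (linSol r c) y) y := by
    intro y hy
    have h1 := (hasDerivAt_pow 2 y).mul (hasDerivAt_amp hr c hy.1)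
    refine h1.congr_deriv ?_
    have h2 : Real.exp y * Real.exp (-y) = 1 := by rw [← Real.exp_add]; simp
    have hy0 : y ≠ 0 := hy.1.ne'
    have h3 : y ^ 2 * (Real.exp y * tail r y / y ^ 2) = Real.exp y * tail r y := by field_simp
    rw [tail_linSol hr c hy.1, pot, h3]
    push_cast
    linear_combination (-2 * y * amp r c y) * h2
  have hc : ContinuousOn (fun y => y ^ 2 * amp r c y) (Icc 0 x) := by
    intro y hy
    rcases hy.1.eq_or_lt with h0 | h0
    · rw [← h0]
      have h1 : Tendsto (fun y : ℝ => y * (|c| + 3 * nX r)) (𝓝[Icc 0 x] 0) (𝓝 0) := by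
        have h2 : Continuous fun y : ℝ => y * (|c| + 3 * nX r) := by fun_prop
        have h3 := h2.tendsto 0
        rw [zero_mul] at h3
        exact h3.mono_left nhdsWithin_le_nhds
      have h2 : Tendsto (fun y => y ^ 2 * amp r c y) (𝓝[Icc 0 x] 0) (𝓝 0) := by
        refine squeeze_zero_norm' ?_ h1
        have h3 : Iio (1 : ℝ) ∈ 𝓝[Icc 0 x] (0 : ℝ) :=
          mem_nhdsWithin_of_mem_nhds (Iio_mem_nhds one_pos)
        filter_upwards [h3, self_mem_nhdsWithin] with y hy1 hy2
        rcases hy2.1.eq_or_lt with h4 | h4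
        · rw [← h4]; simp
        · have h5 := mul_abs_amp_le hr c h4 (le_of_lt hy1)
          rw [norm_mul, Real.norm_eq_abs, Real.norm_eq_abs, abs_of_pos (pow_pos h4 2), pow_two,
            mul_assoc]
          exact mul_le_mul_of_nonneg_left h5 h4.le
      simpa [ContinuousWithinAt] using h2
    · exact ((continuousAt_id.pow 2).mul
        (hasDerivAt_amp hr c h0).continuousAt).continuousWithinAt
  rw [intervalIntegral.integral_eq_sub_of_hasDerivAt_of_le hx.le hc hd
    (intervalIntegrable_mul_tail_linSol hr c Real.continuous_exp hx.le)]
  simp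

/-- Integrating the second flux by parts expresses both through the tail of the solution. The
integrals against (1 + y)e^y cancel, leaving only ∫ e^y · tail, which is x²Z. -/
lemma flux_linSol {x : ℝ} (hx : 0 < x) :
    flux (fun _ _ => 1) expProfile (linSol r c) x + flux (fun _ _ => 1) (linSol r c) expProfile x
      = (1 + x) * Real.exp (-x) * (x ^ 2 * amp r c x) - x * tail (linSol r c) x := by
  set h := linSol r c with hh
  have hhi : Integrable h posVol := (memX_linSol hr c).integrable
  have hii : ∀ {φ : ℝ → ℝ}, Continuous φ →
      IntervalIntegrable (fun y => φ y * tail h y) volume 0 x := fun hφ =>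
    intervalIntegrable_mul_tail_linSol hr c hφ hx.le
  have h1 : flux (fun _ _ => 1) expProfile h x
      = ∫ y in (0 : ℝ)..x, Real.exp (-x) * ((x - y) * Real.exp y * tail h y) := by
    rw [flux_one_eq memX_expProfile.integrable hhi, ← integral_Ioc_eq_integral_Ioo,
      ← intervalIntegral.integral_of_le hx.le]
    have h2 := intervalIntegral.integral_comp_sub_left (a := 0) (b := x)
      (fun y => y * expProfile y * tail h (x - y)) x
    rw [sub_self, sub_zero] at h2
    rw [← h2]
    refine intervalIntegral.integral_congr fun y _ => ?_
    have h3 : expProfile (x - y) = Real.exp (-x) * Real.exp y := by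
      rw [expProfile, ← Real.exp_add]; ring_nf
    simp only [h3, sub_sub_cancel]
    ring
  have h2 : flux (fun _ _ => 1) h expProfile x
      = ∫ y in (0 : ℝ)..x, Real.exp (-x) * ((y * Real.exp y) * h y) := by
    rw [flux_one_eq hhi memX_expProfile.integrable, ← integral_Ioc_eq_integral_Ioo,
      ← intervalIntegral.integral_of_le hx.le]
    refine intervalIntegral.integral_congr fun y _ => ?_
    have h3 : Real.exp (-(x - y)) = Real.exp (-x) * Real.exp y := by
      rw [← Real.exp_add]; ring_nf
    simp only [tail_expProfile, h3]
    ring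
  have h3 := tail_by_parts hhi le_rfl hx.le (φ := fun y => y * Real.exp y)
    (φ' := fun y => (1 + y) * Real.exp y)
    (ContDiff.contDiffOn (by fun_prop)) (fun y _ => by
      refine ((hasDerivAt_id y).mul (Real.hasDerivAt_exp y)).congr_deriv ?_
      simp only [id]; ring) (by fun_prop)
  rw [h1, h2, intervalIntegral.integral_const_mul, intervalIntegral.integral_const_mul, h3]
  have h4 : ∫ y in (0 : ℝ)..x, (x - y) * Real.exp y * tail h y
      = (1 + x) * (∫ y in (0 : ℝ)..x, Real.exp y * tail h y)
        - ∫ y in (0 : ℝ)..x, (1 + y) * Real.exp y * tail h y := by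
    rw [← intervalIntegral.integral_const_mul, ← intervalIntegral.integral_sub
      ((hii Real.continuous_exp).const_mul _) (hii (by fun_prop))]
    refine intervalIntegral.integral_congr fun y _ => ?_
    ring
  rw [h4, integral_exp_mul_tail_linSol hr c hx]
  have h5 : Real.exp (-x) * Real.exp x = 1 := by rw [← Real.exp_add]; simp
  linear_combination (-x * tail h x) * h5

/-- By the flux identity the two gains add up to minus `potDeriv`, which is exactly how `linSol`
departs from r. -/
lemma linSol_spec {x : ℝ} (hx : 0 < x) :
    linSol r c x = r x + 2 * gain (fun _ _ => 1) expProfile (linSol r c) x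
      + 2 * gain (fun _ _ => 1) (linSol r c) expProfile x := by
  have h1 := flux_linSol hr c hx
  rw [tail_linSol hr c hx, pot] at h1
  have h2 : gain (fun _ _ => 1) expProfile (linSol r c) x
      + gain (fun _ _ => 1) (linSol r c) expProfile x
      = -(tail r x / x + (1 - x) * Real.exp (-x) * amp r c x) := by
    rw [gain, gain, ← add_div, h1]
    field_simp
    ring
  have h3 : linSol r c x = r x - 2 * (tail r x / x + (1 - x) * Real.exp (-x) * amp r c x) := rfl
  linarith

/-- The constant c adds the multiple -2c of the kernel element (1-x)e^{-x}, whose first moment is 1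
- 2 = -1. So c adjusts the mass freely. -/
lemma integral_id_mul_linSol :
    ∫ x, x * linSol r c x ∂posVol = (∫ x, x * linSol r 0 x ∂posVol) + 2 * c := by
  have h1 : ∀ x, x * linSol r c x
      = x * linSol r 0 x - 2 * c * (x ^ 1 * expProfile x - x ^ 2 * expProfile x) := by
    intro x
    simp only [linSol, potDeriv, amp, expProfile]
    ring
  have hi : Integrable (fun x => x ^ 1 * expProfile x - x ^ 2 * expProfile x) posVol :=
    (integrable_pow_expProfile 1).sub (integrable_pow_expProfile 2)
  simp_rw [h1]
  rw [integral_sub (memX_linSol hr 0).integrable_id (hi.const_mul _), integral_const_mul,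
    integral_sub (integrable_pow_expProfile 1) (integrable_pow_expProfile 2),
    integral_pow_expProfile, integral_pow_expProfile]
  norm_num [Nat.factorial]

end

/-- Solvability of the linearized problem on functions of vanishing mass. -/
theorem exists_linearized_solution {r : ℝ → ℝ} (hr : MemX r) :
    ∃ h, MemX h ∧ nX h ≤ 20000 * nX r ∧ ∫ x, x * h x ∂posVol = 0 ∧
      h =ᵐ[posVol] fun x => r x + 2 * gain (fun _ _ => 1) expProfile h x
        + 2 * gain (fun _ _ => 1) h expProfile x := by
  set m := ∫ x, x * linSol r 0 x ∂posVol with hm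
  have h1 : |m| ≤ 193 * nX r := by
    have h2 := nX_linSol_le hr 0
    rw [abs_zero, add_zero] at h2
    exact abs_integral_le_integral_abs.trans ((memX_linSol hr 0).integral_id_le.trans h2)
  refine ⟨linSol r (-m / 2), memX_linSol hr _, ?_, ?_, ?_⟩
  · refine (nX_linSol_le hr _).trans ?_
    rw [abs_div, abs_neg, abs_of_pos (two_pos : (0 : ℝ) < 2)]
    -- The constant is 193(1 + 193/2) < 20000, where 193 = 1 + 2 · 96.
    linarith [nX_nonneg r]
  · rw [integral_id_mul_linSol hr]; linarith
  · filter_upwards [ae_pos] with x hx using linSol_spec hr _ hx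

/-- The a priori estimate for the linearized problem. -/
theorem nX_le_of_linearized {h r : ℝ → ℝ} (hh : MemX h) (hr : MemX r)
    (hm : ∫ x, x * h x ∂posVol = 0)
    (heq : h =ᵐ[posVol] fun x => r x + 2 * gain (fun _ _ => 1) expProfile h x
        + 2 * gain (fun _ _ => 1) h expProfile x) : nX h ≤ 20000 * nX r := by
  obtain ⟨k, hk, hkn, hkm, hkeq⟩ := exists_linearized_solution hr
  have he := memX_expProfile.integrable
  have h1 : (fun x => h x - k x) =ᵐ[posVol] 0 := by
    -- The bound is known for the constructed solution only; injectivity on mass zero identifies h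
    -- with it.
    refine eq_zero_of_linearized (hh.sub hk) ?_ ?_
    · simp_rw [mul_sub]
      rw [integral_sub hh.integrable_id hk.integrable_id, hm, hkm, sub_zero]
    · filter_upwards [heq, hkeq] with x h1 h2
      rw [gain_sub_right bddKernel_one he hh.integrable hk.integrable,
        gain_sub_left bddKernel_one hh.integrable hk.integrable he]
      linarith
  have h2 : h =ᵐ[posVol] k := by
    filter_upwards [h1] with x hx using sub_eq_zero.1 hx
  rw [nX_congr h2]
  exact hkn

/-! ### Nonlinear perturbation: local uniqueness and existence -/

/-- The deviation of the difference of the quadratic operators from their linearization at the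
exponential profile. -/
noncomputable def linErr (W : ℝ → ℝ → ℝ) (ε : ℝ) (a b h : ℝ → ℝ) (x : ℝ) : ℝ :=
  2 * gain (fun _ _ => 1) (fun y => a y - expProfile y) h x
    + 2 * gain (fun _ _ => 1) h (fun y => b y - expProfile y) x
    + ε * (gain W a h x + gain W h b x)

section
variable {W : ℝ → ℝ → ℝ} (hW : IsPerturbation W) {ε : ℝ} (h0 : 0 ≤ ε) {a b h : ℝ → ℝ}
  (ha : MemX a) (hb : MemX b) (hh : MemX h)
include hW h0 ha hb hh

omit h0 in
lemma linErr_memX : MemX (linErr W ε a b h) :=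
  (((gain_memX bddKernel_one (ha.sub memX_expProfile) hh).1.const_mul 2).add
    ((gain_memX bddKernel_one hh (hb.sub memX_expProfile)).1.const_mul 2)).add
    (((gain_memX hW.bddKernel ha hh).1.add (gain_memX hW.bddKernel hh hb).1).const_mul ε)

/-- The two constant-kernel terms contribute 2δ each. Since e^{-x} has norm 3, a and b have norm at
most 4, and the W terms contribute (4 + 4)ε. -/
lemma nX_linErr_le {δ : ℝ} (hδ : δ ≤ 1) (hal : nX (fun x => a x - expProfile x) ≤ δ)
    (hbl : nX (fun x => b x - expProfile x) ≤ δ) :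
    nX (linErr W ε a b h) ≤ (4 * δ + 8 * ε) * nX h := by
  have hn := nX_nonneg h
  have h1 := gain_memX bddKernel_one (ha.sub memX_expProfile) hh
  have h2 := gain_memX bddKernel_one hh (hb.sub memX_expProfile)
  have h3 := gain_memX hW.bddKernel ha hh
  have h4 := gain_memX hW.bddKernel hh hb
  have hbd : ∀ {a : ℝ → ℝ}, MemX a → nX (fun x => a x - expProfile x) ≤ δ → nX a ≤ 4 := by
    intro a ha hal
    have := nX_add_le (ha.sub memX_expProfile) memX_expProfile
    rw [nX_expProfile] at this
    simp only [sub_add_cancel] at this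
    have h5 : nX (fun x => a x) = nX a := rfl
    linarith
  have ha4 := hbd ha hal
  have hb4 := hbd hb hbl
  have h5 := nX_add_le ((h1.1.const_mul 2).add (h2.1.const_mul 2)) ((h3.1.add h4.1).const_mul ε)
  have h6 := nX_add_le (h1.1.const_mul 2) (h2.1.const_mul 2)
  have h7 := nX_add_le h3.1 h4.1
  rw [nX_const_mul, abs_of_nonneg h0] at h5
  rw [nX_const_mul, nX_const_mul, abs_of_pos two_pos] at h6
  have h8 := mul_le_mul_of_nonneg_right hal hn
  have h9 := mul_le_mul_of_nonneg_left hbl hn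
  have h10 := mul_le_mul_of_nonneg_right ha4 hn
  have h11 := mul_le_mul_of_nonneg_left hb4 hn
  have h12 := h1.2
  have h13 := h2.2
  have h14 := h3.2
  have h15 := h4.2
  have h16 : nX (fun x => gain W a h x + gain W h b x) ≤ 8 * nX h := by linarith
  have h17 := mul_le_mul_of_nonneg_left h16 h0
  refine h5.trans ?_
  linarith

omit h0 in
/-- The difference of two values of the nonlinearity. -/
lemma gain_kernel_sub (hhab : h =ᵐ[posVol] fun x => a x - b x) (x : ℝ) :
    gain (kernel W ε) a a x - gain (kernel W ε) b b x
      = linErr W ε a b h x + 2 * gain (fun _ _ => 1) expProfile h x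
        + 2 * gain (fun _ _ => 1) h expProfile x := by
  have he := memX_expProfile.integrable
  have ha' := ha.integrable
  have hb' := hb.integrable
  have hh' := hh.integrable
  rw [linErr, gain_sub_left bddKernel_one ha' he hh', gain_sub_right bddKernel_one hh' hb' he,
    gain_kernel hW ε ha' ha', gain_kernel hW ε hb' hb',
    gain_congr (Eventually.of_forall fun _ => rfl : a =ᵐ[posVol] a) hhab,
    gain_congr (Eventually.of_forall fun _ => rfl : a =ᵐ[posVol] a) hhab,
    gain_congr hhab (Eventually.of_forall fun _ => rfl : b =ᵐ[posVol] b),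
    gain_congr hhab (Eventually.of_forall fun _ => rfl : b =ᵐ[posVol] b),
    gain_sub_right bddKernel_one ha' ha' hb', gain_sub_right hW.bddKernel ha' ha' hb',
    gain_sub_left bddKernel_one ha' hb' hb', gain_sub_left hW.bddKernel ha' hb' hb']
  ring

end

/-- Fixed points near the exponential profile are unique. -/
theorem ae_eq_of_eq_gain {W : ℝ → ℝ → ℝ} (hW : IsPerturbation W) {ε : ℝ} (h0 : 0 ≤ ε)
    (h1 : ε ≤ 1 / 1000000) {G H : ℝ → ℝ} (hG : MemX G) (hH : MemX H)
    (hGe : G =ᵐ[posVol] gain (kernel W ε) G G) (hHe : H =ᵐ[posVol] gain (kernel W ε) H H)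
    (hm : ∫ x, x * H x ∂posVol = ∫ x, x * G x ∂posVol)
    (hGc : nX (fun x => G x - expProfile x) ≤ 1 / 1000000)
    (hHc : nX (fun x => H x - expProfile x) ≤ 1 / 1000000) : H =ᵐ[posVol] G := by
  have hh := hH.sub hG
  have h2 := nX_linErr_le hW h0 hH hG hh (by norm_num) hHc hGc
  have h3 := nX_le_of_linearized hh (linErr_memX (ε := ε) hW hH hG hh) (by
      simp_rw [mul_sub]
      rw [integral_sub hH.integrable_id hG.integrable_id, hm, sub_self]) (by
      filter_upwards [hGe, hHe] with x hx1 hx2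
      rw [← gain_kernel_sub (ε := ε) hW hH hG hh (Eventually.of_forall fun _ => rfl), ← hx1, ← hx2])
  have hn := nX_nonneg (fun x => H x - G x)
  -- The difference is at most 20000 · 12/1000000 < 1 times itself.
  have h4 : nX (fun x => H x - G x) ≤ 0 := by nlinarith
  filter_upwards [nX_eq_zero hh h4] with x hx using sub_eq_zero.1 hx

lemma two_mul_gain_expProfile {x : ℝ} (hx : 0 < x) :
    2 * gain (fun _ _ => 1) expProfile expProfile x = expProfile x := by
  rw [gain, flux_one_expProfile hx, expProfile]
  field_simp

/-- The function represented by an element of `L¹` after removing the weight `1 + x²`. -/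
noncomputable def unweight (f : Lp ℝ 1 posVol) (x : ℝ) : ℝ := f x / (1 + x ^ 2)

lemma unweight_mul (f : Lp ℝ 1 posVol) (x : ℝ) : unweight f x * (1 + x ^ 2) = f x := by
  have : (1 : ℝ) + x ^ 2 ≠ 0 := by positivity
  rw [unweight]; field_simp

lemma memX_unweight (f : Lp ℝ 1 posVol) : MemX (unweight f) := by
  unfold MemX
  simp only [unweight_mul]
  exact L1.integrable_coeFn f

lemma nX_unweight_sub (f g : Lp ℝ 1 posVol) :
    nX (fun x => unweight f x - unweight g x) = dist f g := by
  rw [dist_eq_norm, L1.norm_eq_integral_norm, nX]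
  refine integral_congr_ae ?_
  filter_upwards [Lp.coeFn_sub f g] with x hx
  rw [hx, Pi.sub_apply, ← unweight_mul, ← unweight_mul, ← sub_mul, norm_mul, Real.norm_eq_abs,
    Real.norm_eq_abs, abs_of_pos (by positivity : 0 < 1 + x ^ 2)]

lemma unweight_toL1 {h : ℝ → ℝ} (hh : MemX h) :
    unweight (Integrable.toL1 (fun x => h x * (1 + x ^ 2)) hh) =ᵐ[posVol] h := by
  filter_upwards [Integrable.coeFn_toL1 hh] with x hx
  have : (1 : ℝ) + x ^ 2 ≠ 0 := by positivity
  rw [unweight, hx]; field_simp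

/-- The quadratic operator has a fixed point of mass one near the exponential profile. -/
theorem exists_eq_gain {W : ℝ → ℝ → ℝ} (hW : IsPerturbation W) {δ : ℝ} (hδ : 0 < δ)
    (hδ1 : δ ≤ 1 / 1000000) {ε : ℝ} (h0 : 0 ≤ ε) (h1 : ε ≤ δ / 1000000) :
    ∃ G, MemX G ∧ G =ᵐ[posVol] gain (kernel W ε) G G ∧ ∫ x, x * G x ∂posVol = 1 ∧
      nX (fun x => G x - expProfile x) ≤ δ := by
  have he := memX_expProfile
  set P : Lp ℝ 1 posVol → ℝ → ℝ := fun f x => expProfile x + unweight f x with hP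
  have hPm : ∀ f, MemX (P f) := fun f => he.add (memX_unweight f)
  have hPd : ∀ f x, P f x - expProfile x = unweight f x := fun f x => by simp [hP]
  -- With G = e^{-x} + f, the fixed-point equation reads f = N(f) + (linear part of f), because
  -- 2B_1(e^{-x}, e^{-x}) = e^{-x}. Inverting the linearization on mass zero gives f = S(f).
  set N : Lp ℝ 1 posVol → ℝ → ℝ := fun f x => gain (kernel W ε) (P f) (P f) x
    - 2 * gain (fun _ _ => 1) expProfile expProfile x
    - (2 * gain (fun _ _ => 1) expProfile (unweight f) x
      + 2 * gain (fun _ _ => 1) (unweight f) expProfile x) with hN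
  have hNm : ∀ f, MemX (N f) := fun f =>
    (((gain_memX (hW.bddKernel_kernel h0) (hPm f) (hPm f)).1.sub
      ((gain_memX bddKernel_one he he).1.const_mul 2))).sub
      (((gain_memX bddKernel_one he (memX_unweight f)).1.const_mul 2).add
        ((gain_memX bddKernel_one (memX_unweight f) he).1.const_mul 2))
  choose S hSm hSn hS0 hSe using fun f => exists_linearized_solution (hNm f)
  set Φ : Lp ℝ 1 posVol → Lp ℝ 1 posVol := fun f =>
    Integrable.toL1 (fun x => S f x * (1 + x ^ 2)) (hSm f) with hΦ
  have hu : ∀ f, unweight (Φ f) =ᵐ[posVol] S f := fun f => unweight_toL1 (hSm f)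
  have hnorm : ∀ f : Lp ℝ 1 posVol, nX (unweight f) = ‖f‖ := by
    intro f
    rw [← sub_zero f, ← dist_eq_norm, ← nX_unweight_sub, sub_zero]
    refine nX_congr ?_
    filter_upwards [Lp.coeFn_zero ℝ 1 posVol] with x hx
    rw [unweight, unweight, hx]; simp
  -- S is chosen without any linearity, but S(f) - S(g) solves the linearized problem with
  -- right-hand side N(f) - N(g) = `linErr`. The a priori estimate therefore applies, and 20000(4δ +
  -- 8ε) ≤ 1/2.
  have hlip : ∀ f g, ‖f‖ ≤ δ → ‖g‖ ≤ δ → dist (Φ f) (Φ g) ≤ 1 / 2 * dist f g := by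
    intro f g hf hg
    have hd := (memX_unweight f).sub (memX_unweight g)
    have hff : nX (fun x => P f x - expProfile x) ≤ δ := by
      simp only [hPd]; exact (hnorm f).trans_le hf
    have hgg : nX (fun x => P g x - expProfile x) ≤ δ := by
      simp only [hPd]; exact (hnorm g).trans_le hg
    have h2 := nX_linErr_le hW h0 (hPm f) (hPm g) hd (by linarith) hff hgg
    have h3 := nX_le_of_linearized ((hSm f).sub (hSm g)) (linErr_memX (ε := ε) hW (hPm f) (hPm g) hd) (by
        simp_rw [mul_sub]
        rw [integral_sub (hSm f).integrable_id (hSm g).integrable_id, hS0, hS0, sub_self]) (by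
        filter_upwards [hSe f, hSe g] with x hx1 hx2
        have h4 := gain_kernel_sub (ε := ε) hW (hPm f) (hPm g) hd
          (Eventually.of_forall fun x => by simp [hP]) x
        rw [gain_sub_right bddKernel_one he.integrable (memX_unweight f).integrable
            (memX_unweight g).integrable,
          gain_sub_left bddKernel_one (memX_unweight f).integrable
            (memX_unweight g).integrable he.integrable] at h4
        rw [hx1, hx2, gain_sub_right bddKernel_one he.integrable (hSm f).integrable
            (hSm g).integrable,
          gain_sub_left bddKernel_one (hSm f).integrable (hSm g).integrable he.integrable]
        simp only [hN]
        linarith)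
    have h4 : dist (Φ f) (Φ g) = nX (fun x => S f x - S g x) := by
      rw [← nX_unweight_sub]
      refine nX_congr ?_
      filter_upwards [hu f, hu g] with x hx1 hx2
      rw [hx1, hx2]
    rw [h4]
    rw [nX_unweight_sub] at h2
    have := dist_nonneg (x := f) (y := g)
    nlinarith
  -- N(0) = εB_W(e^{-x}, e^{-x}) has norm at most 9ε, and 20000 · 9ε ≤ δ/2 is why ε must be small
  -- compared with δ.
  have hzero : ‖Φ 0‖ ≤ δ / 2 := by
    have hP0 : P 0 =ᵐ[posVol] expProfile := by
      filter_upwards [Lp.coeFn_zero ℝ 1 posVol] with x hx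
      simp only [hP]
      rw [unweight, hx]; simp
    have hu0 : unweight 0 =ᵐ[posVol] fun x => 0 * expProfile x := by
      filter_upwards [Lp.coeFn_zero ℝ 1 posVol] with x hx
      rw [unweight, hx]; simp
    have hee : expProfile =ᵐ[posVol] expProfile := Eventually.of_forall fun _ => rfl
    have hz : ∀ K : ℝ → ℝ → ℝ, ∀ x, gain K expProfile (fun x => 0 * expProfile x) x = 0 ∧
        gain K (fun x => 0 * expProfile x) expProfile x = 0 := by
      intro K x
      constructor <;>
      · rw [gain, flux]
        simp [pairing]
    have h2 : ∀ x, N 0 x = ε * gain W expProfile expProfile x := by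
      intro x
      simp only [hN]
      rw [gain_congr hP0 hP0, gain_congr hee hu0, gain_congr hu0 hee, (hz _ x).1, (hz _ x).2,
        gain_kernel hW ε he.integrable he.integrable]
      ring
    have h3 : nX (N 0) ≤ ε * 9 := by
      have h4 : nX (N 0) = nX (fun x => ε * gain W expProfile expProfile x) := by
        congr 1; ext x; exact h2 x
      rw [h4, nX_const_mul, abs_of_nonneg h0]
      have h5 := (gain_memX hW.bddKernel he he).2
      rw [nX_expProfile] at h5
      exact mul_le_mul_of_nonneg_left (by linarith) h0
    rw [← hnorm, nX_congr (hu 0)]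
    have := hSn 0
    linarith
  have hmaps : MapsTo Φ (Metric.closedBall 0 δ) (Metric.closedBall 0 δ) := by
    intro f hf
    rw [mem_closedBall_zero_iff] at hf ⊢
    have h2 := hlip f 0 hf (by simpa using hδ.le)
    rw [dist_zero_right] at h2
    have h3 : ‖Φ f‖ ≤ dist (Φ f) (Φ 0) + ‖Φ 0‖ := by
      rw [dist_eq_norm]
      simpa using norm_add_le (Φ f - Φ 0) (Φ 0)
    linarith
  have hcon : ContractingWith (1 / 2) (hmaps.restrict Φ _ _) := by
    refine ⟨by rw [div_lt_one] <;> norm_num, LipschitzWith.of_dist_le_mul fun f g => ?_⟩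
    have h2 := hlip f.1 g.1 (mem_closedBall_zero_iff.1 f.2) (mem_closedBall_zero_iff.1 g.2)
    have h3 : ((1 / 2 : NNReal) : ℝ) = 1 / 2 := by norm_num
    rw [h3]
    exact h2
  obtain ⟨f, hfs, hfix, -⟩ := hcon.exists_fixedPoint' Metric.isClosed_closedBall.isComplete hmaps
    (x := 0) (by simpa using hδ.le) (edist_ne_top _ _)
  have hfu : unweight f =ᵐ[posVol] S f := by
    have := hu f
    rwa [hfix] at this
  refine ⟨P f, hPm f, ?_, ?_, ?_⟩
  · have hee : expProfile =ᵐ[posVol] expProfile := Eventually.of_forall fun _ => rfl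
    filter_upwards [hfu, hSe f, ae_pos] with x hx1 hx2 hx3
    rw [← gain_congr hee hfu, ← gain_congr hfu hee, ← hx1] at hx2
    simp only [hN] at hx2
    rw [two_mul_gain_expProfile hx3] at hx2
    have h2 : P f x = expProfile x + unweight f x := rfl
    linarith
  · have h2 : ∫ x, x * P f x ∂posVol
        = (∫ x, x ^ 1 * expProfile x ∂posVol) + ∫ x, x * unweight f x ∂posVol := by
      rw [← integral_add (integrable_pow_expProfile 1) (memX_unweight f).integrable_id]
      refine integral_congr_ae (Eventually.of_forall fun x => ?_)
      simp only [hP]; ring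
    have h3 : ∫ x, x * unweight f x ∂posVol = 0 := by
      rw [← hS0 f]
      refine integral_congr_ae ?_
      filter_upwards [hfu] with x hx
      rw [hx]
    rw [h2, h3, integral_pow_expProfile]
    simp
  · simp only [hPd]
    exact (hnorm f).trans_le (mem_closedBall_zero_iff.1 hfs)

/-! ### Nonnegativity of the fixed point -/

/-- A continuous function which does not decrease while it is positive stays positive. -/
lemma pos_of_pos_of_mono {f : ℝ → ℝ} {X : ℝ} (hf : ContinuousOn f (Icc 0 X))
    (hmono : ∀ s t, 0 ≤ s → s ≤ t → t ≤ X → (∀ x ∈ Ioo s t, 0 < f x) → f s ≤ f t) {s t : ℝ}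
    (hs : 0 ≤ s) (hst : s ≤ t) (ht : t ≤ X) (h : 0 < f s) : 0 < f t := by
  by_contra hcon
  push Not at hcon
  have hc : IsCompact (Icc s t ∩ f ⁻¹' Iic 0) :=
    isCompact_Icc.of_isClosed_subset
      ((hf.mono (Icc_subset_Icc hs ht)).preimage_isClosed_of_isClosed isClosed_Icc isClosed_Iic)
      inter_subset_left
  obtain ⟨c, ⟨hc1, hc2⟩, hc3⟩ := hc.exists_isLeast ⟨t, right_mem_Icc.2 hst, hcon⟩
  have h1 := hmono s c hs hc1.1 (hc1.2.trans ht) fun x hx => by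
    by_contra hx2
    exact absurd (hc3 ⟨⟨hx.1.le, hx.2.le.trans hc1.2⟩, not_lt.1 hx2⟩) (not_le.2 hx.2)
  exact absurd (h.trans_le h1) (not_lt.2 hc2)

/-- The mass carried by the positive part below `x`. -/
noncomputable def posMass (G : ℝ → ℝ) (x : ℝ) : ℝ := ∫ y in (0 : ℝ)..x, y * max (G y) 0

lemma max_sub_max_neg (a : ℝ) : max a 0 - max (-a) 0 = a := by
  rcases le_total 0 a with h | h
  · rw [max_eq_left h, max_eq_right (by linarith)]; ring
  · rw [max_eq_right h, max_eq_left (by linarith)]; ring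

section
variable {G : ℝ → ℝ} (hG : Integrable G posVol)
include hG

lemma intervalIntegrable_id_mul_max {a b : ℝ} (ha : 0 ≤ a) (hb : 0 ≤ b) :
    IntervalIntegrable (fun y => y * max (G y) 0) volume a b :=
  (intervalIntegrable_of_posVol hG.pos_part ha hb).continuousOn_mul continuousOn_id

lemma posMass_sub {a b : ℝ} (ha : 0 ≤ a) (hb : 0 ≤ b) :
    posMass G b - posMass G a = ∫ y in a..b, y * max (G y) 0 :=
  intervalIntegral.integral_interval_sub_left (intervalIntegrable_id_mul_max hG le_rfl hb)
    (intervalIntegrable_id_mul_max hG le_rfl ha)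

lemma posMass_mono {a b : ℝ} (ha : 0 ≤ a) (hab : a ≤ b) : posMass G a ≤ posMass G b := by
  have h1 := posMass_sub hG ha (ha.trans hab)
  have h2 : 0 ≤ ∫ y in a..b, y * max (G y) 0 :=
    intervalIntegral.integral_nonneg hab fun y hy => mul_nonneg (ha.trans hy.1) (le_max_right _ _)
  linarith

lemma continuousOn_posMass {X : ℝ} (hX : 0 ≤ X) : ContinuousOn (posMass G) (Icc 0 X) := by
  have h := intervalIntegral.continuousOn_primitive_interval'
    (intervalIntegrable_id_mul_max hG le_rfl hX) left_mem_uIcc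
  rwa [uIcc_of_le hX] at h

lemma posMass_eq_of_nonpos {a b : ℝ} (ha : 0 ≤ a) (hab : a ≤ b)
    (h : ∀ᵐ x ∂posVol, x ∈ Ioo a b → G x ≤ 0) : posMass G a = posMass G b := by
  have h1 := posMass_sub hG ha (ha.trans hab)
  have h2 : ∫ y in a..b, y * max (G y) 0 = 0 := by
    rw [intervalIntegral.integral_of_le hab, integral_Ioc_eq_integral_Ioo, ← posVol_restrict_Ioo ha]
    refine integral_eq_zero_of_ae ?_
    filter_upwards [ae_restrict_of_ae h, ae_restrict_mem measurableSet_Ioo] with y h3 h4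
    rw [max_eq_right (h3 h4), mul_zero]; rfl
  linarith

lemma nonpos_of_posMass_eq_zero {b : ℝ} (hb : 0 ≤ b) (h : posMass G b = 0) :
    ∀ᵐ x ∂posVol, x ∈ Ioo 0 b → G x ≤ 0 := by
  rw [posMass, intervalIntegral.integral_of_le hb, integral_Ioc_eq_integral_Ioo,
    ← posVol_restrict_Ioo le_rfl, integral_eq_zero_iff_of_nonneg_ae] at h
  · have h2 := (ae_restrict_iff' measurableSet_Ioo).1 h
    filter_upwards [h2] with x hx hx2
    have := (mul_eq_zero.1 (hx hx2)).resolve_left hx2.1.ne'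
    exact max_eq_right_iff.1 this
  · filter_upwards [ae_restrict_mem measurableSet_Ioo] with y hy
    exact mul_nonneg hy.1.le (le_max_right _ _)
  · rw [posVol_restrict_Ioo le_rfl]
    exact (intervalIntegrable_iff_integrableOn_Ioo_of_le hb).1
      (intervalIntegrable_id_mul_max hG le_rfl hb)

end

/-- Cone argument: near the origin an integrable solution does not change sign. -/
theorem nonneg_near_zero {G : ℝ → ℝ} (hG : Integrable G posVol) {α β X : ℝ} (hα : 0 < α)
    (hαβ : α ≤ β) (hκ : β - α < 1) (hX : 0 < X)
    (hlo : ∀ᵐ x ∂posVol, x ∈ Ioo 0 X → α * posMass G x - β * posMass (fun y => -G y) x ≤ x ^ 2 * G x)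
    (hhi : ∀ᵐ x ∂posVol, x ∈ Ioo 0 X → x ^ 2 * G x ≤ β * posMass G x - α * posMass (fun y => -G y) x)
    (hpos : 0 < α * posMass G X - β * posMass (fun y => -G y) X) :
    ∀ᵐ x ∂posVol, x ∈ Ioo 0 X → 0 ≤ G x := by
  have hG' : Integrable (fun y => -G y) posVol := hG.neg
  have hβ : 0 < β := hα.trans_le hαβ
  set P := posMass G with hP
  set N := posMass (fun y => -G y) with hN
  have hPc := continuousOn_posMass hG hX.le
  have hNc := continuousOn_posMass hG' hX.le
  have hP0 : P 0 = 0 := intervalIntegral.integral_same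
  have hN0 : N 0 = 0 := intervalIntegral.integral_same
  have hPn : ∀ x, 0 ≤ x → 0 ≤ P x := fun x hx => by
    have := posMass_mono hG le_rfl hx; rwa [← hP, hP0] at this
  have hNn : ∀ x, 0 ≤ x → 0 ≤ N x := fun x hx => by
    have := posMass_mono hG' le_rfl hx; rwa [← hN, hN0] at this
  have hfc : ContinuousOn (fun x => α * P x - β * N x) (Icc 0 X) :=
    (hPc.const_mul α).sub (hNc.const_mul β)
  have hgc : ContinuousOn (fun x => α * N x - β * P x) (Icc 0 X) :=
    (hNc.const_mul α).sub (hPc.const_mul β)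
  -- Where αP - βN > 0 the lower bound makes G nonnegative, so N is constant and P nondecreasing:
  -- the cone condition reinforces itself. The same holds with P and N exchanged.
  have hGpos : ∀ s t, 0 ≤ s → t ≤ X → (∀ x ∈ Ioo s t, 0 < α * P x - β * N x) →
      ∀ᵐ x ∂posVol, x ∈ Ioo s t → 0 ≤ G x := by
    intro s t hs ht h
    filter_upwards [hlo, ae_pos] with x h1 h2 h3
    have h4 := h1 ⟨h2, h3.2.trans_le ht⟩
    have h5 := h x h3
    have h6 : 0 < x ^ 2 := by positivity
    by_contra hcon
    nlinarith
  have hfm : ∀ s t, 0 ≤ s → s ≤ t → t ≤ X → (∀ x ∈ Ioo s t, 0 < α * P x - β * N x) →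
      α * P s - β * N s ≤ α * P t - β * N t := by
    intro s t hs hst ht h
    have h1 := posMass_mono hG hs hst
    have h2 := posMass_eq_of_nonpos hG' hs hst (by
      filter_upwards [hGpos s t hs ht h] with x h3 h4
      linarith [h3 h4])
    rw [← hN] at h2
    rw [← hP] at h1
    rw [h2]
    linarith [mul_le_mul_of_nonneg_left h1 hα.le]
  have hgm : ∀ s t, 0 ≤ s → s ≤ t → t ≤ X → (∀ x ∈ Ioo s t, 0 < α * N x - β * P x) →
      α * N s - β * P s ≤ α * N t - β * P t := by
    intro s t hs hst ht h
    have h1 := posMass_mono hG' hs hst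
    have h2 := posMass_eq_of_nonpos hG hs hst (by
      filter_upwards [hhi, ae_pos] with x h1 h2 h3
      have h4 := h1 ⟨h2, h3.2.trans_le ht⟩
      have h5 := h x h3
      have h6 : 0 < x ^ 2 := by positivity
      by_contra hcon
      nlinarith)
    rw [← hP] at h2
    rw [← hN] at h1
    rw [h2]
    linarith [mul_le_mul_of_nonneg_left h1 hα.le]
  have hc : IsCompact (Icc 0 X ∩ (fun x => α * P x - β * N x) ⁻¹' {0}) :=
    isCompact_Icc.of_isClosed_subset
      (hfc.preimage_isClosed_of_isClosed isClosed_Icc isClosed_singleton) inter_subset_left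
  -- c is the last zero of αP - βN. To its right G is nonnegative; to its left neither cone
  -- condition can hold, since it would persist up to c.
  obtain ⟨c, ⟨hc1, hc2⟩, hc3⟩ := hc.exists_isGreatest
    ⟨0, left_mem_Icc.2 hX.le, by simp [hP0, hN0]⟩
  have hc0 : α * P c - β * N c = 0 := hc2
  have hf0 : ∀ t, 0 ≤ t → t ≤ c → α * P t - β * N t ≤ 0 := by
    intro t ht htc
    by_contra hcon
    have := pos_of_pos_of_mono hfc hfm ht htc hc1.2 (not_le.1 hcon)
    simp only [hc0, lt_irrefl] at this
  have hgc0 : α * N c - β * P c ≤ 0 := by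
    have h1 := hPn c hc1.1
    have h2 := hNn c hc1.1
    nlinarith [mul_nonneg h1 hα.le, mul_nonneg h2 hα.le, mul_le_mul_of_nonneg_right hαβ h1, mul_le_mul_of_nonneg_right hαβ h2]
  have hg0 : ∀ t, 0 ≤ t → t ≤ c → α * N t - β * P t ≤ 0 := by
    intro t ht htc
    by_contra hcon
    have := pos_of_pos_of_mono hgc hgm ht htc hc1.2 (not_le.1 hcon)
    exact absurd this (not_lt.2 hgc0)
  have hright : ∀ᵐ x ∂posVol, x ∈ Ioo c X → 0 ≤ G x := by
    refine hGpos c X hc1.1 le_rfl fun x hx => ?_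
    by_contra hcon
    have h1 := intermediate_value_Icc hx.2.le
      (hfc.mono (Icc_subset_Icc (hc1.1.trans hx.1.le) le_rfl))
    obtain ⟨y, hy1, hy2⟩ := h1 ⟨not_lt.1 hcon, hpos.le⟩
    exact absurd (hc3 ⟨⟨hc1.1.trans (hx.1.le.trans hy1.1), hy1.2⟩, hy2⟩)
      (not_le.2 (hx.1.trans_le hy1.1))
  have hR : ∀ x, 0 ≤ x → P x + N x = ∫ y in (0 : ℝ)..x, y * |G y| := by
    intro x hx
    rw [hP, hN, posMass, posMass, ← intervalIntegral.integral_add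
      (intervalIntegrable_id_mul_max hG le_rfl hx) (intervalIntegrable_id_mul_max hG' le_rfl hx)]
    congr 1; ext y
    rw [← mul_add]
    congr 1
    rcases le_total 0 (G y) with h | h
    · rw [max_eq_left h, max_eq_right (by linarith), abs_of_nonneg h, add_zero]
    · rw [max_eq_right h, max_eq_left (by linarith), abs_of_nonpos h, zero_add]
  -- Outside both cones the main terms cancel and only β - α remains. If R = P + N ≤ Cx, this gives
  -- y|G(y)| ≤ (β-α)C and so R ≤ (β-α)Cx. Iterating with β - α < 1 yields R = 0 on [0, c].
  have hbd : ∀ᵐ x ∂posVol, x ∈ Ioo 0 c → x ^ 2 * |G x| ≤ (β - α) * (P x + N x) := by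
    filter_upwards [hlo, hhi] with x h1 h2 h3
    have h4 := h1 ⟨h3.1, h3.2.trans_le hc1.2⟩
    have h5 := h2 ⟨h3.1, h3.2.trans_le hc1.2⟩
    have h6 := hf0 x h3.1.le h3.2.le
    have h7 := hg0 x h3.1.le h3.2.le
    have h8 : x ^ 2 * |G x| = |x ^ 2 * G x| := by rw [abs_mul, abs_of_nonneg (sq_nonneg x)]
    rw [h8, abs_le]
    constructor <;> linarith
  have hκ0 : 0 ≤ β - α := by linarith
  have hstep : ∀ C, (∀ x, 0 ≤ x → x ≤ c → P x + N x ≤ C * x) →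
      ∀ x, 0 ≤ x → x ≤ c → P x + N x ≤ (β - α) * C * x := by
    intro C hC x hx hxc
    rw [hR x hx]
    have h1 : ∀ᵐ y ∂volume, y ∈ Ioo 0 x → y * |G y| ≤ (β - α) * C := by
      have h2 := (ae_restrict_iff' measurableSet_Ioi).1 hbd
      filter_upwards [h2] with y h3 h4
      have h5 := h3 h4.1 ⟨h4.1, h4.2.trans_le hxc⟩
      have h6 := hC y h4.1.le (h4.2.le.trans hxc)
      have h7 := mul_le_mul_of_nonneg_left h6 hκ0
      have h8 : y * (y * |G y|) ≤ y * ((β - α) * C) := by nlinarith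
      exact le_of_mul_le_mul_left h8 h4.1
    rw [intervalIntegral.integral_of_le hx, integral_Ioc_eq_integral_Ioo]
    calc _ ≤ ∫ y in Ioo 0 x, (β - α) * C := by
          refine setIntegral_mono_on_ae ?_ (integrableOn_const (by simp)) measurableSet_Ioo h1
          exact (intervalIntegrable_iff_integrableOn_Ioo_of_le hx).1
            ((intervalIntegrable_of_posVol hG.abs le_rfl hx).continuousOn_mul continuousOn_id)
      _ = _ := by simp [hx, mul_comm]
  have hbase : ∀ x, 0 ≤ x → x ≤ c → P x + N x ≤ (∫ y, |G y| ∂posVol) * x := by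
    intro x hx hxc
    rw [hR x hx, intervalIntegral.integral_of_le hx, integral_Ioc_eq_integral_Ioo,
      ← integral_mul_const]
    have h1 : IntegrableOn (fun y => |G y| * x) (Ioi 0) := hG.abs.mul_const x
    calc _ ≤ ∫ y in Ioo 0 x, |G y| * x := by
          refine setIntegral_mono_on ?_ (h1.mono_set Ioo_subset_Ioi_self) measurableSet_Ioo
            fun y hy => ?_
          · exact (intervalIntegrable_iff_integrableOn_Ioo_of_le hx).1
              ((intervalIntegrable_of_posVol hG.abs le_rfl hx).continuousOn_mul continuousOn_id)
          · rw [mul_comm]; exact mul_le_mul_of_nonneg_left hy.2.le (abs_nonneg _)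
      _ ≤ _ := setIntegral_mono_set h1 (Eventually.of_forall fun y => by positivity)
          (Eventually.of_forall Ioo_subset_Ioi_self)
  have hiter : ∀ k : ℕ, ∀ x, 0 ≤ x → x ≤ c →
      P x + N x ≤ (β - α) ^ k * (∫ y, |G y| ∂posVol) * x := by
    intro k
    induction k with
    | zero => simpa using hbase
    | succ k ih =>
      intro x hx hxc
      have := hstep _ ih x hx hxc
      rwa [← mul_assoc, ← pow_succ'] at this
  have hNc0 : N c = 0 := by
    have h1 : Tendsto (fun k : ℕ => (β - α) ^ k * (∫ y, |G y| ∂posVol) * c) atTop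
        (𝓝 (0 * (∫ y, |G y| ∂posVol) * c)) :=
      ((tendsto_pow_atTop_nhds_zero_of_lt_one hκ0 hκ).mul_const _).mul_const _
    have h2 := ge_of_tendsto' h1 fun k => hiter k c hc1.1 le_rfl
    have := hPn c hc1.1
    have := hNn c hc1.1
    linarith
  filter_upwards [hright, nonpos_of_posMass_eq_zero hG' hc1.1 hNc0, Measure.ae_ne posVol c]
    with x h1 h2 h4 h3
  rcases lt_trichotomy x c with h | h | h
  · linarith [h2 ⟨h3.1, h⟩]
  · exact absurd h h4
  · exact h1 ⟨h, h3.2⟩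

lemma flux_nonneg {K : ℝ → ℝ → ℝ} (hK : ∀ x y, 0 < x → 0 < y → 0 ≤ K x y) {a b : ℝ → ℝ}
    (ha : ∀ x, 0 ≤ a x) (hb : ∀ x, 0 ≤ b x) (x : ℝ) : 0 ≤ flux K a b x := by
  refine integral_nonneg_of_ae ?_
  filter_upwards [ae_quad_pos] with q hq
  exact indicator_apply_nonneg fun _ => mul_nonneg hq.1.le
    (mul_nonneg (hK _ _ hq.1 hq.2) (mul_nonneg (ha _) (hb _)))

/-- Bounds for the flux in terms of the positive and negative masses. -/
lemma flux_bounds {K : ℝ → ℝ → ℝ} {M : ℝ} (hK : BddKernel K M) {G : ℝ → ℝ}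
    (hG : Integrable G posVol) {α β x : ℝ} (hx : 0 < x)
    (h : ∀ y ∈ Ioo 0 x, α ≤ ∫ z in Ioi (x - y), K y z * G z ∧
      ∫ z in Ioi (x - y), K y z * G z ≤ β) :
    α * posMass G x - β * posMass (fun y => -G y) x ≤ flux K G G x ∧
      flux K G G x ≤ β * posMass G x - α * posMass (fun y => -G y) x := by
  have hp := (intervalIntegrable_iff_integrableOn_Ioo_of_le hx.le).1
    (intervalIntegrable_id_mul_max hG le_rfl hx.le)
  have hn := (intervalIntegrable_iff_integrableOn_Ioo_of_le hx.le).1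
    (intervalIntegrable_id_mul_max (G := fun y => -G y) hG.neg le_rfl hx.le)
  have hF := integrableOn_flux hK hG hG x
  rw [flux_eq_iterated hK hG hG, posMass, posMass, intervalIntegral.integral_of_le hx.le,
    intervalIntegral.integral_of_le hx.le, integral_Ioc_eq_integral_Ioo,
    integral_Ioc_eq_integral_Ioo, ← integral_const_mul, ← integral_const_mul, ← integral_const_mul,
    ← integral_const_mul, ← integral_sub (hp.const_mul α) (hn.const_mul β),
    ← integral_sub (hp.const_mul β) (hn.const_mul α)]
  constructor
  · refine setIntegral_mono_on ((hp.const_mul α).sub (hn.const_mul β)) hF measurableSet_Ioo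
      fun y hy => ?_
    obtain ⟨h1, h2⟩ := h y hy
    have h3 := max_sub_max_neg (G y)
    have h4 : 0 ≤ y * max (G y) 0 := mul_nonneg hy.1.le (le_max_right _ _)
    have h5 : 0 ≤ y * max (-G y) 0 := mul_nonneg hy.1.le (le_max_right _ _)
    have h6 : y * G y = y * max (G y) 0 - y * max (-G y) 0 := by rw [← mul_sub, h3]
    rw [h6]
    nlinarith [mul_le_mul_of_nonneg_left h1 h4, mul_le_mul_of_nonneg_left h2 h5]
  · refine setIntegral_mono_on hF ((hp.const_mul β).sub (hn.const_mul α)) measurableSet_Ioo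
      fun y hy => ?_
    obtain ⟨h1, h2⟩ := h y hy
    have h3 := max_sub_max_neg (G y)
    have h4 : 0 ≤ y * max (G y) 0 := mul_nonneg hy.1.le (le_max_right _ _)
    have h5 : 0 ≤ y * max (-G y) 0 := mul_nonneg hy.1.le (le_max_right _ _)
    have h6 : y * G y = y * max (G y) 0 - y * max (-G y) 0 := by rw [← mul_sub, h3]
    rw [h6]
    nlinarith [mul_le_mul_of_nonneg_left h2 h4, mul_le_mul_of_nonneg_left h1 h5]

/-- The comparison value 2e^{-s} is the inner interaction integral for the kernel 2 and the
exponential profile; its uniform positivity on bounded ranges drives the sign argument. -/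
lemma IsPerturbation.abs_integral_kernel_sub_le {W : ℝ → ℝ → ℝ} (hW : IsPerturbation W) {ε : ℝ}
    (h0 : 0 ≤ ε) {G : ℝ → ℝ} (hG : MemX G) {y s : ℝ} (hy : 0 < y) (hs : 0 ≤ s) :
    |(∫ z in Ioi s, kernel W ε y z * G z) - 2 * Real.exp (-s)|
      ≤ 2 * nX (fun x => G x - expProfile x) + ε * nX G := by
  have hWm : AEStronglyMeasurable (fun z => W y z) posVol := by
    refine ContinuousOn.aestronglyMeasurable ?_ measurableSet_Ioi
    exact hW.continuousOn.comp (f := fun z => (y, z)) (by fun_prop) fun z hz => ⟨hy, hz⟩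
  have hWb : ∀ᵐ z ∂posVol, |W y z * G z| ≤ |G z| := by
    filter_upwards [ae_pos] with z hz
    rw [abs_mul]
    exact mul_le_of_le_one_left (abs_nonneg _)
      (abs_le.2 ⟨by linarith [hW.nonneg y z hy hz], hW.le_one y z hy hz⟩)
  have hWi : Integrable (fun z => W y z * G z) posVol :=
    hG.integrable.abs.mono' (hWm.mul hG.aesm) hWb
  have hd := hG.sub memX_expProfile
  have hset : ∀ {f : ℝ → ℝ}, Integrable f posVol → IntegrableOn f (Ioi s) := fun hf =>
    IntegrableOn.mono_set hf (Ioi_subset_Ioi hs)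
  have h1 : (∫ z in Ioi s, kernel W ε y z * G z) - 2 * Real.exp (-s)
      = 2 * tail (fun x => G x - expProfile x) s + ε * tail (fun z => W y z * G z) s := by
    rw [tail_sub hG.integrable memX_expProfile.integrable hs, tail_expProfile]
    have h2 : ∫ z in Ioi s, kernel W ε y z * G z
        = ∫ z in Ioi s, (2 * G z + ε * (W y z * G z)) := by
      congr 1; ext z; rw [kernel]; ring
    rw [h2, integral_add ((hset hG.integrable).const_mul 2) ((hset hWi).const_mul ε),
      integral_const_mul, integral_const_mul, tail, tail]
    ring
  rw [h1]
  refine (abs_add_le _ _).trans (add_le_add ?_ ?_)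
  · rw [abs_mul, abs_of_pos two_pos]
    exact mul_le_mul_of_nonneg_left ((abs_tail_le hd.integrable hs).trans hd.integral_abs_le)
      two_pos.le
  · rw [abs_mul, abs_of_nonneg h0]
    refine mul_le_mul_of_nonneg_left ((abs_tail_le hWi hs).trans ?_) h0
    exact (integral_mono_ae hWi.abs hG.integrable.abs hWb).trans hG.integral_abs_le

/-- A crude bound, enough to keep 2e^{-x} above the error 1/150000 for sizes up to 10. -/
lemma le_exp_neg_of_le_ten {x : ℝ} (hx : x ≤ 10) : 1 / 60000 ≤ Real.exp (-x) := by
  have h1 : Real.exp 10 ≤ 60000 := by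
    have h2 : Real.exp 10 = Real.exp 1 ^ 10 := by rw [← Real.exp_nat_mul]; norm_num
    rw [h2]
    calc Real.exp 1 ^ 10 ≤ 2.7183 ^ 10 :=
          pow_le_pow_left₀ (Real.exp_pos 1).le (by have := Real.exp_one_lt_d9; linarith) 10
      _ ≤ 60000 := by norm_num
  have h2 : Real.exp (-10) ≤ Real.exp (-x) := Real.exp_le_exp.2 (by linarith)
  have h3 : Real.exp (-10) * Real.exp 10 = 1 := by rw [← Real.exp_add]; simp
  nlinarith [Real.exp_pos (-10)]

/-- A solution without negative part on `(0, a)` has none on `(0, a + h)`, as long as the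
interaction is nonnegative. -/
lemma negMass_step {G : ℝ → ℝ} (hG : Integrable G posVol) {a h : ℝ} (ha : 1 / 4 ≤ a)
    (hh : 0 ≤ h) (hh1 : h ≤ 1 / 24)
    (hlo : ∀ᵐ x ∂posVol, x ∈ Ioo a (a + h) → -(3 * posMass (fun y => -G y) x) ≤ x ^ 2 * G x)
    (h0 : posMass (fun y => -G y) a = 0) : posMass (fun y => -G y) (a + h) = 0 := by
  have hG' : Integrable (fun y => -G y) posVol := hG.neg
  have ha0 : 0 ≤ a := by linarith
  set I := posMass (fun y => -G y) (a + h) with hI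
  have hI0 : 0 ≤ I := by
    have := posMass_mono hG' ha0 (by linarith : a ≤ a + h)
    rwa [h0] at this
  have h1 : I = ∫ y in a..(a + h), y * max (-G y) 0 := by
    have := posMass_sub hG' ha0 (by linarith : 0 ≤ a + h)
    rw [h0, sub_zero] at this
    exact this
  -- Here 12 = 3/(1/4) from y ≥ 1/4. A step of length at most 1/24 then gives I ≤ I/2.
  have h2 : ∀ᵐ y ∂volume, y ∈ Ioo a (a + h) → y * max (-G y) 0 ≤ 12 * I := by
    filter_upwards [(ae_restrict_iff' measurableSet_Ioi).1 hlo] with y h3 h4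
    have hy0 : 0 < y := by linarith [h4.1]
    have h5 := h3 hy0 h4
    have h6 := posMass_mono hG' hy0.le h4.2.le
    rcases le_total 0 (G y) with h7 | h7
    · rw [max_eq_right (by linarith)]; simpa using hI0
    · rw [max_eq_left (by linarith)]
      have h8 : 0 ≤ y * -G y := mul_nonneg hy0.le (by linarith)
      nlinarith [h4.1]
  have h3 : I ≤ 12 * I * h := by
    calc I = ∫ y in Ioo a (a + h), y * max (-G y) 0 := by
          rw [h1, intervalIntegral.integral_of_le (by linarith), integral_Ioc_eq_integral_Ioo]
      _ ≤ ∫ y in Ioo a (a + h), 12 * I := by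
          refine setIntegral_mono_on_ae ?_ (integrableOn_const (by simp)) measurableSet_Ioo h2
          exact (intervalIntegrable_iff_integrableOn_Ioo_of_le (by linarith)).1
            (intervalIntegrable_id_mul_max hG' ha0 (by linarith))
      _ = _ := by simp [hh, mul_comm]
  nlinarith

/-- A solution which is nonnegative up to size `10` is nonnegative. -/
lemma nonneg_of_nonneg_lt_ten {K : ℝ → ℝ → ℝ} {M : ℝ} (hK : BddKernel K M) (hM : M ≤ 4)
    (hK0 : ∀ x y, 0 < x → 0 < y → 0 ≤ K x y) {G : ℝ → ℝ} (hG : MemX G)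
    (hGe : G =ᵐ[posVol] gain K G G) (hm : ∫ x, |x * G x| ∂posVol ≤ 9 / 8)
    (h10 : ∀ᵐ x ∂posVol, x ∈ Ioo 0 10 → 0 ≤ G x) : ∀ᵐ x ∂posVol, 0 ≤ G x := by
  have hpi : Integrable (fun y => max (G y) 0) posVol := hG.integrable.pos_part
  have hni : Integrable (fun y => max (-G y) 0) posVol := hG.integrable.neg_part
  have habs : ∀ y, |max (G y) 0| ≤ |G y| ∧ |max (-G y) 0| ≤ |G y| := fun y => by
    rw [abs_of_nonneg (le_max_right (G y) 0), abs_of_nonneg (le_max_right (-G y) 0)]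
    exact ⟨max_le (le_abs_self _) (abs_nonneg _), max_le (neg_le_abs _) (abs_nonneg _)⟩
  have hpw : Integrable (fun y => |max (G y) 0| * y) posVol := by
    refine hG.integrable_id.abs.mono' (hpi.1.norm.mul (by fun_prop)) ?_
    filter_upwards [ae_pos] with y hy
    rw [Real.norm_eq_abs, abs_mul, abs_abs, abs_of_pos hy, abs_mul, abs_of_pos hy, mul_comm y]
    exact mul_le_mul_of_nonneg_right (habs y).1 hy.le
  have hnw : Integrable (fun y => |max (-G y) 0| * y) posVol := by
    refine hG.integrable_id.abs.mono' (hni.1.norm.mul (by fun_prop)) ?_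
    filter_upwards [ae_pos] with y hy
    rw [Real.norm_eq_abs, abs_mul, abs_abs, abs_of_pos hy, abs_mul, abs_of_pos hy, mul_comm y]
    exact mul_le_mul_of_nonneg_right (habs y).2 hy.le
  have hpm : ∫ y, |max (G y) 0| * y ∂posVol ≤ 9 / 8 := by
    refine le_trans (integral_mono_ae hpw hG.integrable_id.abs ?_) hm
    filter_upwards [ae_pos] with y hy
    rw [abs_mul, abs_of_pos hy, mul_comm y]
    exact mul_le_mul_of_nonneg_right (habs y).1 hy.le
  set m := ∫ y, |max (-G y) 0| * y ∂posVol with hmdef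
  have hm0 : 0 ≤ m := integral_nonneg_of_ae (by
    filter_upwards [ae_pos] with y hy using mul_nonneg (abs_nonneg _) hy.le)
  -- The negative part lives on x ≥ 10, where x|G| = |flux|/x ≤ |flux|/10; hence the constant test
  -- function 1/10.
  have hθ : ∀ y z : ℝ, 0 < y → 0 < z →
      y * ∫ x in Ioo y (y + z), |(1 : ℝ) / 10| ≤ y / 10 * z := by
    intro y z hy hz
    simp only [integral_const, MeasurableSet.univ, measureReal_restrict_apply, univ_inter,
      Real.volume_real_Ioo, smul_eq_mul, add_sub_cancel_left, max_eq_left hz.le]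
    rw [abs_of_pos (by norm_num)]
    linarith
  have ht : ∀ {a b : ℝ → ℝ}, Integrable a posVol → Integrable b posVol →
      Integrable (fun y => |a y| * y) posVol → Integrable (fun y => |b y| * y) posVol →
      Integrable (fun x => 1 / 10 * flux K a b x) posVol ∧
      ∫ x, |1 / 10 * flux K a b x| ∂posVol
        ≤ M * ((∫ y, |a y| * (y / 10) ∂posVol) * ∫ z, |b z| * z ∂posVol) := by
    intro a b ha hb haw hbw
    have h := flux_test hK (θ := fun _ => (1 : ℝ) / 10) (w₁ := fun y => y / 10) (w₂ := fun z => z)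
      measurable_const (fun y z _ _ => integrableOn_const (by simp)) hθ ha.1 hb.1
      ((haw.div_const 10).congr (Eventually.of_forall fun y => by simp only; ring)) hbw
    exact ⟨h.1, h.2.1⟩
  have hdiv : ∀ a : ℝ → ℝ, ∫ y, |a y| * (y / 10) ∂posVol = (∫ y, |a y| * y ∂posVol) / 10 := by
    intro a
    rw [← integral_div]
    exact integral_congr_ae (Eventually.of_forall fun y => by simp only; ring)
  have h1 := ht hpi hni hpw hnw
  have h2 := ht hni hpi hnw hpw
  rw [hdiv] at h1 h2
  have hfn : ∀ {a b : ℝ → ℝ}, (∀ x, 0 ≤ a x) → (∀ x, 0 ≤ b x) → ∀ x, 0 ≤ flux K a b x :=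
    fun ha hb => flux_nonneg hK0 ha hb
  have hp0 : ∀ x, 0 ≤ max (G x) 0 := fun x => le_max_right _ _
  have hn0 : ∀ x, 0 ≤ max (-G x) 0 := fun x => le_max_right _ _
  -- Only the mixed fluxes of positive with negative part can make G negative.
  have hle : ∀ᵐ x ∂posVol, |max (-G x) 0| * x
      ≤ |1 / 10 * flux K (fun y => max (G y) 0) (fun y => max (-G y) 0) x|
        + |1 / 10 * flux K (fun y => max (-G y) 0) (fun y => max (G y) 0) x| := by
    filter_upwards [hGe, ae_pos, h10] with x hx hx0 hx10
    have f1 := hfn hp0 hp0 x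
    have f2 := hfn hp0 hn0 x
    have f3 := hfn hn0 hp0 x
    have f4 := hfn hn0 hn0 x
    rw [abs_of_nonneg (hn0 x), abs_of_nonneg (by positivity), abs_of_nonneg (by positivity)]
    rcases le_total 0 (G x) with h3 | h3
    · rw [max_eq_right (by linarith), zero_mul]; positivity
    rcases lt_or_ge x 10 with h4 | h4
    · rw [max_eq_right (by linarith [hx10 ⟨hx0, h4⟩]), zero_mul]; positivity
    rw [max_eq_left (by linarith)]
    have h5 : x ^ 2 * G x = flux K G G x := by rw [hx, gain]; field_simp
    have hsplit : G =ᵐ[posVol] fun y => max (G y) 0 - max (-G y) 0 :=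
      Eventually.of_forall fun y => (max_sub_max_neg (G y)).symm
    have hdi : Integrable (fun y => max (G y) 0 - max (-G y) 0) posVol := hpi.sub hni
    rw [flux_congr hsplit hsplit, flux_sub_left hK hpi hni hdi,
      flux_sub_right hK hpi hpi hni, flux_sub_right hK hni hpi hni] at h5
    have h6 : 0 ≤ x * -G x := mul_nonneg hx0.le (by linarith)
    nlinarith
  -- The factor is 2 · M · (9/8)/10 with M ≤ 4.
  have hmm : m ≤ 9 / 10 * m := by
    calc m ≤ ∫ x, (|1 / 10 * flux K (fun y => max (G y) 0) (fun y => max (-G y) 0) x|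
        + |1 / 10 * flux K (fun y => max (-G y) 0) (fun y => max (G y) 0) x|) ∂posVol :=
          integral_mono_ae hnw (h1.1.abs.add h2.1.abs) hle
      _ ≤ 9 / 10 * m := by
          rw [integral_add h1.1.abs h2.1.abs]
          have h3 := h1.2
          have h4 := h2.2
          have h5 : (∫ y, |max (G y) 0| * y ∂posVol) / 10 * m ≤ 9 / 80 * m :=
            mul_le_mul_of_nonneg_right (by linarith) hm0
          have h6 : 0 ≤ 9 / 80 * m - (∫ y, |max (G y) 0| * y ∂posVol) / 10 * m := by linarith
          have h8 := hK.nonneg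
          nlinarith
  have hmz : m = 0 := by linarith
  rw [hmdef, integral_eq_zero_iff_of_nonneg_ae (by
    filter_upwards [ae_pos] with y hy using mul_nonneg (abs_nonneg _) hy.le) hnw] at hmz
  filter_upwards [hmz, ae_pos] with x h3 h4
  have h5 := (mul_eq_zero.1 h3).resolve_right h4.ne'
  rw [abs_eq_zero] at h5
  linarith [max_eq_right_iff.1 h5]

/-- On (0, 1/4) one has e^{-y} ≥ 3/4, and 3/128 is the integral of 3y/4. This starts the cone
argument at its right endpoint. -/
lemma posMass_exp_bounds {G : ℝ → ℝ} (hG : MemX G) {δ : ℝ}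
    (hc : nX (fun x => G x - expProfile x) ≤ δ) :
    3 / 128 - δ ≤ posMass G (1 / 4) ∧ posMass (fun y => -G y) (1 / 4) ≤ δ := by
  have hd := hG.sub memX_expProfile
  have hi : IntervalIntegrable (fun y => |y * (G y - expProfile y)|) volume 0 (1 / 4) :=
    intervalIntegrable_of_posVol hd.integrable_id.abs le_rfl (by norm_num)
  have h1 : ∫ y in (0 : ℝ)..(1 / 4), |y * (G y - expProfile y)| ≤ δ := by
    rw [intervalIntegral.integral_of_le (by norm_num)]
    refine le_trans ?_ (hd.integral_id_le.trans hc)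
    exact setIntegral_mono_set hd.integrable_id.abs (Eventually.of_forall fun y => abs_nonneg _)
      (Eventually.of_forall Ioc_subset_Ioi_self)
  have h2 : ∫ y in (0 : ℝ)..(1 / 4), 3 / 4 * y = 3 / 128 := by
    rw [intervalIntegral.integral_const_mul, integral_id]; norm_num
  have hi2 : IntervalIntegrable (fun y : ℝ => 3 / 4 * y) volume 0 (1 / 4) :=
    (by fun_prop : Continuous fun y : ℝ => 3 / 4 * y).intervalIntegrable _ _
  constructor
  · have h3 : ∫ y in (0 : ℝ)..(1 / 4), (3 / 4 * y - |y * (G y - expProfile y)|)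
        ≤ posMass G (1 / 4) := by
      refine intervalIntegral.integral_mono_on (by norm_num) (hi2.sub hi)
        (intervalIntegrable_id_mul_max hG.integrable le_rfl (by norm_num)) fun y hy => ?_
      have h4 : 3 / 4 ≤ expProfile y := by
        have := Real.add_one_le_exp (-y)
        rw [expProfile]; linarith [hy.2]
      have h5 := neg_abs_le (y * (G y - expProfile y))
      have h6 := mul_le_mul_of_nonneg_left (le_max_left (G y) 0) hy.1
      nlinarith [mul_le_mul_of_nonneg_left h4 hy.1]
    rw [intervalIntegral.integral_sub hi2 hi, h2] at h3
    linarith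
  · refine le_trans (intervalIntegral.integral_mono_on (by norm_num)
      (intervalIntegrable_id_mul_max hG.integrable.neg le_rfl (by norm_num)) hi fun y hy => ?_) h1
    rw [abs_mul, abs_of_nonneg hy.1]
    refine mul_le_mul_of_nonneg_left (max_le ?_ (abs_nonneg _)) hy.1
    have := neg_abs_le (G y - expProfile y)
    linarith [expProfile_pos y]

/-- Fixed points near the exponential profile are nonnegative. -/
theorem nonneg_of_eq_gain {W : ℝ → ℝ → ℝ} (hW : IsPerturbation W) {ε : ℝ} (h0 : 0 ≤ ε)
    (h1 : ε ≤ 1 / 1000000) {G : ℝ → ℝ} (hG : MemX G) (hGe : G =ᵐ[posVol] gain (kernel W ε) G G)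
    (hc : nX (fun x => G x - expProfile x) ≤ 1 / 1000000) : ∀ᵐ x ∂posVol, 0 ≤ G x := by
  have hK := hW.bddKernel_kernel h0
  have hGi := hG.integrable
  have hGn : Integrable (fun y => -G y) posVol := hGi.neg
  have hG4 : nX G ≤ 4 := by
    have h2 := nX_add_le (hG.sub memX_expProfile) memX_expProfile
    rw [nX_expProfile] at h2
    simp only [sub_add_cancel] at h2
    have h3 : nX (fun x => G x) = nX G := rfl
    linarith
  have hA : ∀ y s, 0 < y → 0 ≤ s →
      |(∫ z in Ioi s, kernel W ε y z * G z) - 2 * Real.exp (-s)| ≤ 1 / 150000 := by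
    intro y s hy hs
    have h2 := hW.abs_integral_kernel_sub_le h0 hG hy hs
    nlinarith [nX_nonneg G]
  have hflux : ∀ᵐ x ∂posVol, x ^ 2 * G x = flux (kernel W ε) G G x := by
    filter_upwards [hGe, ae_pos] with x hx hx0
    rw [hx, gain]; field_simp
  -- For separations below 1/4, 2e^{-s} lies in [3/2, 2]. The margins 1.49 and 2.01 absorb the
  -- error, and their difference 0.52 is below 1, as the cone argument needs.
  have hnear : ∀ x, 0 < x → x ≤ 1 / 4 →
      149 / 100 * posMass G x - 201 / 100 * posMass (fun y => -G y) x ≤ flux (kernel W ε) G G x ∧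
      flux (kernel W ε) G G x
        ≤ 201 / 100 * posMass G x - 149 / 100 * posMass (fun y => -G y) x := by
    intro x hx hx1
    refine flux_bounds hK hGi hx fun y hy => ?_
    have h2 := abs_le.1 (hA y (x - y) hy.1 (by linarith [hy.2]))
    have h3 := Real.add_one_le_exp (-(x - y))
    have h4 : Real.exp (-(x - y)) ≤ 1 := Real.exp_le_one_iff.2 (by linarith [hy.2])
    constructor <;> linarith [hy.1]
  have hfar : ∀ x, 0 < x → x ≤ 10 →
      -(3 * posMass (fun y => -G y) x) ≤ flux (kernel W ε) G G x := by
    intro x hx hx1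
    have h2 := (flux_bounds hK hGi (α := 0) (β := 3) hx fun y hy => by
      have h2 := abs_le.1 (hA y (x - y) hy.1 (by linarith [hy.2]))
      have h3 := le_exp_neg_of_le_ten (x := x - y) (by linarith [hy.1])
      have h4 : Real.exp (-(x - y)) ≤ 1 := Real.exp_le_one_iff.2 (by linarith [hy.2])
      constructor <;> linarith).1
    linarith
  have hquarter : ∀ᵐ x ∂posVol, x ∈ Ioo (0 : ℝ) (1 / 4) → 0 ≤ G x := by
    refine nonneg_near_zero hGi (α := 149 / 100) (β := 201 / 100) (by norm_num) (by norm_num)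
      (by norm_num) (by norm_num) ?_ ?_ ?_
    · filter_upwards [hflux] with x hx hx1
      rw [hx]; exact (hnear x hx1.1 hx1.2.le).1
    · filter_upwards [hflux] with x hx hx1
      rw [hx]; exact (hnear x hx1.1 hx1.2.le).2
    · have := posMass_exp_bounds hG hc
      linarith [this.1, this.2]
  -- 234 steps of length 1/24 lead from 1/4 exactly to 10.
  have hiter : ∀ k : ℕ, k ≤ 234 → posMass (fun y => -G y) (1 / 4 + k / 24) = 0 := by
    intro k
    induction k with
    | zero =>
      intro _
      rw [← posMass_eq_of_nonpos hGn le_rfl (by norm_num) (a := 0)]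
      · exact intervalIntegral.integral_same
      · filter_upwards [hquarter] with x hx hx1
        simp only [Nat.cast_zero, zero_div, add_zero] at hx1
        linarith [hx hx1]
    | succ k ih =>
      intro hk
      have hk2 : (k : ℝ) + 1 ≤ 234 := by exact_mod_cast hk
      have hk0 : (0 : ℝ) ≤ k := k.cast_nonneg
      have h2 := negMass_step hGi (a := 1 / 4 + k / 24) (h := 1 / 24) (by linarith) (by norm_num)
        le_rfl (by
          filter_upwards [hflux, ae_pos] with x hx hx0 hx1
          rw [hx]
          exact hfar x hx0 (by linarith [hx1.2])) (ih (by omega))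
      have h3 : (1 : ℝ) / 4 + ((k + 1 : ℕ) : ℝ) / 24 = 1 / 4 + k / 24 + 1 / 24 := by
        push_cast; ring
      rw [h3]
      exact h2
  have hten := hiter 234 le_rfl
  have h10 : (1 : ℝ) / 4 + ((234 : ℕ) : ℝ) / 24 = 10 := by norm_num
  rw [h10] at hten
  refine nonneg_of_nonneg_lt_ten hK (by linarith) (fun x y hx hy => ?_) hG hGe ?_ ?_
  · have := hW.nonneg x y hx hy
    rw [kernel]; positivity
  · have hd := hG.sub memX_expProfile
    have he := integrable_pow_expProfile 1
    calc ∫ x, |x * G x| ∂posVol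
        ≤ ∫ x, (|x * (G x - expProfile x)| + x ^ 1 * expProfile x) ∂posVol := by
          refine integral_mono_ae hG.integrable_id.abs (hd.integrable_id.abs.add he) ?_
          filter_upwards [ae_pos] with x hx
          have h2 : x * G x = x * (G x - expProfile x) + x * expProfile x := by ring
          rw [h2, pow_one]
          refine (abs_add_le _ _).trans (add_le_add_right ?_ _)
          rw [abs_of_pos (mul_pos hx (expProfile_pos x))]
      _ ≤ 9 / 8 := by
          rw [integral_add hd.integrable_id.abs he, integral_pow_expProfile]
          have h2 := hd.integral_id_le
          simp only [Nat.factorial_one, Nat.cast_one]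
          linarith
  · filter_upwards [nonpos_of_posMass_eq_zero hGn (by norm_num) hten] with x hx hx1
    linarith [hx hx1]

end Smoluchowski

/-! ### Conclusion -/

/-- There is `ε₁ > 0` (the same for all admissible `W`) such that for every `0 ≤ ε ≤ ε₁` the kernel
`2 + ε W` has exactly one self-similar profile of mass `1`, up to equality almost everywhere. -/
theorem corollary7p8 :
    ∃ ε₁ : ℝ, 0 < ε₁ ∧
      ∀ W : ℝ → ℝ → ℝ, Smoluchowski.IsPerturbation W →
        ∀ ε : ℝ, 0 ≤ ε → ε ≤ ε₁ →
          ∃ G : ℝ → ℝ,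
            (Smoluchowski.IsProfile (Smoluchowski.kernel W ε) G ∧ Smoluchowski.mass G = 1) ∧
            ∀ H : ℝ → ℝ,
              Smoluchowski.IsProfile (Smoluchowski.kernel W ε) H → Smoluchowski.mass H = 1 →
                H =ᵐ[volume.restrict (Ioi (0 : ℝ))] G := by
  obtain ⟨ε₀, hε₀, -, hclose⟩ := Smoluchowski.exists_forall_profile_close (δ := 1 / 1000000) (by norm_num)
  -- ε₀ places every profile in the uniqueness ball; the second bound is the condition ε ≤ δ/1000000
  -- of the contraction with δ = 1/1000000.
  refine ⟨min ε₀ (1 / 1000000 / 1000000), lt_min hε₀ (by norm_num), fun W hW ε h0 hε => ?_⟩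
  have h1 : ε ≤ 1 / 1000000 / 1000000 := hε.trans (min_le_right _ _)
  have h2 : ε ≤ 1 / 1000000 := h1.trans (by norm_num)
  have hK := hW.bddKernel_kernel h0
  have hs := hW.kernel_symm ε
  obtain ⟨G, hG, hGe, hm, hc⟩ :=
    Smoluchowski.exists_eq_gain hW (by norm_num : (0 : ℝ) < 1 / 1000000) le_rfl h0 h1
  refine ⟨G, ⟨Smoluchowski.isProfile_of_eq_gain hK hs hG.memL11
    (Smoluchowski.nonneg_of_eq_gain hW h0 h2 hG hGe hc) hGe, hm⟩, fun H hH hHm => ?_⟩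
  refine Smoluchowski.ae_eq_of_eq_gain hW h0 h2 hG (hH.memX hW h0 hHm) hGe (hH.eq_gain hK hs) ?_ hc
    (hclose W hW ε h0 (hε.trans (min_le_left _ _)) H hH hHm)
  rw [hm, Smoluchowski.IsProfile.integral_id hHm]
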